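/- Let $\Sigma$ be a Hausdorff surface of class $C^6$, $\nabla$ a torsion-free affine connection of class $C^4$ on $\Sigma$, and $\epsilon_{ab}$ a volume form on $\Sigma$ (so $\Sigma$ is orientable; the choice of $\epsilon$ does not matter), with $\epsilon^{ab}$ defined by $\epsilon^{ab}\epsilon_{cb}=\delta^a_c$, and $V^a=\epsilon^{ab}V_b$, $V_a=\epsilon_{ba}V^b$. A linear first integral of the geodesic flow on an open set $U\subset\Sigma$ is a $C^1$ one-form $K$ on $U$ with $\nabla_{(a}K_{b)}=0$; first integrals are independent if they are linearly independent over $\mathbb R$ as one-forms on $U$. **Invariants.** Let $[\nabla_a,\nabla_b]X^c=R_{ab}{}^c{}_dX^d$, $R_{ab}=R_{ca}{}^c{}_b$, $\mathrm P_{ab}=\tfrac23R_{ab}+\tfrac13R_{ba}$, $B_{ab}=\mathrm P_{ba}-\mathrm P_{ab}$, $\beta=B_{ab}\epsilon^{ab}$, $Y_{cdb}=\nabla_{[c}\mathrm P_{d]b}$, $L_b=\epsilon^{cd}\nabla_c\mathrm P_{db}$, and $$F^a=\tfrac13\epsilon^{ab}(L_b-\epsilon^{cd}\nabla_bB_{cd}),\qquad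 N_a=-F_a+\epsilon^{bc}\nabla_aB_{bc},$$ $$M_a{}^b=\tfrac13\epsilon^{bc}\epsilon^{de}(\nabla_aY_{dec}-\nabla_a\nabla_cB_{de})+\beta\,\mathrm P^b{}_a+\tfrac12\beta^2\delta^b{}_a,\qquad \mathcal M=\begin{pmatrix}F^1&F^2&\beta\\ M_1{}^1&M_1{}^2&N_1\\ M_2{}^1&M_2{}^2&N_2\end{pmatrix},$$ $$I_N=\epsilon_{cd}\epsilon^{be}M_e{}^c\big(N_bF^d-\tfrac12\beta M_b{}^d\big),\qquad T_a{}^b=N_aF^b-\beta M_a{}^b,$$ $$U^b_{ca}=\epsilon^{bd}\epsilon^{ef}\big[\tfrac13(\nabla_c\nabla_aY_{efd}-\nabla_c\nabla_a\nabla_dB_{ef})+\nabla_c(B_{ef}\mathrm P_{da})\big]+\tfrac12\epsilon^{ef}\epsilon^{gh}\nabla_c(B_{ef}B_{gh})\delta^b{}_a+\epsilon^{bd}N_a(\mathrm P_{dc}+\tfrac12\beta\epsilon_{cd}),$$ $$V_{ca}=-M_{ac}-\tfrac13\epsilon^{de}(\nabla_c\nabla_d\mathrm P_{ea}-4\nabla_c\nabla_aB_{de}),$$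 $$W_{abc}=F_eM_a{}^eV_{(bc)}-F_eU^e_{(bc)}N_a+\beta M_{ae}U^e_{(bc)},\qquad I_S=(W_{111},W_{222}).$$ Call $p\in\Sigma$ regular if the rank of $\mathcal M$ is constant near $p$. Projective flatness on $U$ means that around every point of $U$ there are $C^6$ coordinates in which $\Gamma^c_{ab}=\Upsilon_a\delta^c_b+\Upsilon_b\delta^c_a$ for some $\Upsilon_a$, i.e. in which the unparametrised geodesics are straight lines. **Theorem.** 1. If $\nabla$ admits a nonzero linear first integral on a connected open set $U\subset\Sigma$ (for instance on $\Sigma$, if $\Sigma$ is connected), then $I_N=0$ and $I_S=0$ on $U$, in all local coordinates. 2. The regular points form a dense (open) subset of $\Sigma$. 3. Let $p\in\Sigma$ and fix local coordinates around $p$. Every neighbourhood of $p$ contains a connected open neighbourhood $U$ of $p$, inside the coordinate domain, such that: - if $p$ is regular and $I_N=I_S=0$ on $U$, then $\nabla$ admits a nonzero linear first integral on $U$; - if $p$ is regular, then $\nabla$ admits precisely two independent linear first integrals on $U$ if and only if $T=0$ on $U$ and the skew part of the Ricci tensor of $\nabla$ is nonzero (not identically zero) on $U$; - whether or not $p$ is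 regular: if $\nabla$ admits precisely two independent linear first integrals on $U$, then $T=0$ on $U$ and the skew part of the Ricci tensor is not identically zero on $U$; and if $T=0$ on $U$ and the skew part of the Ricci tensor vanishes nowhere on $U$, then $\nabla$ admits precisely two independent linear first integrals on $U$; - whether or not $p$ is regular: $\nabla$ admits three independent linear first integrals (and no more) on $U$ if and only if $\nabla$ is projectively flat on $U$ and its Ricci tensor is symmetric on $U$. -/

import Mathlib

open Set Filter Topology
open scoped Manifold ContDiff Bundle

noncomputable section

namespace AffineSurface

/-- The coordinate plane. Tensor indices take the values `0, 1 : Fin 2`. -/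
abbrev Plane := EuclideanSpace ℝ (Fin 2)

/-- A surface of class `C^6` is in particular one of class `C^2`. -/
instance isManifoldTwo {S : Type*} [TopologicalSpace S] [ChartedSpace Plane S]
    [IsManifold (𝓡 2) 6 S] : IsManifold (𝓡 2) 2 S :=
  IsManifold.of_le (n := 6) (by norm_cast)

/-! ### Tensor calculus in a coordinate domain

`Γ x c a b` is the Christoffel symbol `Γ^c_{ab}` at `x`, i.e. `∇_a ∂_b = Γ^c_{ab} ∂_c`, and
`v x` is the component `ε_{12}` of the volume form at `x`. -/

/-- Components of a covariant tensor field with `n` indices. -/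
abbrev CoTensor (n : ℕ) := Plane → (Fin n → Fin 2) → ℝ

/-- The partial derivative `∂_a f`. -/
def pd (a : Fin 2) (f : Plane → ℝ) (x : Plane) : ℝ :=
  fderiv ℝ f x (EuclideanSpace.single a 1)

/-- Kronecker delta. -/
def kron (a b : Fin 2) : ℝ := if a = b then 1 else 0

/-- The sign with `alt 0 1 = 1`, `alt 1 0 = -1`. -/
def alt (a b : Fin 2) : ℝ := if a = b then 0 else if a = 0 then 1 else -1

section Coordinates

variable (Γ : Plane → Fin 2 → Fin 2 → Fin 2 → ℝ) (v : Plane → ℝ)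

/-- The covariant derivative of a covariant tensor; the first index is the new one:
`∇_a T_{i…} = ∂_a T_{i…} - ∑_k Γ^d_{a i_k} T_{… d …}`. -/
def nabla {n : ℕ} (T : CoTensor n) : CoTensor (n + 1) := fun x i =>
  pd (i 0) (fun y => T y (Fin.tail i)) x
    - ∑ k : Fin n, ∑ d, Γ x d (i 0) (i k.succ) * T x (Function.update (Fin.tail i) k d)

/-- The curvature `R_{ab}{}^c{}_d`, with `[∇_a, ∇_b] X^c = R_{ab}{}^c{}_d X^d`. -/
def curv (x : Plane) (a b c d : Fin 2) : ℝ :=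
  pd a (fun y => Γ y c b d) x - pd b (fun y => Γ y c a d) x
    + ∑ k, (Γ x c a k * Γ x k b d - Γ x c b k * Γ x k a d)

/-- The Ricci tensor `R_{ab} = R_{ca}{}^c{}_b`. -/
def ricci (x : Plane) (a b : Fin 2) : ℝ := ∑ c, curv Γ x c a c b

/-- The Schouten tensor `P_{ab} = (2/3) R_{ab} + (1/3) R_{ba}`. -/
def schouten : CoTensor 2 := fun x i =>
  2 / 3 * ricci Γ x (i 0) (i 1) + 1 / 3 * ricci Γ x (i 1) (i 0)

/-- `B_{ab} = P_{ba} - P_{ab}`. -/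
def skewB : CoTensor 2 := fun x i => schouten Γ x ![i 1, i 0] - schouten Γ x ![i 0, i 1]

/-- `Y_{cdb} = ∇_{[c} P_{d]b}`. -/
def tensorY : CoTensor 3 := fun x i =>
  1 / 2 * (nabla Γ (schouten Γ) x ![i 0, i 1, i 2] - nabla Γ (schouten Γ) x ![i 1, i 0, i 2])

/-- `ε_{ab}`. -/
def epsLo (x : Plane) (a b : Fin 2) : ℝ := alt a b * v x

/-- `ε^{ab}`, normalised by `ε^{ab} ε_{cb} = δ^a_c`. -/
def epsUp (x : Plane) (a b : Fin 2) : ℝ := alt a b / v x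

/-- `β = B_{ab} ε^{ab}`. -/
def beta (x : Plane) : ℝ := ∑ a, ∑ b, skewB Γ x ![a, b] * epsUp v x a b

/-- The Cotton tensor `L_b = ε^{cd} ∇_c P_{db}`. -/
def cotton (x : Plane) (b : Fin 2) : ℝ :=
  ∑ c, ∑ d, epsUp v x c d * nabla Γ (schouten Γ) x ![c, d, b]

/-- `F^a = (1/3) ε^{ab} (L_b - ε^{cd} ∇_b B_{cd})`. -/
def vecF (x : Plane) (a : Fin 2) : ℝ :=
  1 / 3 * ∑ b, epsUp v x a b *
    (cotton Γ v x b - ∑ c, ∑ d, epsUp v x c d * nabla Γ (skewB Γ) x ![b, c, d])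

/-- `F_a = ε_{ba} F^b`. -/
def covF (x : Plane) (a : Fin 2) : ℝ := ∑ b, epsLo v x b a * vecF Γ v x b

/-- `P^b{}_a = ε^{bc} P_{ca}`, written `schoutenUp Γ v x b a`. -/
def schoutenUp (x : Plane) (b a : Fin 2) : ℝ := ∑ c, epsUp v x b c * schouten Γ x ![c, a]

/-- `M_a{}^b = (1/3) ε^{bc} ε^{de} (∇_a Y_{dec} - ∇_a ∇_c B_{de}) + β P^b{}_a + (1/2) β² δ^b_a`,
written `tensorM Γ v x a b`. -/
def tensorM (x : Plane) (a b : Fin 2) : ℝ :=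
  1 / 3 * ∑ c, ∑ d, ∑ e, epsUp v x b c * epsUp v x d e *
      (nabla Γ (tensorY Γ) x ![a, d, e, c] - nabla Γ (nabla Γ (skewB Γ)) x ![a, c, d, e])
    + beta Γ v x * schoutenUp Γ v x b a + 1 / 2 * beta Γ v x ^ 2 * kron b a

/-- `M_{ac} = ε_{bc} M_a{}^b`. -/
def lowM (x : Plane) (a c : Fin 2) : ℝ := ∑ b, epsLo v x b c * tensorM Γ v x a b

/-- `N_a = -F_a + ε^{bc} ∇_a B_{bc}`. -/
def covN (x : Plane) (a : Fin 2) : ℝ :=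
  -covF Γ v x a + ∑ b, ∑ c, epsUp v x b c * nabla Γ (skewB Γ) x ![a, b, c]

/-- The `3 × 3` matrix with rows `(F^1, F^2, β)`, `(M_1{}^1, M_1{}^2, N_1)`,
`(M_2{}^1, M_2{}^2, N_2)`. -/
def obstructionMatrix (x : Plane) : Matrix (Fin 3) (Fin 3) ℝ :=
  !![vecF Γ v x 0, vecF Γ v x 1, beta Γ v x;
     tensorM Γ v x 0 0, tensorM Γ v x 0 1, covN Γ v x 0;
     tensorM Γ v x 1 0, tensorM Γ v x 1 1, covN Γ v x 1]

/-- `I_N = ε_{cd} ε^{be} M_e{}^c (N_b F^d - (1/2) β M_b{}^d)`. -/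
def invN (x : Plane) : ℝ :=
  ∑ b, ∑ c, ∑ d, ∑ e, epsLo v x c d * epsUp v x b e * tensorM Γ v x e c *
    (covN Γ v x b * vecF Γ v x d - 1 / 2 * beta Γ v x * tensorM Γ v x b d)

/-- `T_a{}^b = N_a F^b - β M_a{}^b`, written `tensorT Γ v x a b`. -/
def tensorT (x : Plane) (a b : Fin 2) : ℝ :=
  covN Γ v x a * vecF Γ v x b - beta Γ v x * tensorM Γ v x a b

/-- `B_{ef} P_{da}`. -/
def tensorBP : CoTensor 4 := fun x i => skewB Γ x ![i 0, i 1] * schouten Γ x ![i 2, i 3]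

/-- `B_{ef} B_{gh}`. -/
def tensorBB : CoTensor 4 := fun x i => skewB Γ x ![i 0, i 1] * skewB Γ x ![i 2, i 3]

/-- `U^b_{ca} = ε^{bd} ε^{ef} [(1/3) (∇_c ∇_a Y_{efd} - ∇_c ∇_a ∇_d B_{ef}) + ∇_c (B_{ef} P_{da})]
+ (1/2) ε^{ef} ε^{gh} ∇_c (B_{ef} B_{gh}) δ^b_a + ε^{bd} N_a (P_{dc} + (1/2) β ε_{cd})`,
written `tensorU Γ v x b c a`. -/
def tensorU (x : Plane) (b c a : Fin 2) : ℝ :=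
  (∑ d, ∑ e, ∑ f, epsUp v x b d * epsUp v x e f *
      (1 / 3 * (nabla Γ (nabla Γ (tensorY Γ)) x ![c, a, e, f, d]
          - nabla Γ (nabla Γ (nabla Γ (skewB Γ))) x ![c, a, d, e, f])
        + nabla Γ (tensorBP Γ) x ![c, e, f, d, a]))
    + 1 / 2 * (∑ e, ∑ f, ∑ g, ∑ h, epsUp v x e f * epsUp v x g h *
        nabla Γ (tensorBB Γ) x ![c, e, f, g, h]) * kron b a
    + ∑ d, epsUp v x b d * covN Γ v x a *
        (schouten Γ x ![d, c] + 1 / 2 * beta Γ v x * epsLo v x c d)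

/-- `V_{ca} = -M_{ac} - (1/3) ε^{de} (∇_c ∇_d P_{ea} - 4 ∇_c ∇_a B_{de})`. -/
def tensorV (x : Plane) (c a : Fin 2) : ℝ :=
  -lowM Γ v x a c - 1 / 3 * ∑ d, ∑ e, epsUp v x d e *
    (nabla Γ (nabla Γ (schouten Γ)) x ![c, d, e, a]
      - 4 * nabla Γ (nabla Γ (skewB Γ)) x ![c, a, d, e])

/-- `U^e_{(bc)}`. -/
def symU (x : Plane) (e b c : Fin 2) : ℝ :=
  1 / 2 * (tensorU Γ v x e b c + tensorU Γ v x e c b)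

/-- `V_{(bc)}`. -/
def symV (x : Plane) (b c : Fin 2) : ℝ := 1 / 2 * (tensorV Γ v x b c + tensorV Γ v x c b)

/-- `W_{abc} = F_e M_a{}^e V_{(bc)} - F_e U^e_{(bc)} N_a + β M_{ae} U^e_{(bc)}`. -/
def tensorW (x : Plane) (a b c : Fin 2) : ℝ :=
  (∑ e, covF Γ v x e * tensorM Γ v x a e) * symV Γ v x b c
    - (∑ e, covF Γ v x e * symU Γ v x e b c) * covN Γ v x a
    + beta Γ v x * ∑ e, lowM Γ v x a e * symU Γ v x e b c

/-- `I_S = (W_{111}, W_{222})`. -/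
def invS (x : Plane) : ℝ × ℝ := (tensorW Γ v x 0 0 0, tensorW Γ v x 1 1 1)

end Coordinates

/-! ### Surfaces, connections, first integrals -/

section Surface

variable {S : Type*} [TopologicalSpace S] [ChartedSpace Plane S]

/-- The coordinate vector field `∂_a` of a chart (meaningful on the source of the chart). -/
def coordField (e : OpenPartialHomeomorph S Plane) (a : Fin 2) :
    (q : S) → TangentSpace (𝓡 2) q :=
  VectorField.mpullback (𝓡 2) (𝓡 2) e (fun _ => (EuclideanSpace.single a 1 : Plane))

/-- A `1`-form, as a function; only its values on the open set under consideration matter. -/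
abbrev OneForm (S : Type*) [TopologicalSpace S] [ChartedSpace Plane S] :=
  (q : S) → TangentSpace (𝓡 2) q →L[ℝ] ℝ

variable (S) in
/-- A volume form: a nowhere vanishing `2`-form with `C^1` components in every chart. -/
structure VolumeForm [IsManifold (𝓡 2) 6 S] where
  /-- the value at a point -/
  form : (q : S) → TangentSpace (𝓡 2) q [⋀^Fin 2]→L[ℝ] ℝ
  ne_zero : ∀ q, form q ≠ 0
  contDiffOn : ∀ e ∈ IsManifold.maximalAtlas (𝓡 2) 6 S,
    ContDiffOn ℝ 1 (fun x => form (e.symm x) (fun a => coordField e a (e.symm x))) e.target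

/-- The component `ε_{12}` of a volume form in a chart. -/
def VolumeForm.comp [IsManifold (𝓡 2) 6 S] (ε : VolumeForm S)
    (e : OpenPartialHomeomorph S Plane) (x : Plane) : ℝ :=
  ε.form (e.symm x) (fun a => coordField e a (e.symm x))

variable [IsManifold (𝓡 2) 6 S]
  (conn : CovariantDerivative (𝓡 2) Plane (TangentSpace (𝓡 2) : S → Type))

/-- The Christoffel symbols in a chart: `christoffel conn e x c a b` is the `c`-th component of
`∇_{∂_a} ∂_b` at the point with coordinates `x`. -/
def christoffel (e : OpenPartialHomeomorph S Plane) (x : Plane) (c a b : Fin 2) : ℝ :=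
  let w : Plane := mfderiv (𝓡 2) (𝓡 2) e (e.symm x)
    (conn (coordField e b) (e.symm x) (coordField e a (e.symm x)))
  w c

/-- `K` is a linear first integral of the geodesic flow on `U`: a `C^1` one-form with
`∇_{(a} K_{b)} = 0`, that is, `(∇_X K)(X) = X (K X) - K (∇_X X) = 0` for every vector field `X`. -/
structure IsFirstIntegralOn (U : Set S) (K : OneForm S) : Prop where
  contMDiffOn : ContMDiffOn (𝓡 2) ((𝓡 2).prod 𝓘(ℝ, Plane →L[ℝ] ℝ)) 1
    (fun q => Bundle.TotalSpace.mk' (Plane →L[ℝ] ℝ)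
      (E := fun q : S => TangentSpace (𝓡 2) q →L[ℝ] Bundle.Trivial S ℝ q) q (K q)) U
  killing : ∀ q ∈ U, ∀ X : (r : S) → TangentSpace (𝓡 2) r,
    MDifferentiableAt (𝓡 2) (𝓡 2).tangent (fun r => (⟨r, X r⟩ : TangentBundle (𝓡 2) S)) q →
    mvfderiv (𝓡 2) (fun r => K r (X r)) q (X q) - K q (conn X q (X q)) = 0

/-- `conn` admits a nonzero linear first integral on `U`. -/
def HasFirstIntegral (U : Set S) : Prop :=
  ∃ K : OneForm S, IsFirstIntegralOn conn U K ∧ ∃ q ∈ U, K q ≠ 0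

/-- `conn` admits `n` linearly independent (over `ℝ`) linear first integrals on `U`. -/
def HasIndepFirstIntegrals (n : ℕ) (U : Set S) : Prop :=
  ∃ K : Fin n → OneForm S, (∀ i, IsFirstIntegralOn conn U (K i)) ∧
    LinearIndependent ℝ (fun (i : Fin n) (q : U) => K i q)

/-- `conn` admits precisely `n` linearly independent linear first integrals on `U`. -/
def HasExactlyFirstIntegrals (n : ℕ) (U : Set S) : Prop :=
  HasIndepFirstIntegrals conn n U ∧ ¬ HasIndepFirstIntegrals conn (n + 1) U

/-- The invariants `I_N` and `I_S` vanish on `U`, computed in the chart `e`. -/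
def InvariantsVanishOn (ε : VolumeForm S) (e : OpenPartialHomeomorph S Plane) (U : Set S) : Prop :=
  ∀ q ∈ U ∩ e.source, invN (christoffel conn e) (ε.comp e) (e q) = 0 ∧
    invS (christoffel conn e) (ε.comp e) (e q) = 0

/-- The tensor `T` vanishes on `U`, computed in the chart `e`. -/
def TensorTVanishesOn (ε : VolumeForm S) (e : OpenPartialHomeomorph S Plane) (U : Set S) : Prop :=
  ∀ q ∈ U ∩ e.source, ∀ a b, tensorT (christoffel conn e) (ε.comp e) (e q) a b = 0

/-- The skew part of the Ricci tensor is nonzero at `q`, computed in the chart `e`. -/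
def RicciSkewNeZeroAt (e : OpenPartialHomeomorph S Plane) (q : S) : Prop :=
  ricci (christoffel conn e) (e q) 0 1 - ricci (christoffel conn e) (e q) 1 0 ≠ 0

/-- The Ricci tensor is symmetric on `U`. -/
def RicciSymmetricOn (U : Set S) : Prop :=
  ∀ e ∈ IsManifold.maximalAtlas (𝓡 2) 6 S, ∀ q ∈ U ∩ e.source, ∀ a b,
    ricci (christoffel conn e) (e q) a b = ricci (christoffel conn e) (e q) b a

/-- `conn` is projectively flat on `U`: around each point of `U` there are local coordinates in
which it is projectively equivalent to the standard flat connection,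
`Γ^c_{ab} = Υ_a δ^c_b + Υ_b δ^c_a` (so that its unparametrised geodesics are straight lines). -/
def ProjectivelyFlatOn (U : Set S) : Prop :=
  ∀ q ∈ U, ∃ e ∈ IsManifold.maximalAtlas (𝓡 2) 6 S, q ∈ e.source ∧ e.source ⊆ U ∧
    ∃ Υ : Plane → Fin 2 → ℝ, ∀ x ∈ e.target, ∀ a b c,
      christoffel conn e x c a b = Υ x a * kron c b + Υ x b * kron c a

/-- `p` is a regular point: in the chart `e`, the rank of the obstruction matrix is constant
near `p`. -/
def IsRegularPoint (ε : VolumeForm S) (e : OpenPartialHomeomorph S Plane) (p : S) : Prop :=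
  ∀ᶠ x in 𝓝 (e p), (obstructionMatrix (christoffel conn e) (ε.comp e) x).rank =
    (obstructionMatrix (christoffel conn e) (ε.comp e) (e p)).rank

end Surface

end AffineSurface

end

open AffineSurface

namespace AffineSurface

/-! ### Calculus of coordinate partial derivatives -/

/-! The Killing equation prolongs to a closed linear system. Put `∇_a K_b = μ ε_{ab}`; one further
differentiation expresses `∂_c μ` through curvature, so on a coordinate domain first integrals are
the parallel sections `u = (K_1, K_2, μ)` of a connection `d - A` with `A = prolong Γ`
(`KillingOn.parallelOn`, `ParallelOn.killingOn`). Over a connected set such a section is determined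
by its value at one point, so counting first integrals means counting admissible initial values.

The curvature of `d - A` has one nonzero row, a multiple of `(F^1, F^2, β)` (`curvMat_prolong`), and
this row must annihilate `u`. Differentiating that equation yields the rows `(M_a^1, M_a^2, N_a)`,
and differentiating again the rows `(U, V)` (`rowD_obsRow_zero`, `rowD_obsRow_succ`). Hence the
values of `n` independent sections lie in the kernel of the obstruction matrix, and its rank is at
most `3 - n`. Up to powers of the volume component, `I_N` is the determinant of this matrix,
`W_{aaa}` is the determinant of the first row, row `a` and the row `(U, V)_{aa}`, and `T` collects
the minors of the first row and row `a` that involve the last column. The necessary conditions are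
therefore statements about rank.

For sufficiency near a regular point, the vanishing of `I_N` and `I_S`, together with the commutator
of covariant derivatives of the first row, makes the row space stable under differentiation
(`rowD_obsRow_mem_of_ne_zero`, `exists_rowD_obsRow_bound`). An initial value in the kernel is then
transported along one coordinate line and from there in the other direction. Grönwall's inequality
keeps it in the kernel, where the curvature vanishes, and this makes the resulting family parallel
in both directions (`exists_parallel_of_constraint`). When the skew Ricci part is nonzero, `T = 0`
means rank one, which gives exactly two first integrals.

Three first integrals mean rank zero. Then `P` is symmetric and `Y = 0`, so the system `∇_a ∇_b σ +
P_{ab} σ = 0` is flat, and quotients of its solutions are coordinates in which geodesics are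
straight (`exists_flat_coordinates`). Conversely, projective flatness with symmetric Ricci tensor
makes the first row vanish (`obsRow_eq_zero_of_flat`), so the prolonged connection itself is flat.
-/

/-- The coordinate vector `e_a` of the plane. -/
noncomputable abbrev stdVec (a : Fin 2) : Plane := EuclideanSpace.single a (1 : ℝ)

theorem pd_eq (a : Fin 2) (f : Plane → ℝ) (x : Plane) : pd a f x = fderiv ℝ f x (stdVec a) := rfl

theorem plane_eq_sum (x : Plane) : x = ∑ a, x a • stdVec a := by
  ext i
  fin_cases i <;> simp [Fin.sum_univ_two]

theorem clm_apply_eq_sum {F : Type*} [NormedAddCommGroup F] [NormedSpace ℝ F] (L : Plane →L[ℝ] F)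
    (h : Plane) : L h = ∑ a, h a • L (stdVec a) := by
  conv_lhs => rw [plane_eq_sum h]
  simp

theorem fderiv_eq_sum_pd (f : Plane → ℝ) (x h : Plane) :
    fderiv ℝ f x h = ∑ a, h a * pd a f x := by
  rw [clm_apply_eq_sum]; rfl

section rules

variable {a : Fin 2} {f g : Plane → ℝ} {x : Plane}

theorem pd_congr (h : f =ᶠ[𝓝 x] g) (a : Fin 2) : pd a f x = pd a g x := by
  rw [pd, pd, h.fderiv_eq]

theorem pd_add (hf : DifferentiableAt ℝ f x) (hg : DifferentiableAt ℝ g x) :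
    pd a (fun y => f y + g y) x = pd a f x + pd a g x := by
  simp [pd, fderiv_fun_add hf hg]

theorem pd_sub (hf : DifferentiableAt ℝ f x) (hg : DifferentiableAt ℝ g x) :
    pd a (fun y => f y - g y) x = pd a f x - pd a g x := by
  simp [pd, fderiv_fun_sub hf hg]

theorem pd_neg : pd a (fun y => -f y) x = -pd a f x := by
  simp [pd, fderiv_fun_neg]

theorem pd_const (c : ℝ) : pd a (fun _ => c) x = 0 := by
  simp [pd]

theorem pd_const_mul (c : ℝ) : pd a (fun y => c * f y) x = c * pd a f x := by
  rcases eq_or_ne c 0 with rfl | hc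
  · simp [pd]
  have : (fun y => c * f y) = c • f := rfl
  rw [pd, this, fderiv_const_smul_field]
  simp [pd]

theorem pd_mul (hf : DifferentiableAt ℝ f x) (hg : DifferentiableAt ℝ g x) :
    pd a (fun y => f y * g y) x = pd a f x * g x + f x * pd a g x := by
  simp [pd, fderiv_fun_mul hf hg]; ring

theorem pd_sum {ι : Type*} (s : Finset ι) {F : ι → Plane → ℝ}
    (hF : ∀ i ∈ s, DifferentiableAt ℝ (F i) x) :
    pd a (fun y => ∑ i ∈ s, F i y) x = ∑ i ∈ s, pd a (F i) x := by
  simp [pd, fderiv_fun_sum hF]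

end rules

theorem _root_.ContDiffAt.pd {f : Plane → ℝ} {x : Plane} {m n : ℕ∞ω} (hf : ContDiffAt ℝ n f x)
    (hmn : m + 1 ≤ n) (a : Fin 2) : ContDiffAt ℝ m (pd a f) x :=
  (hf.fderiv_right hmn).clm_apply contDiffAt_const

theorem pd_comm {f : Plane → ℝ} {x : Plane} (hf : ContDiffAt ℝ 2 f x) (a b : Fin 2) :
    pd a (pd b f) x = pd b (pd a f) x := by
  have hd : DifferentiableAt ℝ (fderiv ℝ f) x :=
    (hf.fderiv_right (m := 1) (by norm_num)).differentiableAt (by norm_num)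
  have key : ∀ a b, pd a (pd b f) x = fderiv ℝ (fderiv ℝ f) x (stdVec a) (stdVec b) := by
    intro a b
    rw [pd_eq]
    have : pd b f = fun y => fderiv ℝ f y (stdVec b) := rfl
    rw [this, fderiv_clm_apply hd (differentiableAt_const _)]
    simp
  rw [key, key]
  exact (hf.isSymmSndFDerivAt (by simp)).eq _ _

theorem hasDerivAt_line {F : Type*} [NormedAddCommGroup F] [NormedSpace ℝ F] {f : Plane → F}
    (x h : Plane) (t : ℝ) (hf : DifferentiableAt ℝ f (x + t • h)) :
    HasDerivAt (fun s : ℝ => f (x + s • h)) (fderiv ℝ f (x + t • h) h) t := by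
  have h1 : HasDerivAt (fun s : ℝ => x + s • h) h t := by
    simpa using ((hasDerivAt_id t).smul_const h).const_add x
  exact hf.hasFDerivAt.comp_hasDerivAt t h1

/-- If `f` is differentiable and `∂_a f` is strictly differentiable, then the mixed derivative
`∂_a ∂_b f` exists and equals `∂_b ∂_a f`. -/
theorem hasDerivAt_pd_of_pd {f : Plane → ℝ} {x : Plane} (a b : Fin 2)
    (hf : ∀ᶠ y in 𝓝 x, DifferentiableAt ℝ f y) (hg : ContDiffAt ℝ 1 (pd a f) x) :
    HasDerivAt (fun t : ℝ => pd b f (x + t • stdVec a)) (pd b (pd a f) x) 0 := by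
  set g := pd a f with hgdef
  set c := pd b g x with hc
  have hstrict := (hg.hasStrictFDerivAt (by norm_num)).isLittleO
  rw [hasDerivAt_iff_isLittleO_nhds_zero]
  rw [Asymptotics.isLittleO_iff]
  intro ε hε
  rw [Asymptotics.isLittleO_iff] at hstrict
  have h1 := hstrict hε
  rw [nhds_prod_eq, Metric.nhds_basis_ball.prod_self.eventually_iff] at h1
  obtain ⟨δ₁, hδ₁, h1⟩ := h1
  obtain ⟨δ₂, hδ₂, h2⟩ := Metric.eventually_nhds_iff_ball.1 hf
  set δ := min δ₁ δ₂ / 2 with hδ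
  have hδ0 : 0 < δ := by positivity
  have hball : ∀ τ s : ℝ, |τ| < δ → |s| < δ →
      x + τ • stdVec a + s • stdVec b ∈ Metric.ball x (min δ₁ δ₂) := by
    intro τ s hτ hs
    rw [mem_ball_iff_norm, add_assoc, add_sub_cancel_left]
    calc ‖τ • stdVec a + s • stdVec b‖ ≤ ‖τ • stdVec a‖ + ‖s • stdVec b‖ := norm_add_le _ _
      _ = |τ| + |s| := by simp [norm_smul]
      _ < δ + δ := by linarith
      _ = min δ₁ δ₂ := by rw [hδ]; ring
  have hball0 : ∀ τ : ℝ, |τ| < δ → x + τ • stdVec a ∈ Metric.ball x (min δ₁ δ₂) := by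
    intro τ hτ
    simpa using hball τ 0 hτ (by simpa using hδ0)
  have hsub1 : Metric.ball x (min δ₁ δ₂) ⊆ Metric.ball x δ₁ :=
    Metric.ball_subset_ball (min_le_left _ _)
  have hsub2 : Metric.ball x (min δ₁ δ₂) ⊆ Metric.ball x δ₂ :=
    Metric.ball_subset_ball (min_le_right _ _)
  -- Peano's argument: the mean value inequality in `t` controls the mixed second difference minus
  -- `t s c`, its derivative being small by strict differentiability of `∂_a f`. Dividing by `s` and
  -- letting `s → 0` then gives the derivative of `∂_b f` along `e_a`.
  have key : ∀ t s : ℝ, |t| < δ → |s| < δ →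
      ‖(f (x + t • stdVec a + s • stdVec b) - f (x + t • stdVec a) - t * (s * c))
        - (f (x + s • stdVec b) - f x)‖ ≤ ε * |s| * |t| := by
    intro t s ht hs
    let ψ : ℝ → ℝ := fun τ => f (x + τ • stdVec a + s • stdVec b) - f (x + τ • stdVec a)
      - τ * (s * c)
    let ψ' : ℝ → ℝ := fun τ => g (x + τ • stdVec a + s • stdVec b) - g (x + τ • stdVec a) - s * c
    have hder : ∀ τ ∈ Metric.ball (0 : ℝ) δ, HasDerivWithinAt ψ (ψ' τ) (Metric.ball (0 : ℝ) δ) τ := by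
      intro τ hτ
      have hτ' : |τ| < δ := by simpa using hτ
      refine HasDerivAt.hasDerivWithinAt ?_
      have e1 : HasDerivAt (fun τ : ℝ => f (x + τ • stdVec a + s • stdVec b))
          (g (x + τ • stdVec a + s • stdVec b)) τ := by
        have := hasDerivAt_line (f := f) (x + s • stdVec b) (stdVec a) τ
          (by rw [add_right_comm]; exact h2 _ (hsub2 (hball τ s hτ' hs)))
        rw [add_right_comm] at this
        refine this.congr_of_eventuallyEq (Eventually.of_forall fun t => ?_)
        change f _ = f _
        rw [add_right_comm]
      have e2 := hasDerivAt_line (f := f) x (stdVec a) τ (h2 _ (hsub2 (hball0 τ hτ')))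
      simpa using! (e1.sub e2).sub ((hasDerivAt_id τ).mul_const (s * c))
    have hbound : ∀ τ ∈ Metric.ball (0 : ℝ) δ, ‖ψ' τ‖ ≤ ε * |s| := by
      intro τ hτ
      have hτ' : |τ| < δ := by simpa using hτ
      have := h1 (Set.mk_mem_prod (hsub1 (hball τ s hτ' hs)) (hsub1 (hball0 τ hτ')))
      simp only [add_sub_cancel_left, map_smul, norm_smul] at this
      simpa [ψ', hc, pd_eq] using this
    have := (convex_ball (0 : ℝ) δ).norm_image_sub_le_of_norm_hasDerivWithin_le hder hbound
      (Metric.mem_ball_self hδ0) (by simpa using ht : t ∈ Metric.ball (0 : ℝ) δ)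
    simpa [ψ] using this
  filter_upwards [Metric.ball_mem_nhds (0 : ℝ) hδ0] with t ht
  have ht' : |t| < δ := by simpa using ht
  have l1 := hasDerivAt_line (f := f) (x + t • stdVec a) (stdVec b) 0
    (by simpa using h2 _ (hsub2 (hball0 t ht')))
  have l2 := hasDerivAt_line (f := f) x (stdVec b) 0 (by simpa using h2 _ (Metric.mem_ball_self hδ₂))
  have l3 := ((l1.sub l2).sub ((hasDerivAt_id (0 : ℝ)).const_mul (t * c))).tendsto_slope_zero.norm
  simp only [zero_add, zero_smul, add_zero, Pi.sub_apply] at l3 ⊢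
  simp only [smul_eq_mul, mul_one] at l3 ⊢
  refine le_of_tendsto l3 ?_
  have hs0 : ∀ᶠ s in 𝓝[≠] (0 : ℝ), |s| < δ := by
    refine nhdsWithin_le_nhds ?_
    filter_upwards [Metric.ball_mem_nhds (0 : ℝ) hδ0] with s hs
    simpa using hs
  filter_upwards [hs0, self_mem_nhdsWithin] with s hs hs1
  have hs1' : s ≠ 0 := hs1
  have hspos : 0 < |s| := abs_pos.2 hs1'
  rw [norm_mul, norm_inv, Real.norm_eq_abs s, inv_mul_le_iff₀ hspos]
  have k := key t s ht' hs
  calc _ = _ := by congr 1; simp; ring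
    _ ≤ _ := k
    _ = _ := by rw [Real.norm_eq_abs]; ring

/-- A function whose partial derivatives exist near `x` and are continuous at `x` is differentiable
at `x`. -/
theorem hasFDerivAt_of_partials {F : Type*} [NormedAddCommGroup F] [NormedSpace ℝ F]
    {f : Plane → F} {g : Fin 2 → Plane → F} {x : Plane}
    (hd : ∀ᶠ y in 𝓝 x, ∀ a, HasDerivAt (fun t : ℝ => f (y + t • stdVec a)) (g a y) 0)
    (hc : ∀ a, ContinuousAt (g a) x) :
    HasFDerivAt f (∑ a, (EuclideanSpace.proj a : Plane →L[ℝ] ℝ).smulRight (g a x)) x := by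
  -- The criterion by partial derivatives is applied on `ℝ × ℝ` and carried to the plane by the
  -- mutually inverse maps `Φ` and `Ψ`.
  let Φ : ℝ × ℝ →L[ℝ] Plane := (ContinuousLinearMap.fst ℝ ℝ ℝ).smulRight (stdVec 0) +
    (ContinuousLinearMap.snd ℝ ℝ ℝ).smulRight (stdVec 1)
  let Ψ : Plane →L[ℝ] ℝ × ℝ := (EuclideanSpace.proj 0).prod (EuclideanSpace.proj 1)
  have hΦΨ : ∀ y, Φ (Ψ y) = y := by
    intro y
    ext i; fin_cases i <;> simp [Φ, Ψ]
  have hΨΦ : ∀ y, Ψ (Φ y) = y := by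
    intro y
    ext <;> simp [Φ, Ψ]
  have hΦc : Tendsto Φ (𝓝 (Ψ x)) (𝓝 x) := by
    have := Φ.continuous.tendsto (Ψ x); rwa [hΦΨ] at this
  have hd' := hΦc.eventually hd
  have key : ∀ v : ℝ × ℝ, ∀ a, HasDerivAt (fun t : ℝ => f (Φ v + t • stdVec a)) (g a (Φ v)) 0 →
      HasDerivAt (fun t : ℝ => f (Φ (if a = 0 then (t, v.2) else (v.1, t)))) (g a (Φ v))
        (if a = 0 then v.1 else v.2) := by
    intro v a h
    fin_cases a
    · have h' := HasDerivAt.comp_sub_const v.1 v.1 (by rw [sub_self]; exact h)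
      simp only [Fin.zero_eta, if_true] at h' ⊢
      convert h' using 2 with t
      congr 1
      simp only [Φ, add_apply, ContinuousLinearMap.smulRight_apply,
        ContinuousLinearMap.coe_fst', ContinuousLinearMap.coe_snd']
      module
    · have h' := HasDerivAt.comp_sub_const v.2 v.2 (by rw [sub_self]; exact h)
      simp only [Fin.mk_one, one_ne_zero, if_false] at h' ⊢
      convert h' using 2 with t
      congr 1
      simp only [Φ, add_apply, ContinuousLinearMap.smulRight_apply,
        ContinuousLinearMap.coe_fst', ContinuousLinearMap.coe_snd']
      module
  have main := hasStrictFDerivAt_uncurry_coprod (𝕜 := ℝ) (u := Ψ x)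
    (f := fun s t => f (Φ (s, t)))
    (f₁ := fun s t => ContinuousLinearMap.toSpanSingleton ℝ (g 0 (Φ (s, t))))
    (f₂ := fun s t => ContinuousLinearMap.toSpanSingleton ℝ (g 1 (Φ (s, t))))
    (by
      filter_upwards [hd'] with v hv
      simpa using! (key v 0 (hv 0)).hasFDerivAt)
    (by
      filter_upwards [hd'] with v hv
      simpa using! (key v 1 (hv 1)).hasFDerivAt)
    (by
      have : ContinuousAt (fun v : ℝ × ℝ => g 0 (Φ v)) (Ψ x) :=
        ContinuousAt.comp (by rw [hΦΨ]; exact hc 0) Φ.continuous.continuousAt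
      exact ((ContinuousLinearMap.toSpanSingletonCLE (𝕜 := ℝ) (E := F)).continuous.continuousAt).comp this)
    (by
      have : ContinuousAt (fun v : ℝ × ℝ => g 1 (Φ v)) (Ψ x) :=
        ContinuousAt.comp (by rw [hΦΨ]; exact hc 1) Φ.continuous.continuousAt
      exact ((ContinuousLinearMap.toSpanSingletonCLE (𝕜 := ℝ) (E := F)).continuous.continuousAt).comp this)
  have h2 := main.hasFDerivAt.comp x Ψ.hasFDerivAt
  have e1 : (↿fun s t => f (Φ (s, t))) ∘ Ψ = f := by
    funext y
    change f (Φ (Ψ y)) = f y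
    rw [hΦΨ]
  rw [e1] at h2
  refine h2.congr_fderiv ?_
  ext h
  have hx : Φ (x 0, x 1) = x := hΦΨ x
  simp [Function.HasUncurry.uncurry, Fin.sum_univ_two, hx, Ψ]

/-- The bootstrapping step for every differential system below: an equation for the first
derivatives raises the regularity of a solution by one. -/
theorem contDiffAt_of_pd {f : Plane → ℝ} {V : Set Plane} (hV : IsOpen V) {n : ℕ}
    (hf : ∀ x ∈ V, DifferentiableAt ℝ f x)
    (hpd : ∀ a, ∀ x ∈ V, ContDiffAt ℝ n (pd a f) x) : ∀ x ∈ V, ContDiffAt ℝ (n + 1) f x := by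
  have h : ContDiffOn ℝ (n + 1) f V := by
    rw [contDiffOn_succ_iff_fderiv_of_isOpen hV]
    refine ⟨fun x hx => (hf x hx).differentiableWithinAt, by simp, ?_⟩
    have : fderiv ℝ f = fun x => ∑ a, pd a f x • (EuclideanSpace.proj a : Plane →L[ℝ] ℝ) := by
      funext x
      ext h
      rw [fderiv_eq_sum_pd]
      simp [mul_comm]
    rw [this]
    have h : ∀ a, ContDiffOn ℝ n (pd a f) V := fun a x hx => (hpd a x hx).contDiffWithinAt
    exact ContDiffOn.sum fun a _ => (h a).smul contDiffOn_const
  exact fun x hx => h.contDiffAt (hV.mem_nhds hx)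

/-! ### Explicit forms of the covariant derivative -/

section nabla

variable {Γ : Plane → Fin 2 → Fin 2 → Fin 2 → ℝ}

theorem nabla_two (T : CoTensor 2) (x : Plane) (a i j : Fin 2) :
    nabla Γ T x ![a, i, j] = pd a (fun y => T y ![i, j]) x
      - ∑ d, (Γ x d a i * T x ![d, j] + Γ x d a j * T x ![i, d]) := by
  have h : Fin.tail ![a, i, j] = ![i, j] := rfl
  have u0 : ∀ d, Function.update ![i, j] 0 d = ![d, j] := fun d => by
    ext k; fin_cases k <;> rfl
  have u1 : ∀ d, Function.update ![i, j] 1 d = ![i, d] := fun d => by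
    ext k; fin_cases k <;> rfl
  simp only [nabla, h, Fin.sum_univ_two, u0, u1]
  simp
  ring

theorem nabla_three (T : CoTensor 3) (x : Plane) (a i j k : Fin 2) :
    nabla Γ T x ![a, i, j, k] = pd a (fun y => T y ![i, j, k]) x
      - ∑ d, (Γ x d a i * T x ![d, j, k] + Γ x d a j * T x ![i, d, k]
        + Γ x d a k * T x ![i, j, d]) := by
  have h : Fin.tail ![a, i, j, k] = ![i, j, k] := rfl
  have u0 : ∀ d, Function.update ![i, j, k] 0 d = ![d, j, k] := fun d => by
    ext k; fin_cases k <;> rfl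
  have u1 : ∀ d, Function.update ![i, j, k] 1 d = ![i, d, k] := fun d => by
    ext k; fin_cases k <;> rfl
  have u2 : ∀ d, Function.update ![i, j, k] 2 d = ![i, j, d] := fun d => by
    ext k; fin_cases k <;> rfl
  simp only [nabla, h, Fin.sum_univ_two, Fin.sum_univ_three, u0, u1, u2]
  simp
  ring

theorem nabla_four (T : CoTensor 4) (x : Plane) (a i j k l : Fin 2) :
    nabla Γ T x ![a, i, j, k, l] = pd a (fun y => T y ![i, j, k, l]) x
      - ∑ d, (Γ x d a i * T x ![d, j, k, l] + Γ x d a j * T x ![i, d, k, l]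
        + Γ x d a k * T x ![i, j, d, l] + Γ x d a l * T x ![i, j, k, d]) := by
  have h : Fin.tail ![a, i, j, k, l] = ![i, j, k, l] := rfl
  have u0 : ∀ d, Function.update ![i, j, k, l] 0 d = ![d, j, k, l] := fun d => by
    ext k; fin_cases k <;> rfl
  have u1 : ∀ d, Function.update ![i, j, k, l] 1 d = ![i, d, k, l] := fun d => by
    ext k; fin_cases k <;> rfl
  have u2 : ∀ d, Function.update ![i, j, k, l] 2 d = ![i, j, d, l] := fun d => by
    ext k; fin_cases k <;> rfl
  have u3 : ∀ d, Function.update ![i, j, k, l] 3 d = ![i, j, k, d] := fun d => by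
    ext k; fin_cases k <;> rfl
  have s0 : (0 : Fin 4).succ = 1 := rfl
  have s1 : (1 : Fin 4).succ = 2 := rfl
  have s2 : (2 : Fin 4).succ = 3 := rfl
  have s3 : (3 : Fin 4).succ = 4 := rfl
  simp only [nabla, h, Fin.sum_univ_two, Fin.sum_univ_four, u0, u1, u2, u3, s0, s1, s2, s3]
  have e0 : (![a, i, j, k, l] : Fin 5 → Fin 2) 0 = a := rfl
  have e1 : (![a, i, j, k, l] : Fin 5 → Fin 2) 1 = i := rfl
  have e2 : (![a, i, j, k, l] : Fin 5 → Fin 2) 2 = j := rfl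
  have e3 : (![a, i, j, k, l] : Fin 5 → Fin 2) 3 = k := rfl
  have e4 : (![a, i, j, k, l] : Fin 5 → Fin 2) 4 = l := rfl
  simp only [e0, e1, e2, e3, e4]
  ring

/-- In dimension two a skew pair of indices carries only the component `01`. This lemma and its
analogues for `Y` and for covariant derivatives reduce each invariant to a few components, so that
the later identities become polynomial ones. -/
theorem skewB_swap (x : Plane) (i j : Fin 2) : skewB Γ x ![j, i] = -skewB Γ x ![i, j] := by
  simp [skewB]

theorem skewB_self (x : Plane) (i : Fin 2) : skewB Γ x ![i, i] = 0 := by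
  simp [skewB]

theorem tensorY_swap (x : Plane) (i j k : Fin 2) :
    tensorY Γ x ![j, i, k] = -tensorY Γ x ![i, j, k] := by
  simp [tensorY]; ring

theorem tensorY_self (x : Plane) (i k : Fin 2) : tensorY Γ x ![i, i, k] = 0 := by
  simp [tensorY]

theorem nabla_skewB_swap (x : Plane) (a i j : Fin 2) :
    nabla Γ (skewB Γ) x ![a, j, i] = -nabla Γ (skewB Γ) x ![a, i, j] := by
  rw [nabla_two, nabla_two]
  simp only [skewB_swap _ i j, pd_neg, Fin.sum_univ_two, skewB_swap x 0 i, skewB_swap x 1 i,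
    skewB_swap x j 0, skewB_swap x j 1]
  ring

theorem nabla_tensorY_swap (x : Plane) (a i j k : Fin 2) :
    nabla Γ (tensorY Γ) x ![a, j, i, k] = -nabla Γ (tensorY Γ) x ![a, i, j, k] := by
  rw [nabla_three, nabla_three]
  simp only [tensorY_swap _ i j, pd_neg, Fin.sum_univ_two, tensorY_swap x 0 i, tensorY_swap x 1 i,
    tensorY_swap x j 0, tensorY_swap x j 1]
  ring

theorem nabla_nabla_skewB_swap (x : Plane) (a b i j : Fin 2) :
    nabla Γ (nabla Γ (skewB Γ)) x ![a, b, j, i] = -nabla Γ (nabla Γ (skewB Γ)) x ![a, b, i, j] := by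
  rw [nabla_three, nabla_three]
  simp only [nabla_skewB_swap _ _ i j, pd_neg, Fin.sum_univ_two, nabla_skewB_swap x b 0 i,
    nabla_skewB_swap x b 1 i, nabla_skewB_swap x b j 0, nabla_skewB_swap x b j 1]
  ring

theorem nabla_nabla_tensorY_swap (x : Plane) (a b i j k : Fin 2) :
    nabla Γ (nabla Γ (tensorY Γ)) x ![a, b, j, i, k] =
      -nabla Γ (nabla Γ (tensorY Γ)) x ![a, b, i, j, k] := by
  rw [nabla_four, nabla_four]
  simp only [nabla_tensorY_swap _ _ i j, pd_neg, Fin.sum_univ_two, nabla_tensorY_swap x b 0 i,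
    nabla_tensorY_swap x b 1 i, nabla_tensorY_swap x b j 0, nabla_tensorY_swap x b j 1]
  ring

theorem nabla_nabla_nabla_skewB_swap (x : Plane) (a b c i j : Fin 2) :
    nabla Γ (nabla Γ (nabla Γ (skewB Γ))) x ![a, b, c, j, i] =
      -nabla Γ (nabla Γ (nabla Γ (skewB Γ))) x ![a, b, c, i, j] := by
  rw [nabla_four, nabla_four]
  simp only [nabla_nabla_skewB_swap _ _ _ i j, pd_neg, Fin.sum_univ_two,
    nabla_nabla_skewB_swap x b c 0 i, nabla_nabla_skewB_swap x b c 1 i,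
    nabla_nabla_skewB_swap x b c j 0, nabla_nabla_skewB_swap x b c j 1]
  ring

end nabla

/-! ### Regularity of the tensors attached to a connection -/

section regularity

variable {Γ : Plane → Fin 2 → Fin 2 → Fin 2 → ℝ} {x : Plane}

theorem ContDiffAt.nabla {n : ℕ} {T : CoTensor n} {m k l : ℕ∞ω}
    (hΓ : ∀ c a b, ContDiffAt ℝ k (fun y => Γ y c a b) x)
    (hT : ∀ i, ContDiffAt ℝ l (fun y => T y i) x) (hmk : m ≤ k) (hml : m + 1 ≤ l)
    (i : Fin (n + 1) → Fin 2) : ContDiffAt ℝ m (fun y => nabla Γ T y i) x := by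
  have hml' : m ≤ l := le_trans (by simp) hml
  refine ContDiffAt.sub ((hT _).pd hml _) ?_
  refine ContDiffAt.sum fun j _ => ContDiffAt.sum fun d _ => ?_
  exact ((hΓ _ _ _).of_le hmk).mul ((hT _).of_le hml')

theorem contDiffAt_curv {n m : ℕ∞ω} (hΓ : ∀ c a b, ContDiffAt ℝ n (fun y => Γ y c a b) x)
    (hmn : m + 1 ≤ n) (a b c d : Fin 2) : ContDiffAt ℝ m (fun y => curv Γ y a b c d) x := by
  have h : m ≤ n := le_trans (by simp) hmn
  have hΓ' : ∀ c a b, ContDiffAt ℝ m (fun y => Γ y c a b) x := fun c a b => (hΓ c a b).of_le h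
  refine (((hΓ c b d).pd hmn a).sub ((hΓ c a d).pd hmn b)).add ?_
  exact ContDiffAt.sum fun k _ =>
    ((hΓ' c a k).mul (hΓ' k b d)).sub ((hΓ' c b k).mul (hΓ' k a d))

theorem contDiffAt_ricci {n m : ℕ∞ω} (hΓ : ∀ c a b, ContDiffAt ℝ n (fun y => Γ y c a b) x)
    (hmn : m + 1 ≤ n) (a b : Fin 2) : ContDiffAt ℝ m (fun y => ricci Γ y a b) x :=
  ContDiffAt.sum fun _ _ => contDiffAt_curv hΓ hmn _ _ _ _

theorem contDiffAt_schouten {n m : ℕ∞ω} (hΓ : ∀ c a b, ContDiffAt ℝ n (fun y => Γ y c a b) x)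
    (hmn : m + 1 ≤ n) (i : Fin 2 → Fin 2) : ContDiffAt ℝ m (fun y => schouten Γ y i) x :=
  (contDiffAt_const.mul (contDiffAt_ricci hΓ hmn _ _)).add
    (contDiffAt_const.mul (contDiffAt_ricci hΓ hmn _ _))

theorem contDiffAt_skewB {n m : ℕ∞ω} (hΓ : ∀ c a b, ContDiffAt ℝ n (fun y => Γ y c a b) x)
    (hmn : m + 1 ≤ n) (i : Fin 2 → Fin 2) : ContDiffAt ℝ m (fun y => skewB Γ y i) x :=
  (contDiffAt_schouten hΓ hmn _).sub (contDiffAt_schouten hΓ hmn _)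

variable (hΓ : ∀ c a b, ContDiffAt ℝ 4 (fun y => Γ y c a b) x)
include hΓ

/-- The budget of derivatives: `Γ` is `C^4`, so `P` and `B` are `C^3`, `∇P`, `∇B` and `Y` are `C^2`,
and `∇Y` and `∇∇B` are `C^1`. This leaves exactly the one derivative that has to be taken of `M`. -/
theorem contDiffAt_nabla_schouten (i : Fin 3 → Fin 2) :
    ContDiffAt ℝ 2 (fun y => nabla Γ (schouten Γ) y i) x :=
  ContDiffAt.nabla hΓ (contDiffAt_schouten (m := 3) hΓ (by norm_num)) (by norm_num) (by norm_num) i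

theorem contDiffAt_nabla_skewB (i : Fin 3 → Fin 2) :
    ContDiffAt ℝ 2 (fun y => nabla Γ (skewB Γ) y i) x :=
  ContDiffAt.nabla hΓ (contDiffAt_skewB (m := 3) hΓ (by norm_num)) (by norm_num) (by norm_num) i

theorem contDiffAt_tensorY (i : Fin 3 → Fin 2) : ContDiffAt ℝ 2 (fun y => tensorY Γ y i) x :=
  contDiffAt_const.mul ((contDiffAt_nabla_schouten hΓ _).sub (contDiffAt_nabla_schouten hΓ _))

theorem contDiffAt_nabla_tensorY (i : Fin 4 → Fin 2) :
    ContDiffAt ℝ 1 (fun y => nabla Γ (tensorY Γ) y i) x :=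
  ContDiffAt.nabla hΓ (contDiffAt_tensorY hΓ) (by norm_num) (by norm_num) i

theorem contDiffAt_nabla_nabla_skewB (i : Fin 4 → Fin 2) :
    ContDiffAt ℝ 1 (fun y => nabla Γ (nabla Γ (skewB Γ)) y i) x :=
  ContDiffAt.nabla hΓ (contDiffAt_nabla_skewB hΓ) (by norm_num) (by norm_num) i

end regularity

/-! ### The invariants for the coordinate volume form -/

/-- The component of the coordinate volume form. -/
abbrev unitVol : Plane → ℝ := fun _ => 1

section unit

variable {Γ : Plane → Fin 2 → Fin 2 → Fin 2 → ℝ}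

theorem beta_unitVol (x : Plane) : beta Γ unitVol x = 2 * skewB Γ x ![0, 1] := by
  simp [beta, epsUp, alt, Fin.sum_univ_two, skewB_swap x 0 1]
  ring

theorem vecF_unitVol (x : Plane) (a : Fin 2) : vecF Γ unitVol x a =
    2 / 3 * ∑ b, alt a b * (tensorY Γ x ![0, 1, b] - nabla Γ (skewB Γ) x ![b, 0, 1]) := by
  fin_cases a <;>
  simp [vecF, cotton, epsUp, alt, Fin.sum_univ_two, nabla_skewB_swap x _ 0 1, tensorY] <;> ring

theorem covF_unitVol (x : Plane) (a : Fin 2) :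
    covF Γ unitVol x a = ∑ b, alt b a * vecF Γ unitVol x b := by
  simp [covF, epsLo]

theorem covN_unitVol (x : Plane) (a : Fin 2) : covN Γ unitVol x a =
    -(∑ b, alt b a * vecF Γ unitVol x b) + 2 * nabla Γ (skewB Γ) x ![a, 0, 1] := by
  rw [covN, covF_unitVol]
  simp [epsUp, alt, Fin.sum_univ_two, nabla_skewB_swap x a 0 1]
  ring

theorem tensorM_unitVol (x : Plane) (a b : Fin 2) : tensorM Γ unitVol x a b =
    2 / 3 * ∑ c, alt b c * (nabla Γ (tensorY Γ) x ![a, 0, 1, c]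
        - nabla Γ (nabla Γ (skewB Γ)) x ![a, c, 0, 1])
      + 2 * skewB Γ x ![0, 1] * (∑ c, alt b c * schouten Γ x ![c, a])
      + 2 * (skewB Γ x ![0, 1] * skewB Γ x ![0, 1]) * kron b a := by
  rw [tensorM, beta_unitVol]
  fin_cases b <;>
  simp [schoutenUp, epsUp, alt, Fin.sum_univ_two, nabla_tensorY_swap x a 0 1,
    nabla_nabla_skewB_swap x a _ 0 1] <;> ring

variable {x : Plane} (hΓ : ∀ c a b, ContDiffAt ℝ 4 (fun y => Γ y c a b) x)
include hΓ

/-- The Leibniz rule; it rewrites `U` in the same quantities that appear when `M` is differentiated.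
-/
theorem nabla_tensorBP_apply (c e f d a : Fin 2) : nabla Γ (tensorBP Γ) x ![c, e, f, d, a] =
    nabla Γ (skewB Γ) x ![c, e, f] * schouten Γ x ![d, a]
      + skewB Γ x ![e, f] * nabla Γ (schouten Γ) x ![c, d, a] := by
  have h1 : DifferentiableAt ℝ (fun y => skewB Γ y ![e, f]) x :=
    (contDiffAt_skewB (m := 3) hΓ (by norm_num) _).differentiableAt (by norm_num)
  have h2 : DifferentiableAt ℝ (fun y => schouten Γ y ![d, a]) x :=
    (contDiffAt_schouten (m := 3) hΓ (by norm_num) _).differentiableAt (by norm_num)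
  rw [nabla_four, nabla_two, nabla_two]
  simp only [tensorBP, Fin.sum_univ_two]
  simp only [Matrix.cons_val]
  rw [pd_mul h1 h2]
  ring

theorem nabla_tensorBB_apply (c e f g h : Fin 2) : nabla Γ (tensorBB Γ) x ![c, e, f, g, h] =
    nabla Γ (skewB Γ) x ![c, e, f] * skewB Γ x ![g, h]
      + skewB Γ x ![e, f] * nabla Γ (skewB Γ) x ![c, g, h] := by
  have h1 : ∀ i, DifferentiableAt ℝ (fun y => skewB Γ y i) x := fun i =>
    (contDiffAt_skewB (m := 3) hΓ (by norm_num) _).differentiableAt (by norm_num)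
  rw [nabla_four, nabla_two, nabla_two]
  simp only [tensorBB, Fin.sum_univ_two]
  simp only [Matrix.cons_val]
  rw [pd_mul (h1 _) (h1 _)]
  ring

theorem tensorU_unitVol (b c a : Fin 2) : tensorU Γ unitVol x b c a =
    2 / 3 * ∑ d, alt b d * (nabla Γ (nabla Γ (tensorY Γ)) x ![c, a, 0, 1, d]
        - nabla Γ (nabla Γ (nabla Γ (skewB Γ))) x ![c, a, d, 0, 1])
      + 2 * ∑ d, alt b d * (nabla Γ (skewB Γ) x ![c, 0, 1] * schouten Γ x ![d, a]
        + skewB Γ x ![0, 1] * nabla Γ (schouten Γ) x ![c, d, a])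
      + 4 * (skewB Γ x ![0, 1] * nabla Γ (skewB Γ) x ![c, 0, 1]) * kron b a
      + ∑ d, alt b d * covN Γ unitVol x a * (schouten Γ x ![d, c]
        + skewB Γ x ![0, 1] * alt c d) := by
  rw [tensorU, beta_unitVol]
  simp only [nabla_tensorBP_apply hΓ, nabla_tensorBB_apply hΓ]
  fin_cases b <;>
  simp [epsUp, epsLo, alt, Fin.sum_univ_two, nabla_nabla_tensorY_swap x _ _ 0 1,
    nabla_nabla_nabla_skewB_swap x _ _ _ 0 1, nabla_skewB_swap x _ 0 1, skewB_swap x 0 1] <;> ring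

/-- The contraction `ε^{de} ∇_c ∇_d P_{ea}` in `V` sees only the part of `∇P` skew in its first two
indices, which is `Y`. -/
theorem nabla_nabla_schouten_sub (c i j k : Fin 2) :
    nabla Γ (nabla Γ (schouten Γ)) x ![c, i, j, k] - nabla Γ (nabla Γ (schouten Γ)) x ![c, j, i, k]
      = 2 * nabla Γ (tensorY Γ) x ![c, i, j, k] := by
  have h1 : ∀ i, DifferentiableAt ℝ (fun y => nabla Γ (schouten Γ) y i) x := fun i =>
    (contDiffAt_nabla_schouten hΓ _).differentiableAt (by norm_num)
  rw [nabla_three, nabla_three, nabla_three]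
  simp only [tensorY, Fin.sum_univ_two]
  simp only [Matrix.cons_val]
  rw [pd_const_mul, pd_sub (h1 _) (h1 _)]
  ring

theorem tensorV_unitVol (c a : Fin 2) : tensorV Γ unitVol x c a =
    -(∑ b, alt b c * tensorM Γ unitVol x a b) - 2 / 3 * nabla Γ (tensorY Γ) x ![c, 0, 1, a]
      + 8 / 3 * nabla Γ (nabla Γ (skewB Γ)) x ![c, a, 0, 1] := by
  have h := nabla_nabla_schouten_sub hΓ c 0 1 a
  rw [tensorV]
  simp [lowM, epsUp, epsLo, alt, Fin.sum_univ_two, nabla_nabla_skewB_swap x _ _ 0 1]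
  linear_combination (-1/3) * h

end unit

/-! ### The prolonged connection and its obstruction rows -/

section prolongation

variable (Γ : Plane → Fin 2 → Fin 2 → Fin 2 → ℝ)

/-- The trace `Γ^c_{ac}`. -/
noncomputable def traceGam (x : Plane) (a : Fin 2) : ℝ := ∑ c, Γ x c a c

/-- The matrices `A_c` of the prolonged Killing system `∂_c u = A_c u` for `u = (K_1, K_2, μ)`, where
`∇_a K_b = μ` times the coordinate volume form. -/
noncomputable def prolong (c : Fin 2) (x : Plane) : Matrix (Fin 3) (Fin 3) ℝ :=
  !![Γ x 0 c 0, Γ x 1 c 0, alt c 0;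
     Γ x 0 c 1, Γ x 1 c 1, alt c 1;
     curv Γ x 0 1 0 c, curv Γ x 0 1 1 c, traceGam Γ x c]

/-- The rows of the obstruction matrix for the coordinate volume form. -/
noncomputable def obsRow (i : Fin 3) (x : Plane) : Fin 3 → ℝ := obstructionMatrix Γ unitVol x i

/-- The covariant derivative of a row with respect to matrices `A`. -/
noncomputable def rowD (A : Fin 2 → Plane → Matrix (Fin 3) (Fin 3) ℝ) (b : Fin 2) (ρ : Plane → Fin 3 → ℝ)
    (x : Plane) (j : Fin 3) : ℝ :=
  pd b (fun y => ρ y j) x + ∑ k, ρ x k * A b x k j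

/-- The curvature matrix of the connection with matrices `A`. -/
noncomputable def curvMat (A : Fin 2 → Plane → Matrix (Fin 3) (Fin 3) ℝ) (x : Plane) : Matrix (Fin 3) (Fin 3) ℝ :=
  fun i j => pd 0 (fun y => A 1 y i j) x - pd 1 (fun y => A 0 y i j) x
    + ((A 1 x * A 0 x) i j - (A 0 x * A 1 x) i j)

/-- The row `(U^1_{ca}, U^2_{ca}, V_{ca})` for the coordinate volume form. -/
noncomputable def rowU (x : Plane) (c a : Fin 2) : Fin 3 → ℝ :=
  ![tensorU Γ unitVol x 0 c a, tensorU Γ unitVol x 1 c a, tensorV Γ unitVol x c a]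

variable {Γ}

/-- On a surface the whole curvature is algebraic in the Ricci tensor, hence in `P`. This and the
next lemma eliminate `curv` in favour of `P`. -/
theorem curv_zero_one_zero (x : Plane) (b : Fin 2) :
    curv Γ x 0 1 0 b = 2 * schouten Γ x ![1, b] - schouten Γ x ![b, 1] := by
  fin_cases b <;> simp [schouten, ricci, curv, Fin.sum_univ_two] <;> ring

theorem curv_zero_one_one (x : Plane) (b : Fin 2) :
    curv Γ x 0 1 1 b = schouten Γ x ![b, 0] - 2 * schouten Γ x ![0, b] := by
  fin_cases b <;> simp [schouten, ricci, curv, Fin.sum_univ_two] <;> ring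

theorem obsRow_zero (x : Plane) :
    obsRow Γ 0 x = ![vecF Γ unitVol x 0, vecF Γ unitVol x 1, beta Γ unitVol x] := by
  ext j; fin_cases j <;> rfl

theorem obsRow_succ (a : Fin 2) (x : Plane) :
    obsRow Γ a.succ x = ![tensorM Γ unitVol x a 0, tensorM Γ unitVol x a 1, covN Γ unitVol x a] := by
  fin_cases a <;> ext j <;> fin_cases j <;> rfl

theorem nabla_skewB_self (x : Plane) (a i : Fin 2) : nabla Γ (skewB Γ) x ![a, i, i] = 0 := by
  have := nabla_skewB_swap (Γ := Γ) x a i i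
  linarith

theorem nabla_tensorY_self (x : Plane) (a i k : Fin 2) :
    nabla Γ (tensorY Γ) x ![a, i, i, k] = 0 := by
  have := nabla_tensorY_swap (Γ := Γ) x a i i k
  linarith

theorem nabla_nabla_skewB_self (x : Plane) (a b i : Fin 2) :
    nabla Γ (nabla Γ (skewB Γ)) x ![a, b, i, i] = 0 := by
  have := nabla_nabla_skewB_swap (Γ := Γ) x a b i i
  linarith

variable {x : Plane} (hΓ : ∀ c a b, ContDiffAt ℝ 4 (fun y => Γ y c a b) x)
  (hsym : ∀ c a b, Γ x c a b = Γ x c b a)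
include hΓ

theorem contDiffAt_vecF_unitVol (a : Fin 2) :
    ContDiffAt ℝ 2 (fun y => vecF Γ unitVol y a) x := by
  simp only [vecF_unitVol]
  exact contDiffAt_const.mul (ContDiffAt.sum fun b _ => contDiffAt_const.mul
    ((contDiffAt_tensorY hΓ _).sub (contDiffAt_nabla_skewB hΓ _)))

theorem contDiffAt_beta_unitVol : ContDiffAt ℝ 3 (fun y => beta Γ unitVol y) x := by
  simp only [beta_unitVol]
  exact contDiffAt_const.mul (contDiffAt_skewB hΓ (by norm_num) _)

theorem contDiffAt_covN_unitVol (a : Fin 2) :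
    ContDiffAt ℝ 2 (fun y => covN Γ unitVol y a) x := by
  simp only [covN_unitVol]
  exact ((ContDiffAt.sum fun b _ => contDiffAt_const.mul
    (contDiffAt_vecF_unitVol hΓ b)).neg).add (contDiffAt_const.mul (contDiffAt_nabla_skewB hΓ _))

theorem contDiffAt_tensorM_unitVol (a b : Fin 2) :
    ContDiffAt ℝ 1 (fun y => tensorM Γ unitVol y a b) x := by
  simp only [tensorM_unitVol]
  have hB := (contDiffAt_skewB (m := 1) hΓ (by norm_num) ![0, 1])
  refine ((contDiffAt_const.mul (ContDiffAt.sum fun c _ => contDiffAt_const.mul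
    ((contDiffAt_nabla_tensorY hΓ _).sub (contDiffAt_nabla_nabla_skewB hΓ _)))).add
    ((contDiffAt_const.mul hB).mul (ContDiffAt.sum fun c _ => contDiffAt_const.mul
      (contDiffAt_schouten hΓ (by norm_num) _)))).add
    ((contDiffAt_const.mul (hB.mul hB)).mul contDiffAt_const)

theorem contDiffAt_obsRow_zero (j : Fin 3) : ContDiffAt ℝ 2 (fun y => obsRow Γ 0 y j) x := by
  simp only [obsRow_zero]
  fin_cases j
  · exact contDiffAt_vecF_unitVol hΓ 0
  · exact contDiffAt_vecF_unitVol hΓ 1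
  · exact (contDiffAt_beta_unitVol hΓ).of_le (by norm_num)

theorem contDiffAt_obsRow (i j : Fin 3) : ContDiffAt ℝ 1 (fun y => obsRow Γ i y j) x := by
  induction i using Fin.cases with
  | zero => exact (contDiffAt_obsRow_zero hΓ j).of_le (by norm_num)
  | succ a =>
    simp only [obsRow_succ]
    fin_cases j
    · exact contDiffAt_tensorM_unitVol hΓ a 0
    · exact contDiffAt_tensorM_unitVol hΓ a 1
    · exact (contDiffAt_covN_unitVol hΓ a).of_le (by norm_num)

theorem pd_vecF_unitVol (c a : Fin 2) : pd c (fun y => vecF Γ unitVol y a) x =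
    2 / 3 * ∑ b, alt a b * (pd c (fun y => tensorY Γ y ![0, 1, b]) x
      - pd c (fun y => nabla Γ (skewB Γ) y ![b, 0, 1]) x) := by
  have hY : ∀ i, DifferentiableAt ℝ (fun y => tensorY Γ y i) x := fun i =>
    (contDiffAt_tensorY hΓ _).differentiableAt (by norm_num)
  have hB : ∀ i, DifferentiableAt ℝ (fun y => nabla Γ (skewB Γ) y i) x := fun i =>
    (contDiffAt_nabla_skewB hΓ _).differentiableAt (by norm_num)
  simp only [vecF_unitVol]
  rw [pd_const_mul, pd_sum (F := fun b y => alt a b * (tensorY Γ y ![0, 1, b]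
    - nabla Γ (skewB Γ) y ![b, 0, 1])) _ fun i _ => ((hY _).sub (hB _)).const_mul _]
  simp only [pd_const_mul]
  congr 1
  exact Finset.sum_congr rfl fun b _ => by rw [pd_sub (hY _) (hB _)]

theorem pd_covN_unitVol (c a : Fin 2) : pd c (fun y => covN Γ unitVol y a) x =
    -(∑ b, alt b a * pd c (fun y => vecF Γ unitVol y b) x)
      + 2 * pd c (fun y => nabla Γ (skewB Γ) y ![a, 0, 1]) x := by
  have hF : ∀ b, DifferentiableAt ℝ (fun y => vecF Γ unitVol y b) x := fun b =>
    (contDiffAt_vecF_unitVol hΓ b).differentiableAt (by norm_num)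
  have hB : ∀ i, DifferentiableAt ℝ (fun y => nabla Γ (skewB Γ) y i) x := fun i =>
    (contDiffAt_nabla_skewB hΓ _).differentiableAt (by norm_num)
  simp only [covN_unitVol, Fin.sum_univ_two]
  rw [pd_add (by fun_prop) (by fun_prop), pd_neg, pd_add (by fun_prop) (by fun_prop)]
  simp only [pd_const_mul]

theorem pd_tensorM_unitVol (d a b : Fin 2) : pd d (fun y => tensorM Γ unitVol y a b) x =
    2 / 3 * ∑ c, alt b c * (pd d (fun y => nabla Γ (tensorY Γ) y ![a, 0, 1, c]) x
        - pd d (fun y => nabla Γ (nabla Γ (skewB Γ)) y ![a, c, 0, 1]) x)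
      + 2 * ∑ c, alt b c * (pd d (fun y => skewB Γ y ![0, 1]) x * schouten Γ x ![c, a]
        + skewB Γ x ![0, 1] * pd d (fun y => schouten Γ y ![c, a]) x)
      + 4 * (skewB Γ x ![0, 1] * pd d (fun y => skewB Γ y ![0, 1]) x) * kron b a := by
  have h1 : ∀ i, DifferentiableAt ℝ (fun y => nabla Γ (tensorY Γ) y i) x := fun i =>
    (contDiffAt_nabla_tensorY hΓ _).differentiableAt (by norm_num)
  have h2 : ∀ i, DifferentiableAt ℝ (fun y => nabla Γ (nabla Γ (skewB Γ)) y i) x := fun i =>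
    (contDiffAt_nabla_nabla_skewB hΓ _).differentiableAt (by norm_num)
  have h3 : ∀ i, DifferentiableAt ℝ (fun y => skewB Γ y i) x := fun i =>
    (contDiffAt_skewB (m := 3) hΓ (by norm_num) _).differentiableAt (by norm_num)
  have h4 : ∀ i, DifferentiableAt ℝ (fun y => schouten Γ y i) x := fun i =>
    (contDiffAt_schouten (m := 3) hΓ (by norm_num) _).differentiableAt (by norm_num)
  simp only [tensorM_unitVol, Fin.sum_univ_two]
  rw [pd_add (by fun_prop) (by fun_prop), pd_add (by fun_prop) (by fun_prop),
    pd_mul (f := fun y => 2 * skewB Γ y ![0, 1]) (g := fun y => alt b 0 * schouten Γ y ![0, a]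
      + alt b 1 * schouten Γ y ![1, a]) (by fun_prop) (by fun_prop),
    pd_mul (f := fun y => 2 * (skewB Γ y ![0, 1] * skewB Γ y ![0, 1])) (g := fun _ => kron b a)
      (by fun_prop) (by fun_prop), pd_const]
  simp only [pd_const_mul]
  rw [pd_add (by fun_prop) (by fun_prop), pd_add (by fun_prop) (by fun_prop),
    pd_mul (h3 _) (h3 _)]
  simp only [pd_const_mul]
  rw [pd_sub (by fun_prop) (by fun_prop), pd_sub (by fun_prop) (by fun_prop)]
  ring

include hsym

/-- `M` and `N` are by design what differentiating the first integrability condition produces. The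
trace term is present because, with the coordinate volume form, the pairing of the row with a jet is
a density of weight two. -/
theorem rowD_obsRow_zero (a : Fin 2) (j : Fin 3) : rowD (prolong Γ) a (obsRow Γ 0) x j =
    obsRow Γ a.succ x j + 2 * traceGam Γ x a * obsRow Γ 0 x j := by
  have hs : ∀ c, Γ x c 1 0 = Γ x c 0 1 := fun c => hsym c 1 0
  have hB : skewB Γ x ![0, 1] = schouten Γ x ![1, 0] - schouten Γ x ![0, 1] := by simp [skewB]
  rw [rowD, Fin.sum_univ_three]
  simp only [obsRow_succ, obsRow_zero]
  fin_cases j <;>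
    simp only [Fin.zero_eta, Fin.mk_one, Fin.reduceFinMk, Matrix.cons_val, beta_unitVol,
      pd_const_mul, pd_vecF_unitVol hΓ, tensorM_unitVol, nabla_three, covN_unitVol] <;>
    simp only [vecF_unitVol, prolong, curv_zero_one_zero, curv_zero_one_one, Fin.sum_univ_two,
      tensorY_self, nabla_skewB_self, traceGam] <;>
    fin_cases a <;>
    simp [alt, kron, hs, nabla_two, skewB_self, hB] <;>
    ring

-- The same computation one order higher: `U` and `V` are the new content of the second derivative
-- of the integrability condition. The trace term is again the density weight, and the last sum is
-- the Christoffel correction for the index `a`.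
set_option maxHeartbeats 4000000 in
theorem rowD_obsRow_succ (c a : Fin 2) (j : Fin 3) :
    rowD (prolong Γ) c (obsRow Γ a.succ) x j = rowU Γ x c a j
      + 2 * traceGam Γ x c * obsRow Γ a.succ x j + ∑ e, Γ x e c a * obsRow Γ e.succ x j := by
  have hs : ∀ c, Γ x c 1 0 = Γ x c 0 1 := fun c => hsym c 1 0
  have hB : skewB Γ x ![0, 1] = schouten Γ x ![1, 0] - schouten Γ x ![0, 1] := by simp [skewB]
  rw [rowD, Fin.sum_univ_three, rowU]
  simp only [obsRow_succ]
  fin_cases j <;>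
    simp only [Fin.zero_eta, Fin.mk_one, Fin.reduceFinMk, Matrix.cons_val, Fin.sum_univ_two,
      tensorU_unitVol hΓ, tensorV_unitVol hΓ, pd_tensorM_unitVol hΓ, pd_covN_unitVol hΓ,
      pd_vecF_unitVol hΓ, nabla_four] <;>
    simp only [tensorM_unitVol, covN_unitVol, vecF_unitVol, prolong, curv_zero_one_zero,
      curv_zero_one_one, Fin.sum_univ_two, traceGam, nabla_tensorY_self,
      nabla_nabla_skewB_self] <;>
    fin_cases c <;> fin_cases a <;>
    simp [alt, kron, hs, tensorY_self, skewB_self, nabla_two, nabla_three, pd_const,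
      skewB_swap x 0 1] <;>
    simp only [hB] <;>
    ring

end prolongation

/-! ### Curvature of the prolonged Killing connection. -/

section curvature

variable {Γ : Plane → Fin 2 → Fin 2 → Fin 2 → ℝ} {x : Plane}

/-- The equation for `∂_c μ` was obtained by cross-differentiating the first two equations, so their
rows of the curvature vanish identically. Only cross-differentiation of the equation for `μ` gives a
condition, and it is the pairing with `(F, β)`. -/
theorem curvMat_prolong (hΓ : ∀ c a b, ContDiffAt ℝ 4 (fun y => Γ y c a b) x)
    (hsym : ∀ c a b, Γ x c a b = Γ x c b a) (i j : Fin 3) :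
    curvMat (prolong Γ) x i j = if i = 2 then 3 * obsRow Γ 0 x j else 0 := by
  have hs : ∀ c, Γ x c 1 0 = Γ x c 0 1 := fun c => hsym c 1 0
  have h4 : ∀ i, DifferentiableAt ℝ (fun y => schouten Γ y i) x := fun i =>
    (contDiffAt_schouten (m := 3) hΓ (by norm_num) _).differentiableAt (by norm_num)
  have hd : ∀ c a b, DifferentiableAt ℝ (fun y => Γ y c a b) x := fun c a b =>
    (hΓ c a b).differentiableAt (by norm_num)
  have hB : ∀ y, skewB Γ y ![0, 1] = schouten Γ y ![1, 0] - schouten Γ y ![0, 1] := fun y => by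
    simp [skewB]
  have p0 : ∀ a b, pd a (fun y => curv Γ y 0 1 0 b) x =
      2 * pd a (fun y => schouten Γ y ![1, b]) x - pd a (fun y => schouten Γ y ![b, 1]) x := by
    intro a b
    simp only [curv_zero_one_zero]
    rw [pd_sub ((h4 _).const_mul _) (h4 _), pd_const_mul]
  have p1 : ∀ a b, pd a (fun y => curv Γ y 0 1 1 b) x =
      pd a (fun y => schouten Γ y ![b, 0]) x - 2 * pd a (fun y => schouten Γ y ![0, b]) x := by
    intro a b
    simp only [curv_zero_one_one]
    rw [pd_sub (h4 _) ((h4 _).const_mul _), pd_const_mul]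
  have pB : ∀ a, pd a (fun y => skewB Γ y ![0, 1]) x =
      pd a (fun y => schouten Γ y ![1, 0]) x - pd a (fun y => schouten Γ y ![0, 1]) x := by
    intro a
    simp only [hB]
    rw [pd_sub (h4 _) (h4 _)]
  -- The quadratic terms in `Γ` cancel in the trace of the curvature, so that trace is the exterior
  -- derivative of the trace of `Γ`.
  have pt : pd 0 (fun y => traceGam Γ y 1) x - pd 1 (fun y => traceGam Γ y 0) x =
      curv Γ x 0 1 0 0 + curv Γ x 0 1 1 1 := by
    simp only [traceGam, Fin.sum_univ_two]
    rw [pd_add (hd _ _ _) (hd _ _ _), pd_add (hd _ _ _) (hd _ _ _)]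
    simp only [curv, Fin.sum_univ_two]
    ring
  rw [curvMat, Matrix.mul_apply, Matrix.mul_apply, Fin.sum_univ_three, Fin.sum_univ_three,
    obsRow_zero]
  fin_cases i
  · fin_cases j <;> simp [prolong, alt, pd_const, curv, traceGam, Fin.sum_univ_two, hs] <;> ring
  · fin_cases j <;> simp [prolong, alt, pd_const, curv, traceGam, Fin.sum_univ_two, hs] <;> ring
  · fin_cases j
    · simp [prolong, alt, vecF_unitVol, nabla_two, tensorY, Fin.sum_univ_two, hs, p0, pB,
        traceGam, skewB_self]
      simp only [curv_zero_one_zero, curv_zero_one_one, hB]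
      ring
    · simp [prolong, alt, vecF_unitVol, nabla_two, tensorY, Fin.sum_univ_two, hs, p1, pB,
        traceGam, skewB_self]
      simp only [curv_zero_one_zero, curv_zero_one_one, hB]
      ring
    · have pt' := pt
      simp only [curv_zero_one_zero, curv_zero_one_one] at pt'
      simp [prolong, alt, beta_unitVol, curv_zero_one_zero, curv_zero_one_one, hB]
      linear_combination pt'

end curvature

/-! ### Dependence on the volume form -/

/-- The determinant of three rows. -/
noncomputable def det3 (a b c : Fin 3 → ℝ) : ℝ :=
  a 0 * (b 1 * c 2 - b 2 * c 1) - a 1 * (b 0 * c 2 - b 2 * c 0) + a 2 * (b 0 * c 1 - b 1 * c 0)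


section scaling

variable {Γ : Plane → Fin 2 → Fin 2 → Fin 2 → ℝ} {v : Plane → ℝ} {x : Plane}

/-- No invariant differentiates the volume form, so `v` enters each of them only as a power
determined by counting `ε`'s. All computations can therefore be done with `v = 1`, and the choice of
volume form is immaterial. -/
theorem epsUp_eq (a b : Fin 2) : epsUp v x a b = (v x)⁻¹ * epsUp unitVol x a b := by
  simp [epsUp, div_eq_mul_inv, mul_comm]

theorem epsLo_eq (a b : Fin 2) : epsLo v x a b = v x * epsLo unitVol x a b := by
  simp [epsLo, mul_comm]

theorem beta_eq : beta Γ v x = (v x)⁻¹ * beta Γ unitVol x := by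
  simp only [beta, epsUp_eq (v := v), Fin.sum_univ_two]
  ring

theorem vecF_eq (a : Fin 2) : vecF Γ v x a = (v x)⁻¹ ^ 2 * vecF Γ unitVol x a := by
  simp only [vecF, cotton, epsUp_eq (v := v), Fin.sum_univ_two]
  ring

theorem schoutenUp_eq (a b : Fin 2) :
    schoutenUp Γ v x a b = (v x)⁻¹ * schoutenUp Γ unitVol x a b := by
  simp only [schoutenUp, epsUp_eq (v := v), Fin.sum_univ_two]
  ring

theorem tensorM_eq (a b : Fin 2) :
    tensorM Γ v x a b = (v x)⁻¹ ^ 2 * tensorM Γ unitVol x a b := by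
  simp only [tensorM, epsUp_eq (v := v), beta_eq (v := v), schoutenUp_eq (v := v),
    Fin.sum_univ_two]
  ring

variable (hv : v x ≠ 0)
include hv

theorem covF_eq (a : Fin 2) : covF Γ v x a = (v x)⁻¹ * covF Γ unitVol x a := by
  simp only [covF, epsLo_eq (v := v), vecF_eq (v := v), Fin.sum_univ_two]
  field_simp

theorem lowM_eq (a b : Fin 2) : lowM Γ v x a b = (v x)⁻¹ * lowM Γ unitVol x a b := by
  simp only [lowM, epsLo_eq (v := v), tensorM_eq (v := v), Fin.sum_univ_two]
  field_simp

theorem covN_eq (a : Fin 2) : covN Γ v x a = (v x)⁻¹ * covN Γ unitVol x a := by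
  simp only [covN, covF_eq hv, epsUp_eq (v := v), Fin.sum_univ_two]
  ring

theorem tensorU_eq (b c a : Fin 2) :
    tensorU Γ v x b c a = (v x)⁻¹ ^ 2 * tensorU Γ unitVol x b c a := by
  have h : ∀ s t : ℝ, (v x)⁻¹ * (v x * s) = s := fun s t => by field_simp
  have h' : ∀ d e, beta Γ v x * epsLo v x d e = beta Γ unitVol x * epsLo unitVol x d e := by
    intro d e
    rw [beta_eq, epsLo_eq]; field_simp
  simp only [tensorU, mul_assoc, h']
  simp only [epsUp_eq (v := v), covN_eq hv, Fin.sum_univ_two]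
  ring

theorem tensorV_eq (c a : Fin 2) : tensorV Γ v x c a = (v x)⁻¹ * tensorV Γ unitVol x c a := by
  simp only [tensorV, lowM_eq hv, epsUp_eq (v := v), Fin.sum_univ_two]
  ring

theorem tensorT_eq (a b : Fin 2) : tensorT Γ v x a b = (v x)⁻¹ ^ 3 *
    (obsRow Γ a.succ x 2 * obsRow Γ 0 x b.castSucc
      - obsRow Γ 0 x 2 * obsRow Γ a.succ x b.castSucc) := by
  rw [tensorT, covN_eq hv, vecF_eq, beta_eq, tensorM_eq, obsRow_zero, obsRow_succ]
  fin_cases b <;> simp <;> ring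

/-- The condition `I_N = 0` is linear dependence of the three obstruction rows. The exponent is the
sum of the column weights `2 + 2 + 1`. -/
theorem invN_eq : invN Γ v x = (v x)⁻¹ ^ 5 *
    det3 (obsRow Γ 0 x) (obsRow Γ 1 x) (obsRow Γ 2 x) := by
  have h1 : obsRow Γ 1 x = _ := obsRow_succ (Γ := Γ) 0 x
  have h2 : obsRow Γ 2 x = _ := obsRow_succ (Γ := Γ) 1 x
  rw [det3, h1, h2, obsRow_zero]
  simp only [invN, covN_eq hv, vecF_eq (v := v), beta_eq (v := v), tensorM_eq (v := v),
    epsLo, epsUp, Fin.sum_univ_two]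
  simp [alt]
  field_simp
  ring

/-- The two components of `I_S` say that the row `(U, V)_{aa}` adds nothing to the span of row zero
and row `a`, provided these are independent. Lowering one index accounts for the exponent `4` in
place of `5`. -/
theorem tensorW_eq (a : Fin 2) : tensorW Γ v x a a a = (v x)⁻¹ ^ 4 *
    det3 (obsRow Γ 0 x) (obsRow Γ a.succ x) (rowU Γ x a a) := by
  rw [det3, obsRow_succ, obsRow_zero, rowU]
  simp only [tensorW, symU, symV, covN_eq hv, covF_eq hv, beta_eq (v := v), tensorM_eq (v := v),
    lowM_eq hv, tensorU_eq hv, tensorV_eq hv, Fin.sum_univ_two, covF_unitVol]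
  simp [alt, lowM, epsLo, Fin.sum_univ_two]
  field_simp
  ring

theorem obstructionMatrix_eq : obstructionMatrix Γ v x = obstructionMatrix Γ unitVol x *
    Matrix.diagonal ![(v x)⁻¹ ^ 2, (v x)⁻¹ ^ 2, (v x)⁻¹] := by
  ext i j
  rw [Matrix.mul_diagonal]
  fin_cases i <;> fin_cases j <;>
    simp [obstructionMatrix, vecF_eq (v := v), beta_eq (v := v), tensorM_eq (v := v),
      covN_eq hv, mul_comm]

/-- Columns are rescaled by nonzero factors, so the rank, and with it regularity of a point, does
not depend on the volume form. -/
theorem rank_obstructionMatrix_eq :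
    (obstructionMatrix Γ v x).rank = (obstructionMatrix Γ unitVol x).rank := by
  rw [obstructionMatrix_eq hv]
  refine Matrix.rank_mul_eq_left_of_isUnit_det _ _ ?_
  rw [Matrix.det_diagonal, Fin.prod_univ_three]
  simp [hv]

end scaling

/-! ### Linear algebra of `3 × 3` matrices -/

section linalg

open Matrix

theorem det_eq_det3 (M : Matrix (Fin 3) (Fin 3) ℝ) : M.det = det3 (M 0) (M 1) (M 2) := by
  rw [Matrix.det_fin_three, det3]; ring

theorem linearIndependent_iff_det3_ne_zero (a b c : Fin 3 → ℝ) :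
    LinearIndependent ℝ ![a, b, c] ↔ det3 a b c ≠ 0 := by
  have h := Matrix.linearIndependent_rows_iff_isUnit (A := Matrix.of ![a, b, c])
  rw [Matrix.isUnit_iff_isUnit_det, isUnit_iff_ne_zero, det_eq_det3] at h
  exact h

theorem mem_span_of_det3_eq_zero {a b s : Fin 3 → ℝ} (h : det3 a b s = 0)
    (hab : LinearIndependent ℝ ![a, b]) : s ∈ Submodule.span ℝ {a, b} := by
  by_contra hs
  have h1 : LinearIndependent ℝ (Fin.snoc ![a, b] s : Fin 3 → Fin 3 → ℝ) := by
    rw [linearIndependent_finSnoc]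
    refine ⟨hab, ?_⟩
    simpa [Matrix.range_cons, Set.pair_comm] using hs
  have h2 : (Fin.snoc ![a, b] s : Fin 3 → Fin 3 → ℝ) = ![a, b, s] := by
    ext i; fin_cases i <;> rfl
  rw [h2, linearIndependent_iff_det3_ne_zero] at h1
  exact h1 h

/-- The source of all necessary conditions: rows that kill a common nonzero jet are dependent. -/
theorem det3_eq_zero_of_dotProduct {a b c u : Fin 3 → ℝ} (hu : u ≠ 0) (ha : a ⬝ᵥ u = 0)
    (hb : b ⬝ᵥ u = 0) (hc : c ⬝ᵥ u = 0) : det3 a b c = 0 := by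
  have h : (Matrix.of ![a, b, c]).det = 0 := by
    rw [← Matrix.exists_mulVec_eq_zero_iff]
    refine ⟨u, hu, ?_⟩
    ext i
    fin_cases i
    · exact ha
    · exact hb
    · exact hc
  rwa [det_eq_det3] at h

theorem linearIndependent_of_minor_ne_zero {a b : Fin 3 → ℝ} {i j : Fin 3}
    (h : a i * b j - a j * b i ≠ 0) : LinearIndependent ℝ ![a, b] := by
  rw [LinearIndependent.pair_iff]
  intro s t hst
  have hi := congrFun hst i
  have hj := congrFun hst j
  simp only [Pi.add_apply, Pi.smul_apply, smul_eq_mul, Pi.zero_apply] at hi hj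
  constructor
  · apply (mul_eq_zero.1 (?_ : s * (a i * b j - a j * b i) = 0)).resolve_right h
    linear_combination b j * hi - b i * hj
  · apply (mul_eq_zero.1 (?_ : t * (a i * b j - a j * b i) = 0)).resolve_right h
    linear_combination a i * hj - a j * hi

theorem mem_span_singleton_of_minors {a s : Fin 3 → ℝ} (ha : a ≠ 0)
    (h : ∀ i j, a i * s j - a j * s i = 0) : s ∈ Submodule.span ℝ {a} := by
  obtain ⟨i, hi⟩ := Function.ne_iff.1 ha
  have hi' : a i ≠ 0 := hi
  rw [Submodule.mem_span_singleton]
  refine ⟨s i / a i, ?_⟩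
  ext j
  have := h i j
  simp only [Pi.smul_apply, smul_eq_mul]
  field_simp
  linarith

theorem rank_eq_finrank_rows (M : Matrix (Fin 3) (Fin 3) ℝ) :
    M.rank = Module.finrank ℝ (Submodule.span ℝ (Set.range fun i => M i)) :=
  Matrix.rank_eq_finrank_span_row M

theorem two_le_rank_of_linearIndependent {M : Matrix (Fin 3) (Fin 3) ℝ} {i j : Fin 3}
    (h : LinearIndependent ℝ ![M i, M j]) : 2 ≤ M.rank := by
  rw [rank_eq_finrank_rows, ← Fintype.card_fin 2, ← finrank_span_eq_card h]
  refine Submodule.finrank_mono (Submodule.span_mono ?_)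
  rintro _ ⟨k, rfl⟩
  fin_cases k
  · exact ⟨i, rfl⟩
  · exact ⟨j, rfl⟩

theorem rank_eq_three_iff (M : Matrix (Fin 3) (Fin 3) ℝ) :
    M.rank = 3 ↔ det3 (M 0) (M 1) (M 2) ≠ 0 := by
  have e : (fun i => M i) = ![M 0, M 1, M 2] := by ext i; fin_cases i <;> rfl
  rw [← linearIndependent_iff_det3_ne_zero, ← e, rank_eq_finrank_rows,
    linearIndependent_iff_card_eq_finrank_span, Fintype.card_fin, Set.finrank, eq_comm]

theorem rank_le_three (M : Matrix (Fin 3) (Fin 3) ℝ) : M.rank ≤ 3 := by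
  simpa using M.rank_le_width

theorem rank_add_card_le {M : Matrix (Fin 3) (Fin 3) ℝ} {n : ℕ} {u : Fin n → Fin 3 → ℝ}
    (hu : LinearIndependent ℝ u) (h : ∀ i, M *ᵥ u i = 0) : M.rank + n ≤ 3 := by
  have h1 := LinearMap.finrank_range_add_finrank_ker M.mulVecLin
  rw [Module.finrank_fintype_fun_eq_card, Fintype.card_fin] at h1
  have h2 : n ≤ Module.finrank ℝ (LinearMap.ker M.mulVecLin) := by
    have hu' : LinearIndependent ℝ (fun i => (⟨u i, h i⟩ : LinearMap.ker M.mulVecLin)) :=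
      LinearIndependent.of_comp (LinearMap.ker M.mulVecLin).subtype hu
    simpa using hu'.fintype_card_le_finrank
  have h3 : M.rank = Module.finrank ℝ (LinearMap.range M.mulVecLin) := rfl
  omega

theorem exists_linearIndependent_ker (M : Matrix (Fin 3) (Fin 3) ℝ) {n : ℕ} (hn : M.rank + n ≤ 3) :
    ∃ u : Fin n → Fin 3 → ℝ, LinearIndependent ℝ u ∧ ∀ i, M *ᵥ u i = 0 := by
  have h1 := LinearMap.finrank_range_add_finrank_ker M.mulVecLin
  rw [Module.finrank_fintype_fun_eq_card, Fintype.card_fin] at h1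
  have h3 : M.rank = Module.finrank ℝ (LinearMap.range M.mulVecLin) := rfl
  obtain ⟨f, hf⟩ := exists_linearIndependent_of_le_finrank
    (R := ℝ) (M := LinearMap.ker M.mulVecLin) (n := n) (by omega)
  exact ⟨fun i => f i, hf.map' _ (Submodule.ker_subtype _), fun i => (f i).2⟩

theorem rank_eq_zero_iff (M : Matrix (Fin 3) (Fin 3) ℝ) : M.rank = 0 ↔ M = 0 := by
  rw [rank_eq_finrank_rows, Submodule.finrank_eq_zero, Submodule.span_eq_bot]
  constructor
  · intro h
    ext i j
    exact congrFun (h (M i) ⟨i, rfl⟩) j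
  · rintro rfl _ ⟨i, rfl⟩
    rfl

/-- Near `p` the rank of a continuous matrix does not drop, and where it agrees with the rank at `p`
the elements of the row space are controlled by the rows. -/
theorem eventually_rank_le_and_rowSpace_bound {X : Type*} [TopologicalSpace X]
    {M : X → Matrix (Fin 3) (Fin 3) ℝ} {p : X} (hM : ∀ i j, ContinuousAt (fun x => M x i j) p) :
    ∃ C : ℝ, ∀ᶠ x in 𝓝 p, (M p).rank ≤ (M x).rank ∧ ((M x).rank = (M p).rank →
      ∀ s ∈ Submodule.span ℝ (Set.range fun i => M x i), ∀ u : Fin 3 → ℝ,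
        |s ⬝ᵥ u| ≤ C * ‖s‖ * ∑ i, |M x i ⬝ᵥ u|) := by
  classical
  -- Select rows that form a basis of the row space at `p`; by continuity the same rows stay
  -- independent nearby.
  obtain ⟨κ, a, ha, hspan, hli⟩ := exists_linearIndependent' ℝ (fun i => M p i)
  have : Fintype κ := Fintype.ofInjective a ha
  let T : X → (κ → ℝ) →ₗ[ℝ] (Fin 3 → ℝ) := fun x => Fintype.linearCombination ℝ (fun k => M x (a k))
  have hT : ∀ x c, T x c = ∑ k, c k • M x (a k) := fun x c => by
    simp [T, Fintype.linearCombination_apply]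
  have hrank : (M p).rank = Fintype.card κ := by
    rw [rank_eq_finrank_rows, ← hspan, finrank_span_eq_card hli]
  -- Coefficients are bounded by `K` times the norm of their combination at `p`. A perturbation of
  -- the rows of total size below `1 / (2 K)` at most doubles this constant.
  obtain ⟨K, hK0, hK⟩ := (T p).exists_antilipschitzWith (by
    rw [LinearMap.ker_eq_bot]
    exact linearIndependent_iff_injective_fintypeLinearCombination.1 hli)
  have hKb : ∀ c, ‖c‖ ≤ K * ‖T p c‖ := fun c => by
    simpa [dist_eq_norm] using hK.le_mul_dist c 0
  have hKpos : (0 : ℝ) < K := hK0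
  have hcont : Tendsto (fun x => ∑ k, ‖M x (a k) - M p (a k)‖) (𝓝 p) (𝓝 0) := by
    have : Tendsto (fun x => ∑ k, ‖M x (a k) - M p (a k)‖) (𝓝 p)
        (𝓝 (∑ k, ‖M p (a k) - M p (a k)‖)) := by
      refine tendsto_finsetSum _ fun k _ => Tendsto.norm (Tendsto.sub_const ?_ _)
      exact tendsto_pi_nhds.2 fun j => hM (a k) j
    simpa using this
  have hev : ∀ᶠ x in 𝓝 p, ∑ k, ‖M x (a k) - M p (a k)‖ < 1 / (2 * K) :=
    hcont.eventually (gt_mem_nhds (by positivity))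
  refine ⟨2 * K, hev.mono fun x hx => ?_⟩
  have hbound : ∀ c, ‖c‖ ≤ 2 * K * ‖T x c‖ := by
    intro c
    have h1 : ‖T x c - T p c‖ ≤ ‖c‖ * (1 / (2 * K)) := by
      rw [hT, hT, ← Finset.sum_sub_distrib]
      calc ‖∑ k, (c k • M x (a k) - c k • M p (a k))‖
          ≤ ∑ k, ‖c k • M x (a k) - c k • M p (a k)‖ := norm_sum_le _ _
        _ ≤ ∑ k, ‖c‖ * ‖M x (a k) - M p (a k)‖ := by
            refine Finset.sum_le_sum fun k _ => ?_
            rw [← smul_sub, norm_smul]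
            gcongr
            exact norm_le_pi_norm c k
        _ = ‖c‖ * ∑ k, ‖M x (a k) - M p (a k)‖ := by rw [Finset.mul_sum]
        _ ≤ _ := by gcongr
    have h2 : ‖T p c‖ ≤ ‖T x c‖ + ‖c‖ * (1 / (2 * K)) := by
      have := norm_sub_norm_le (T p c) (T x c)
      rw [norm_sub_rev] at this
      linarith
    have h3 := (hKb c).trans (mul_le_mul_of_nonneg_left h2 hKpos.le)
    have h4 : (K : ℝ) * (‖T x c‖ + ‖c‖ * (1 / (2 * K))) = K * ‖T x c‖ + ‖c‖ / 2 := by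
      field_simp
    linarith
  have hlix : LinearIndependent ℝ (fun k => M x (a k)) := by
    rw [linearIndependent_iff_injective_fintypeLinearCombination]
    refine (injective_iff_map_eq_zero _).2 fun c hc => ?_
    have := hbound c
    change T x c = 0 at hc
    rw [hc, norm_zero, mul_zero] at this
    exact norm_le_zero_iff.1 this
  have hle : Submodule.span ℝ (Set.range fun k => M x (a k)) ≤
      Submodule.span ℝ (Set.range fun i => M x i) :=
    Submodule.span_mono (by rintro _ ⟨k, rfl⟩; exact ⟨a k, rfl⟩)
  have hcard := finrank_span_eq_card hlix
  constructor
  · rw [hrank, rank_eq_finrank_rows, ← hcard]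
    exact Submodule.finrank_mono hle
  · intro hr s hs u
    -- If the rank at `x` is that at `p`, the selected rows span the row space at `x`, so `s` is a
    -- combination of them with controlled coefficients.
    rw [← Submodule.eq_of_le_of_finrank_eq hle
      (by rw [hcard, ← hrank, ← hr, rank_eq_finrank_rows])] at hs
    obtain ⟨c, rfl⟩ := (Submodule.mem_span_range_iff_exists_fun ℝ).1 hs
    have hc := hbound c
    rw [hT] at hc
    calc |(∑ k, c k • M x (a k)) ⬝ᵥ u| = |∑ k, c k * (M x (a k) ⬝ᵥ u)| := by
          rw [sum_dotProduct]; simp [smul_dotProduct]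
      _ ≤ ∑ k, |c k * (M x (a k) ⬝ᵥ u)| := Finset.abs_sum_le_sum_abs _ _
      _ ≤ ∑ k, ‖c‖ * |M x (a k) ⬝ᵥ u| := by
          refine Finset.sum_le_sum fun k _ => ?_
          rw [abs_mul]
          gcongr
          exact norm_le_pi_norm c k
      _ = ‖c‖ * ∑ k, |M x (a k) ⬝ᵥ u| := by rw [Finset.mul_sum]
      _ ≤ ‖c‖ * ∑ i, |M x i ⬝ᵥ u| := by
          gcongr
          rw [← Finset.sum_image (s := Finset.univ) (g := a) (f := fun i => |M x i ⬝ᵥ u|)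
            (fun _ _ _ _ h => ha h)]
          exact Finset.sum_le_sum_of_subset_of_nonneg (Finset.subset_univ _)
            fun _ _ _ => abs_nonneg _
      _ ≤ _ := by gcongr

end linalg

/-! ### Squares in the plane -/

/-- The open square with centre `p` and half side `r`. -/
def square (p : Plane) (r : ℝ) : Set Plane := {x | ∀ i, |x i - p i| < r}

theorem isOpen_square (p : Plane) (r : ℝ) : IsOpen (square p r) := by
  simp only [square, Set.ofPred_forall]
  refine isOpen_iInter_of_finite fun i => isOpen_lt ?_ continuous_const
  fun_prop

theorem convex_square (p : Plane) (r : ℝ) : Convex ℝ (square p r) := by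
  have : square p r = ⋂ i, (EuclideanSpace.proj i : Plane →L[ℝ] ℝ) ⁻¹' Metric.ball (p i) r := by
    ext x; simp [square, Real.dist_eq]
  rw [this]
  exact convex_iInter fun i => (convex_ball (p i) r).linear_preimage
    (EuclideanSpace.proj i : Plane →L[ℝ] ℝ).toLinearMap

theorem mem_square_self {p : Plane} {r : ℝ} (hr : 0 < r) : p ∈ square p r := by
  simpa [square] using hr

theorem square_mem_nhds {p : Plane} {r : ℝ} (hr : 0 < r) : square p r ∈ 𝓝 p :=
  (isOpen_square p r).mem_nhds (mem_square_self hr)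

theorem square_mono {p : Plane} {r s : ℝ} (h : r ≤ s) : square p r ⊆ square p s :=
  fun _ hx i => (hx i).trans_le h

theorem exists_square_subset {p : Plane} {N : Set Plane} (hN : N ∈ 𝓝 p) :
    ∃ r > 0, square p r ⊆ N := by
  obtain ⟨ε, hε, h⟩ := Metric.mem_nhds_iff.1 hN
  refine ⟨ε / 2, by positivity, fun x hx => h ?_⟩
  rw [mem_ball_iff_norm, plane_eq_sum (x - p)]
  calc _ ≤ ∑ a, ‖(x - p) a • stdVec a‖ := norm_sum_le _ _
    _ = |x 0 - p 0| + |x 1 - p 1| := by simp [norm_smul, Fin.sum_univ_two]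
    _ < ε / 2 + ε / 2 := add_lt_add (hx 0) (hx 1)
    _ = ε := by ring

/-! ### Linear differential equations and Grönwall estimates -/

section ode

variable {E : Type*} [NormedAddCommGroup E] [NormedSpace ℝ E]

/-- Picard–Lindelöf on the ball of radius `‖u₀‖` about `u₀`: there the speed is at most `2 K ‖u₀‖`,
and `K ρ ≤ 1 / 2` keeps the solution inside. By linearity the interval does not depend on `u₀`, so
one square serves all initial values. -/
theorem exists_linear_ode_solution [CompleteSpace E] {A : ℝ → E →L[ℝ] E} {ρ K : ℝ} (hρ : 0 < ρ)
    (hA : ContinuousOn A (Icc (-ρ) ρ)) (hK : ∀ t ∈ Icc (-ρ) ρ, ‖A t‖ ≤ K) (hKρ : K * ρ ≤ 1 / 2)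
    (u₀ : E) : ∃ u : ℝ → E, u 0 = u₀ ∧ ∀ t ∈ Ioo (-ρ) ρ, HasDerivAt u (A t (u t)) t := by
  have hK0 : 0 ≤ K := (norm_nonneg _).trans (hK 0 ⟨by linarith, by linarith⟩)
  have hPL : IsPicardLindelof (fun t u => A t u) (tmin := -ρ) (tmax := ρ)
      ⟨0, by constructor <;> linarith⟩ u₀ ‖u₀‖₊ 0 (⟨K, hK0⟩ * (2 * ‖u₀‖₊)) ⟨K, hK0⟩ :=
    { lipschitzOnWith := fun t ht =>
        ((A t).lipschitz.weaken (show ‖A t‖₊ ≤ ⟨K, hK0⟩ from hK t ht)).lipschitzOnWith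
      continuousOn := fun x _ => hA.clm_apply continuousOn_const
      norm_le := fun t ht x hx => by
        have hx' : ‖x‖ ≤ 2 * ‖u₀‖ := by
          have h1 := norm_sub_norm_le x u₀
          have h2 : ‖x - u₀‖ ≤ ‖u₀‖ := by
            rw [← dist_eq_norm]; simpa using hx
          linarith
        calc ‖A t x‖ ≤ ‖A t‖ * ‖x‖ := (A t).le_opNorm x
          _ ≤ K * (2 * ‖u₀‖) := mul_le_mul (hK t ht) hx' (norm_nonneg _) hK0
      mul_max_le := by
        have h0 : 0 ≤ ‖u₀‖ := norm_nonneg _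
        have h1 : ((⟨K, hK0⟩ * (2 * ‖u₀‖₊) : NNReal) : ℝ) = K * (2 * ‖u₀‖) := rfl
        simp only [sub_zero, zero_sub, neg_neg, max_self, h1, coe_nnnorm, NNReal.coe_zero]
        nlinarith }
  obtain ⟨u, h0, hu⟩ := hPL.exists_eq_forall_mem_Icc_hasDerivWithinAt₀
  exact ⟨u, h0, fun t ht => (hu t (Ioo_subset_Icc_self ht)).hasDerivAt (Icc_mem_nhds ht.1 ht.2)⟩

/-- Negative times are reduced to positive ones by the reflection `τ ↦ -τ`. -/
theorem norm_le_gronwallBound_uIcc {f f' : ℝ → E} {K ε δ t : ℝ}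
    (hf : ∀ τ ∈ uIcc 0 t, HasDerivAt f (f' τ) τ) (h0 : ‖f 0‖ ≤ δ)
    (hb : ∀ τ ∈ uIcc 0 t, ‖f' τ‖ ≤ K * ‖f τ‖ + ε) : ‖f t‖ ≤ gronwallBound δ K ε |t| := by
  rcases le_total 0 t with ht | ht
  · rw [uIcc_of_le ht] at hf hb
    have := norm_le_gronwallBound_of_norm_deriv_right_le (f := f) (f' := f') (a := 0) (b := t)
      (fun x hx => (hf x hx).continuousAt.continuousWithinAt)
      (fun x hx => (hf x (Ico_subset_Icc_self hx)).hasDerivWithinAt) h0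
      (fun x hx => hb x (Ico_subset_Icc_self hx)) t ⟨ht, le_rfl⟩
    rw [abs_of_nonneg ht]
    rwa [sub_zero] at this
  · rw [uIcc_of_ge ht] at hf hb
    have hf' : ∀ x ∈ Icc 0 (-t), HasDerivAt (fun τ => f (-τ)) (-f' (-x)) x := fun x hx => by
      have := (hf (-x) ⟨by linarith [hx.2], by linarith [hx.1]⟩).scomp x (hasDerivAt_neg x)
      simpa using! this
    have := norm_le_gronwallBound_of_norm_deriv_right_le (f := fun τ => f (-τ))
      (f' := fun τ => -f' (-τ)) (a := 0) (b := -t) (δ := δ) (K := K) (ε := ε)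
      (fun x hx => (hf' x hx).continuousAt.continuousWithinAt)
      (fun x hx => (hf' x (Ico_subset_Icc_self hx)).hasDerivWithinAt) (by simpa using h0)
      (fun x hx => by
        rw [norm_neg]
        exact hb (-x) ⟨by linarith [hx.2], by linarith [hx.1]⟩) (-t) ⟨by linarith, le_rfl⟩
    rw [abs_of_nonpos ht]
    simpa using this

theorem gronwallBound_le {δ K ε x : ℝ} (hK : 1 ≤ K) (hε : 0 ≤ ε) (hδ : 0 ≤ δ) (hx : K * x ≤ 1) :
    gronwallBound δ K ε x ≤ 3 * (δ + ε) := by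
  rw [gronwallBound_of_K_ne_0 (by linarith)]
  have h1 : Real.exp (K * x) ≤ 3 :=
    (Real.exp_le_exp.2 hx).trans (Real.exp_one_lt_d9.le.trans (by norm_num))
  have h2 : ε / K ≤ ε := div_le_self hε hK
  have h3 : 0 ≤ ε / K := by positivity
  have h4 : 0 < Real.exp (K * x) := Real.exp_pos _
  simp only
  nlinarith

end ode

/-! ### Parallel sections of linear connections over squares -/

section frobenius

variable {E F : Type*} [NormedAddCommGroup E] [NormedSpace ℝ E]
  [NormedAddCommGroup F] [NormedSpace ℝ F]

theorem norm_stdVec (a : Fin 2) : ‖stdVec a‖ = 1 := by simp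

/-- The point with coordinates `s, t` relative to `p`. -/
noncomputable def gridPt (p : Plane) (s t : ℝ) : Plane := p + s • stdVec 0 + t • stdVec 1

theorem gridPt_zero (p : Plane) (s t : ℝ) : gridPt p s t 0 = p 0 + s := by simp [gridPt]

theorem gridPt_one (p : Plane) (s t : ℝ) : gridPt p s t 1 = p 1 + t := by simp [gridPt]

theorem gridPt_mem_square {p : Plane} {r s t : ℝ} :
    gridPt p s t ∈ square p r ↔ |s| < r ∧ |t| < r := by
  simp [square, Fin.forall_fin_two, gridPt_zero, gridPt_one]

theorem gridPt_sub (p x : Plane) : gridPt p (x 0 - p 0) (x 1 - p 1) = x := by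
  ext i
  fin_cases i
  · exact (gridPt_zero _ _ _).trans (add_sub_cancel _ _)
  · exact (gridPt_one _ _ _).trans (add_sub_cancel _ _)

theorem gridPt_add_left (p : Plane) (s h t : ℝ) :
    gridPt p (s + h) t = gridPt p s t + h • stdVec 0 := by
  simp only [gridPt, add_smul]; abel

theorem hasDerivAt_gridPt_left (p : Plane) (s t : ℝ) :
    HasDerivAt (fun s => gridPt p s t) (stdVec 0) s := by
  have := (((hasDerivAt_id s).smul_const (stdVec 0)).const_add p).add_const (t • stdVec 1)
  simpa [gridPt] using! this

theorem hasDerivAt_gridPt_right (p : Plane) (s t : ℝ) :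
    HasDerivAt (fun t => gridPt p s t) (stdVec 1) t := by
  have := ((hasDerivAt_id t).smul_const (stdVec 1)).const_add (p + s • stdVec 0)
  simpa [gridPt] using! this

/-- `C^2` regularity makes `A` and its derivative Lipschitz near `p`. A single constant `K ≥ 1` is
taken for all bounds, and the square is shrunk by `1 / (2 K)` to meet the smallness needed for
existence and for Grönwall. -/
theorem exists_square_bounds {A : Fin 2 → Plane → E} {p : Plane}
    (hA : ∀ a, ContDiffAt ℝ 2 (A a) p) :
    ∃ r > 0, ∃ K ≥ 1, K * r ≤ 1 / 2 ∧
      (∀ x ∈ square p r, ∀ a, DifferentiableAt ℝ (A a) x ∧ ‖A a x‖ ≤ K) ∧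
      ∀ x ∈ square p r, ∀ y ∈ square p r, ∀ a, ‖A a y - A a x‖ ≤ K * ‖y - x‖ ∧
        ‖fderiv ℝ (A a) y - fderiv ℝ (A a) x‖ ≤ K * ‖y - x‖ := by
  have h1 : ∀ a, ∃ K : NNReal, ∃ N ∈ 𝓝 p, LipschitzOnWith K (A a) N := fun a =>
    ((hA a).of_le (by norm_num)).exists_lipschitzOnWith
  have h2 : ∀ a, ∃ K : NNReal, ∃ N ∈ 𝓝 p, LipschitzOnWith K (fderiv ℝ (A a)) N := fun a =>
    ((hA a).fderiv_right (m := 1) (by norm_num)).exists_lipschitzOnWith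
  choose K1 N1 hN1 hL1 using h1
  choose K2 N2 hN2 hL2 using h2
  have h3 : ∀ a, ∀ᶠ x in 𝓝 p, DifferentiableAt ℝ (A a) x ∧ ‖A a x‖ ≤ ‖A a p‖ + 1 := fun a =>
    (((hA a).eventually (by simp)).mono fun x hx => hx.differentiableAt (by simp)).and
      (((hA a).continuousAt.norm.eventually_lt continuousAt_const (lt_add_one _)).mono
        fun x hx => le_of_lt hx)
  have h4 : ∀ᶠ x in 𝓝 p, ∀ a, (DifferentiableAt ℝ (A a) x ∧ ‖A a x‖ ≤ ‖A a p‖ + 1) ∧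
      x ∈ N1 a ∧ x ∈ N2 a :=
    eventually_all.2 fun a => (h3 a).and (inter_mem (hN1 a) (hN2 a))
  obtain ⟨r, hr, hsub⟩ := exists_square_subset h4
  set K : ℝ := 1 + ∑ a, ((‖A a p‖ + 1) + K1 a + K2 a) with hK
  have hle : ∀ a, (‖A a p‖ + 1) + K1 a + K2 a ≤ K := fun a =>
    (Finset.single_le_sum (f := fun a => (‖A a p‖ + 1) + (K1 a : ℝ) + K2 a)
      (fun i _ => by positivity) (Finset.mem_univ a)).trans (by rw [hK]; linarith)
  have hK1 : 1 ≤ K := by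
    have := hle 0
    have h5 : (0 : ℝ) ≤ K1 0 := NNReal.coe_nonneg _
    have h6 : (0 : ℝ) ≤ K2 0 := NNReal.coe_nonneg _
    linarith [norm_nonneg (A 0 p)]
  refine ⟨min r (1 / (2 * K)), by positivity, K, hK1, ?_, fun x hx a => ?_, fun x hx y hy a => ?_⟩
  · calc K * min r (1 / (2 * K)) ≤ K * (1 / (2 * K)) := by gcongr; exact min_le_right _ _
      _ = 1 / 2 := by field_simp
  · have := hsub (square_mono (min_le_left _ _) hx) a
    refine ⟨this.1.1, this.1.2.trans (le_trans ?_ (hle a))⟩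
    have h5 : (0 : ℝ) ≤ K1 a := NNReal.coe_nonneg _
    have h6 : (0 : ℝ) ≤ K2 a := NNReal.coe_nonneg _
    linarith
  · have hx' := hsub (square_mono (min_le_left _ _) hx) a
    have hy' := hsub (square_mono (min_le_left _ _) hy) a
    have h5 : (0 : ℝ) ≤ K1 a := NNReal.coe_nonneg _
    have h6 : (0 : ℝ) ≤ K2 a := NNReal.coe_nonneg _
    have h7 := hle a
    have h8 := norm_nonneg (A a p)
    constructor
    · refine ((hL1 a).norm_sub_le hy'.2.1 hx'.2.1).trans ?_
      gcongr; linarith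
    · refine ((hL2 a).norm_sub_le hy'.2.2 hx'.2.2).trans ?_
      gcongr; linarith

theorem norm_taylor_le {f : Plane → E} {Q : Set Plane} (hQ : Convex ℝ Q) {K : ℝ}
    (hf : ∀ x ∈ Q, DifferentiableAt ℝ f x)
    (hL : ∀ x ∈ Q, ∀ y ∈ Q, ‖fderiv ℝ f y - fderiv ℝ f x‖ ≤ K * ‖y - x‖) (hK : 0 ≤ K)
    {x y : Plane} (hx : x ∈ Q) (hy : y ∈ Q) :
    ‖f y - f x - fderiv ℝ f x (y - x)‖ ≤ K * ‖y - x‖ ^ 2 := by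
  have hseg := hQ.segment_subset hx hy
  have := (convex_segment x y).norm_image_sub_le_of_norm_hasFDerivWithin_le'
    (f := f) (f' := fderiv ℝ f) (φ := fderiv ℝ f x) (C := K * ‖y - x‖)
    (fun z hz => (hf z (hseg hz)).hasFDerivAt.hasFDerivWithinAt)
    (fun z hz => (hL x hx z (hseg hz)).trans (by
      gcongr
      obtain ⟨θ, hθ, rfl⟩ := (segment_eq_image' ℝ x y ▸ hz : z ∈ _ '' _)
      rw [add_sub_cancel_left, norm_smul, Real.norm_of_nonneg hθ.1]
      exact mul_le_of_le_one_left (norm_nonneg _) hθ.2))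
    (left_mem_segment ℝ x y) (right_mem_segment ℝ x y)
  rw [pow_two, ← mul_assoc]
  exact this

/-- Bounded partial derivatives give a Lipschitz estimate in both variables. This recovers joint
continuity of a family of solutions that is built, and chosen, one line at a time. -/
theorem continuousAt_of_partials_le {U : ℝ → ℝ → E} {U₀ U₁ : ℝ → ℝ → E} {r C : ℝ}
    (h0 : ∀ s t, |s| < r → |t| < r → HasDerivAt (fun s => U s t) (U₀ s t) s ∧ ‖U₀ s t‖ ≤ C)
    (h1 : ∀ s t, |s| < r → |t| < r → HasDerivAt (fun t => U s t) (U₁ s t) t ∧ ‖U₁ s t‖ ≤ C)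
    {s t : ℝ} (hs : |s| < r) (ht : |t| < r) : ContinuousAt (fun z : ℝ × ℝ => U z.1 z.2) (s, t) := by
  have hconv : Convex ℝ {x : ℝ | |x| < r} := by
    have : {x : ℝ | |x| < r} = Metric.ball 0 r := by ext; simp
    rw [this]; exact convex_ball _ _
  have hev : ∀ᶠ z : ℝ × ℝ in 𝓝 (s, t), |z.1| < r ∧ |z.2| < r :=
    (continuous_fst.abs.continuousAt.eventually_lt continuousAt_const hs).and
      (continuous_snd.abs.continuousAt.eventually_lt continuousAt_const ht)
  have hbd : ∀ᶠ z : ℝ × ℝ in 𝓝 (s, t),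
      ‖U z.1 z.2 - U s t‖ ≤ C * ‖z.1 - s‖ + C * ‖z.2 - t‖ := hev.mono fun z hz => by
    have e1 := hconv.norm_image_sub_le_of_norm_hasDerivWithin_le (f := fun s => U s z.2)
      (f' := fun s => U₀ s z.2) (fun x hx => (h0 x z.2 hx hz.2).1.hasDerivWithinAt)
      (fun x hx => (h0 x z.2 hx hz.2).2) hs hz.1
    have e2 := hconv.norm_image_sub_le_of_norm_hasDerivWithin_le (f := fun t => U s t)
      (f' := fun t => U₁ s t) (fun x hx => (h1 s x hs hx).1.hasDerivWithinAt)
      (fun x hx => (h1 s x hs hx).2) ht hz.2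
    calc ‖U z.1 z.2 - U s t‖ = ‖(U z.1 z.2 - U s z.2) + (U s z.2 - U s t)‖ := by
          rw [sub_add_sub_cancel]
      _ ≤ _ := (norm_add_le _ _).trans (add_le_add e1 e2)
  rw [ContinuousAt, tendsto_iff_norm_sub_tendsto_zero]
  refine squeeze_zero' (Eventually.of_forall fun _ => norm_nonneg _) hbd ?_
  have hc : Continuous fun z : ℝ × ℝ => C * ‖z.1 - s‖ + C * ‖z.2 - t‖ := by fun_prop
  simpa using hc.tendsto (s, t)

end frobenius

section frobenius

variable {E F : Type*} [NormedAddCommGroup E] [NormedSpace ℝ E]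
  [NormedAddCommGroup F] [NormedSpace ℝ F]

/-- The curvature of the linear connection `d - A`. -/
noncomputable def connCurv (A : Fin 2 → Plane → E →L[ℝ] E) (x : Plane) : E →L[ℝ] E :=
  fderiv ℝ (A 1) x (stdVec 0) + A 1 x ∘L A 0 x -
    (fderiv ℝ (A 0) x (stdVec 1) + A 0 x ∘L A 1 x)

/-- A linear constraint which is differentially closed stays satisfied along a solution of a linear
differential equation. -/
theorem constraint_eq_zero {A : ℝ → E →L[ℝ] E} {R R' : ℝ → E →L[ℝ] F} {u : ℝ → E} {r c t : ℝ}
    (hR : ∀ τ, |τ| < r → HasDerivAt R (R' τ) τ)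
    (hu : ∀ τ, |τ| < r → HasDerivAt u (A τ (u τ)) τ)
    (hc : ∀ τ, |τ| < r → ‖R' τ (u τ) + R τ (A τ (u τ))‖ ≤ c * ‖R τ (u τ)‖)
    (h0 : R 0 (u 0) = 0) (ht : |t| < r) : R t (u t) = 0 := by
  have hmem : ∀ τ ∈ uIcc 0 t, |τ| < r := fun τ hτ =>
    lt_of_le_of_lt (by simpa using abs_sub_left_of_mem_uIcc hτ) ht
  have := norm_le_gronwallBound_uIcc (f := fun τ => R τ (u τ)) (K := c) (ε := 0) (δ := 0)
    (fun τ hτ => (hR τ (hmem τ hτ)).clm_apply (hu τ (hmem τ hτ))) (by simp [h0])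
    (fun τ hτ => by simpa using hc τ (hmem τ hτ))
  simpa [gronwallBound_ε0_δ0] using this

/-- A two-parameter family which solves the second equation of an overdetermined linear system,
solves the first one along `t = 0`, and is annihilated by the curvature, solves the first
equation. -/
theorem hasDerivAt_transport {A : Fin 2 → Plane → E →L[ℝ] E} {p : Plane} {r K D : ℝ} (hK1 : 1 ≤ K)
    (hKr : K * r ≤ 1 / 2)
    (hA : ∀ x ∈ square p r, ∀ a, DifferentiableAt ℝ (A a) x ∧ ‖A a x‖ ≤ K)
    (hL : ∀ x ∈ square p r, ∀ y ∈ square p r, ∀ a, ‖A a y - A a x‖ ≤ K * ‖y - x‖ ∧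
        ‖fderiv ℝ (A a) y - fderiv ℝ (A a) x‖ ≤ K * ‖y - x‖)
    {U : ℝ → ℝ → E}
    (hU1 : ∀ s t, |s| < r → |t| < r →
      HasDerivAt (fun t => U s t) (A 1 (gridPt p s t) (U s t)) t)
    (hU0 : ∀ s, |s| < r → HasDerivAt (fun s => U s 0) (A 0 (gridPt p s 0) (U s 0)) s)
    (hD : ∀ s t, |s| < r → |t| < r → ‖U s t‖ ≤ D)
    (hcurv : ∀ s t, |s| < r → |t| < r → connCurv A (gridPt p s t) (U s t) = 0)
    {s t : ℝ} (hs : |s| < r) (ht : |t| < r) :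
    HasDerivAt (fun s => U s t) (A 0 (gridPt p s t) (U s t)) s := by
  have hr : 0 < r := (abs_nonneg _).trans_lt hs
  have hD0 : 0 ≤ D := (norm_nonneg _).trans (hD s t hs ht)
  have hK0 : 0 ≤ K := by linarith
  have hmem : ∀ {s t}, |s| < r → |t| < r → gridPt p s t ∈ square p r := fun h h' =>
    gridPt_mem_square.2 ⟨h, h'⟩
  -- `w h t` is the defect of the first equation at step `h`. It satisfies `∂_t w = A_1 w + O(h²)`,
  -- since the terms of first order in `h` combine to the curvature applied to `U`, which is zero.
  -- Grönwall then carries `w = o(h)` from `t = 0` to every `t`.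
  set w : ℝ → ℝ → E := fun h t => U (s + h) t - U s t - h • A 0 (gridPt p s t) (U s t) with hw
  have hev : ∀ᶠ h : ℝ in 𝓝 0, |s + h| < r := by
    have : ContinuousAt (fun h : ℝ => |s + h|) 0 := by fun_prop
    exact this.eventually_lt continuousAt_const (by simpa using hs)
  have hkey : ∀ h, |s + h| < r → ‖w h t‖ ≤ 3 * (‖w h 0‖ + (K * K * D + K * D) * h ^ 2) := by
    intro h hh
    have hτ : ∀ τ ∈ uIcc 0 t, |τ| < r := fun τ hτ =>
      lt_of_le_of_lt (by simpa using abs_sub_left_of_mem_uIcc hτ) ht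
    have hder : ∀ τ ∈ uIcc 0 t, HasDerivAt (w h)
        (A 1 (gridPt p (s + h) τ) (U (s + h) τ) - A 1 (gridPt p s τ) (U s τ) -
          h • (fderiv ℝ (A 0) (gridPt p s τ) (stdVec 1) (U s τ) +
            A 0 (gridPt p s τ) (A 1 (gridPt p s τ) (U s τ)))) τ := fun τ hτt => by
      have hτ' := hτ τ hτt
      exact ((hU1 (s + h) τ hh hτ').sub (hU1 s τ hs hτ')).sub
        ((((hA _ (hmem hs hτ') 0).1.hasFDerivAt.comp_hasDerivAt τ
          (hasDerivAt_gridPt_right p s τ)).clm_apply (hU1 s τ hs hτ')).const_smul h)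
    have hb : ∀ τ ∈ uIcc 0 t,
        ‖A 1 (gridPt p (s + h) τ) (U (s + h) τ) - A 1 (gridPt p s τ) (U s τ) -
          h • (fderiv ℝ (A 0) (gridPt p s τ) (stdVec 1) (U s τ) +
            A 0 (gridPt p s τ) (A 1 (gridPt p s τ) (U s τ)))‖ ≤
        K * ‖w h τ‖ + (K * K * D + K * D) * h ^ 2 := fun τ hτt => by
      have hτ' := hτ τ hτt
      have hc := hcurv s τ hs hτ'
      simp only [connCurv, sub_apply, add_apply, ContinuousLinearMap.comp_apply] at hc
      -- Vanishing curvature trades `∂_1 A_0 + A_0 A_1` for `∂_0 A_1 + A_1 A_0` on `U`, and the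
      -- latter is the first-order Taylor term of `A_1 U` in direction `0`.
      rw [← sub_eq_zero.1 hc]
      set x := gridPt p s τ
      set y := gridPt p (s + h) τ with hy
      have hyx : y - x = h • stdVec 0 := by rw [hy, gridPt_add_left, add_sub_cancel_left]
      have hx' : x ∈ square p r := hmem hs hτ'
      have hy' : y ∈ square p r := hmem hh hτ'
      have hn : ‖y - x‖ = |h| := by rw [hyx, norm_smul, norm_stdVec, mul_one, Real.norm_eq_abs]
      have hT := norm_taylor_le (convex_square p r) (fun z hz => (hA z hz 1).1)
        (fun z hz z' hz' => (hL z hz z' hz' 1).2) hK0 hx' hy'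
      have hLip := (hL x hx' y hy' 1).1
      rw [hn] at hT hLip
      rw [hyx, map_smul] at hT
      have heq : A 1 y (U (s + h) τ) - A 1 x (U s τ) -
          h • (fderiv ℝ (A 1) x (stdVec 0) (U s τ) + A 1 x (A 0 x (U s τ))) =
          A 1 y (w h τ) + ((A 1 y - A 1 x) (h • A 0 x (U s τ)) +
            (A 1 y - A 1 x - h • fderiv ℝ (A 1) x (stdVec 0)) (U s τ)) := by
        simp only [hw, map_sub, map_smul, sub_apply, smul_apply, smul_add, smul_sub]
        abel
      rw [heq]
      have b1 : ‖A 1 y (w h τ)‖ ≤ K * ‖w h τ‖ :=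
        ((A 1 y).le_opNorm _).trans (by gcongr; exact (hA y hy' 1).2)
      have b2 : ‖(A 1 y - A 1 x) (h • A 0 x (U s τ))‖ ≤ (K * |h|) * (|h| * (K * D)) := by
        refine (ContinuousLinearMap.le_opNorm _ _).trans ?_
        rw [norm_smul, Real.norm_eq_abs]
        gcongr
        exact ((A 0 x).le_opNorm _).trans
          (mul_le_mul (hA x hx' 0).2 (hD s τ hs hτ') (norm_nonneg _) hK0)
      have b3 : ‖(A 1 y - A 1 x - h • fderiv ℝ (A 1) x (stdVec 0)) (U s τ)‖ ≤
          K * |h| ^ 2 * D :=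
        (ContinuousLinearMap.le_opNorm _ _).trans
          (mul_le_mul hT (hD s τ hs hτ') (norm_nonneg _) (by positivity))
      calc _ ≤ _ := (norm_add_le _ _).trans (add_le_add b1 ((norm_add_le _ _).trans
              (add_le_add b2 b3)))
        _ = _ := by rw [← sq_abs h]; ring
    refine (norm_le_gronwallBound_uIcc hder le_rfl hb).trans
      (gronwallBound_le hK1 (by positivity) (norm_nonneg _) ?_)
    nlinarith [abs_nonneg t]
  have hw0 : (fun h => w h 0) =o[𝓝 0] fun h => h := hasDerivAt_iff_isLittleO_nhds_zero.1 (hU0 s hs)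
  have hsq : (fun h : ℝ => (K * K * D + K * D) * h ^ 2) =o[𝓝 0] fun h => h :=
    (Asymptotics.isLittleO_pow_id one_lt_two).const_mul_left _
  rw [hasDerivAt_iff_isLittleO_nhds_zero]
  refine Asymptotics.IsBigO.trans_isLittleO (Asymptotics.IsBigO.of_bound 3 ?_)
    (hw0.norm_left.add hsq)
  filter_upwards [hev] with h hh
  refine (hkey h hh).trans ?_
  gcongr
  exact le_abs_self _

/-- Existence of parallel sections of the linear connection `d - A` over small squares, with
given initial value in the kernel of a differentially closed linear constraint `R` that implies the
vanishing of the curvature. -/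
theorem exists_parallel_of_constraint [CompleteSpace E] {A : Fin 2 → Plane → E →L[ℝ] E} {p : Plane}
    (hA : ∀ a, ContDiffAt ℝ 2 (A a) p) :
    ∃ r₀ > 0, ∀ r, 0 < r → r ≤ r₀ → ∀ (R : Plane → E →L[ℝ] F) (c : ℝ),
      (∀ x ∈ square p r, DifferentiableAt ℝ R x) →
      (∀ x ∈ square p r, ∀ a u, ‖fderiv ℝ R x (stdVec a) u + R x (A a x u)‖ ≤ c * ‖R x u‖) →
      (∀ x ∈ square p r, ∀ u, R x u = 0 → connCurv A x u = 0) →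
      ∀ u₀, R p u₀ = 0 → ∃ u : Plane → E, u p = u₀ ∧
        ∀ x ∈ square p r, DifferentiableAt ℝ u x ∧
          ∀ a, fderiv ℝ u x (stdVec a) = A a x (u x) := by
  obtain ⟨r₁, hr₁, K, hK1, hKr, hb, hL⟩ := exists_square_bounds hA
  set ρ := r₁ / 2 with hρ
  have hρ0 : 0 < ρ := by positivity
  have hlt : ∀ {t}, t ∈ Icc (-ρ) ρ → |t| < r₁ := fun ht => by
    have := abs_le.2 ht; linarith
  refine ⟨ρ, hρ0, fun r hr hrρ R c hR hc hcurv u₀ hu₀ => ?_⟩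
  have hcont : ∀ x ∈ square p r₁, ∀ a, ContinuousAt (A a) x := fun x hx a =>
    (hb x hx a).1.continuousAt
  have hKρ : K * ρ ≤ 1 / 2 := by nlinarith
  -- Solve along the horizontal axis through `p`, and then along each vertical line with the axis
  -- value as initial value.
  obtain ⟨α, hα0, hα⟩ := exists_linear_ode_solution (A := fun s => A 0 (gridPt p s 0)) hρ0
    (fun s hs => ((hcont _ (gridPt_mem_square.2 ⟨hlt hs, by simpa using hr₁⟩) 0).comp
      (f := fun s => gridPt p s 0) (hasDerivAt_gridPt_left p s 0).continuousAt).continuousWithinAt)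
    (fun s hs => (hb _ (gridPt_mem_square.2 ⟨hlt hs, by simpa using hr₁⟩) 0).2) hKρ u₀
  have hUex : ∀ s, ∃ v : ℝ → E, |s| < ρ → v 0 = α s ∧
      ∀ t ∈ Ioo (-ρ) ρ, HasDerivAt v (A 1 (gridPt p s t) (v t)) t := fun s => by
    by_cases hs : |s| < ρ
    · have hs' : |s| < r₁ := by linarith
      obtain ⟨v, hv⟩ := exists_linear_ode_solution (A := fun t => A 1 (gridPt p s t)) hρ0
        (fun t ht => ((hcont _ (gridPt_mem_square.2 ⟨hs', hlt ht⟩) 1).comp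
          (f := fun t => gridPt p s t)
          (hasDerivAt_gridPt_right p s t).continuousAt).continuousWithinAt)
        (fun t ht => (hb _ (gridPt_mem_square.2 ⟨hs', hlt ht⟩) 1).2) hKρ (α s)
      exact ⟨v, fun _ => hv⟩
    -- A dummy value for lines outside the square, so that a solution can be chosen for every `s`.
    · exact ⟨0, fun h => absurd h hs⟩
  choose U hU using hUex
  have hIoo : ∀ {t}, |t| < r → t ∈ Ioo (-ρ) ρ := fun ht => abs_lt.1 (ht.trans_le hrρ)
  have hU0 : ∀ s, |s| < r → U s 0 = α s := fun s hs => (hU s (hs.trans_le hrρ)).1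
  have hU1 : ∀ s t, |s| < r → |t| < r →
      HasDerivAt (fun t => U s t) (A 1 (gridPt p s t) (U s t)) t := fun s t hs ht =>
    (hU s (hs.trans_le hrρ)).2 t (hIoo ht)
  have hα' : ∀ s, |s| < r → HasDerivAt α (A 0 (gridPt p s 0) (α s)) s := fun s hs =>
    hα s (hIoo hs)
  have hmem : ∀ {s t}, |s| < r → |t| < r → gridPt p s t ∈ square p r := fun h h' =>
    gridPt_mem_square.2 ⟨h, h'⟩
  have hr0 : |(0 : ℝ)| < r := by simpa using hr
  have hb' : ∀ x ∈ square p r, ∀ a, DifferentiableAt ℝ (A a) x ∧ ‖A a x‖ ≤ K := fun x hx =>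
    hb x (square_mono (by linarith) hx)
  have hL' : ∀ x ∈ square p r, ∀ y ∈ square p r, ∀ a, ‖A a y - A a x‖ ≤ K * ‖y - x‖ ∧
      ‖fderiv ℝ (A a) y - fderiv ℝ (A a) x‖ ≤ K * ‖y - x‖ := fun x hx y hy =>
    hL x (square_mono (by linarith) hx) y (square_mono (by linarith) hy)
  -- The constraint propagates along the axis and then along the vertical lines. This is what makes
  -- the curvature vanish on the constructed family before it is known to be parallel.
  have hRα : ∀ s, |s| < r → R (gridPt p s 0) (α s) = 0 := fun s hs =>
    constraint_eq_zero (R := fun s => R (gridPt p s 0)) (c := c)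
      (fun τ hτ => (hR _ (hmem hτ hr0)).hasFDerivAt.comp_hasDerivAt τ
        (hasDerivAt_gridPt_left p τ 0)) hα' (fun τ hτ => hc _ (hmem hτ hr0) 0 _)
      (by simpa [gridPt, hα0] using hu₀) hs
  have hRU : ∀ s t, |s| < r → |t| < r → R (gridPt p s t) (U s t) = 0 := fun s t hs ht =>
    constraint_eq_zero (R := fun t => R (gridPt p s t)) (c := c)
      (fun τ hτ => (hR _ (hmem hs hτ)).hasFDerivAt.comp_hasDerivAt τ
        (hasDerivAt_gridPt_right p s τ)) (fun τ hτ => hU1 s τ hs hτ)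
      (fun τ hτ => hc _ (hmem hs hτ) 1 _) (by rw [hU0 s hs]; exact hRα s hs) ht
  have hgrow : ∀ (B : ℝ → E →L[ℝ] E) (v : ℝ → E), (∀ τ, |τ| < r → HasDerivAt v (B τ (v τ)) τ) →
      (∀ τ, |τ| < r → ‖B τ‖ ≤ K) → ∀ t, |t| < r → ‖v t‖ ≤ 3 * ‖v 0‖ := fun B v hv hB t ht => by
    have hτ : ∀ τ ∈ uIcc 0 t, |τ| < r := fun τ hτ =>
      lt_of_le_of_lt (by simpa using abs_sub_left_of_mem_uIcc hτ) ht
    have := (norm_le_gronwallBound_uIcc (K := K) (ε := 0) (fun τ h => hv τ (hτ τ h)) le_rfl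
      (fun τ h => by
        rw [add_zero]; exact ((B τ).le_opNorm _).trans (by gcongr; exact hB τ (hτ τ h)))).trans
      (gronwallBound_le hK1 le_rfl (norm_nonneg _) (by nlinarith [abs_nonneg t]))
    simpa using this
  have hD : ∀ s t, |s| < r → |t| < r → ‖U s t‖ ≤ 9 * ‖u₀‖ := fun s t hs ht => by
    have h1 := hgrow _ _ (fun τ hτ => hU1 s τ hs hτ) (fun τ hτ => (hb' _ (hmem hs hτ) 1).2) t ht
    have h2 := hgrow _ _ hα' (fun τ hτ => (hb' _ (hmem hτ hr0) 0).2) s hs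
    rw [hU0 s hs] at h1
    rw [hα0] at h2
    linarith
  have hUs : ∀ s t, |s| < r → |t| < r →
      HasDerivAt (fun s => U s t) (A 0 (gridPt p s t) (U s t)) s := fun s t hs ht =>
    hasDerivAt_transport hK1 (by nlinarith) hb' hL' hU1
      (fun s hs => by
        rw [hU0 s hs]
        refine (hα' s hs).congr_of_eventuallyEq ?_
        filter_upwards [(continuous_abs.isOpen_preimage _ isOpen_Iio).mem_nhds hs] with s' hs'
        exact hU0 s' hs')
      hD (fun s t hs ht => hcurv _ (hmem hs ht) _ (hRU s t hs ht)) hs ht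
  have hbd : ∀ a s t, |s| < r → |t| < r → ‖A a (gridPt p s t) (U s t)‖ ≤ K * (9 * ‖u₀‖) :=
    fun a s t hs ht => ((A a _).le_opNorm _).trans
      (mul_le_mul (hb' _ (hmem hs ht) a).2 (hD s t hs ht) (norm_nonneg _) (by linarith))
  set u : Plane → E := fun x => U (x 0 - p 0) (x 1 - p 1) with hu
  have hucont : ∀ x ∈ square p r, ContinuousAt u x := fun x hx =>
    (continuousAt_of_partials_le (fun s t hs ht => ⟨hUs s t hs ht, hbd 0 s t hs ht⟩)
      (fun s t hs ht => ⟨hU1 s t hs ht, hbd 1 s t hs ht⟩) (hx 0) (hx 1)).comp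
      (f := fun x : Plane => (x 0 - p 0, x 1 - p 1)) (by fun_prop)
  have hpart : ∀ y ∈ square p r, ∀ a, HasDerivAt (fun t : ℝ => u (y + t • stdVec a)) (A a y (u y)) 0 := by
    intro y hy a
    have hg := gridPt_sub p y
    fin_cases a
    · have h1 := hUs _ _ (hy 0) (hy 1)
      rw [hg, ← add_zero (y 0 - p 0)] at h1
      have h2 : HasDerivAt (fun t : ℝ => U (y 0 - p 0 + t) (y 1 - p 1)) (A 0 y (u y)) 0 := by
        simpa using! h1.comp_const_add (y 0 - p 0) (0 : ℝ)
      refine h2.congr_of_eventuallyEq (Eventually.of_forall fun t => ?_)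
      simp [hu, add_sub_right_comm]
    · have h1 := hU1 _ _ (hy 0) (hy 1)
      rw [hg, ← add_zero (y 1 - p 1)] at h1
      have h2 : HasDerivAt (fun t : ℝ => U (y 0 - p 0) (y 1 - p 1 + t)) (A 1 y (u y)) 0 := by
        simpa using! h1.comp_const_add (y 1 - p 1) (0 : ℝ)
      refine h2.congr_of_eventuallyEq (Eventually.of_forall fun t => ?_)
      simp [hu, add_sub_right_comm]
  refine ⟨u, by simp [hu, hU0 0 hr0, hα0], fun x hx => ?_⟩
  have hfd := hasFDerivAt_of_partials (f := u) (g := fun a y => A a y (u y)) (x := x)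
    (mem_of_superset ((isOpen_square p r).mem_nhds hx) hpart)
    (fun a => (hb' x hx a).1.continuousAt.clm_apply (hucont x hx))
  refine ⟨hfd.differentiableAt, fun a => ?_⟩
  rw [hfd.fderiv]
  fin_cases a <;> simp [Fin.sum_univ_two]

end frobenius

open scoped Matrix


/-! ### Matrix form -/

/-- `u` is a parallel section of `d - A` on `V`. -/
def ParallelOn (A : Fin 2 → Plane → Matrix (Fin 3) (Fin 3) ℝ) (V : Set Plane)
    (u : Plane → Fin 3 → ℝ) : Prop :=
  ∀ x ∈ V, (∀ j, DifferentiableAt ℝ (fun y => u y j) x) ∧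
    ∀ a j, pd a (fun y => u y j) x = ∑ k, A a x j k * u x k

section

variable {A : Fin 2 → Plane → Matrix (Fin 3) (Fin 3) ℝ} {V : Set Plane} {u : Plane → Fin 3 → ℝ}

theorem ParallelOn.mono (hu : ParallelOn A V u) {W : Set Plane} (h : W ⊆ V) : ParallelOn A W u :=
  fun x hx => hu x (h hx)

/-- The continuous linear map of a matrix. -/
noncomputable def matCLM (M : Matrix (Fin 3) (Fin 3) ℝ) : (Fin 3 → ℝ) →L[ℝ] (Fin 3 → ℝ) :=
  ∑ i, ∑ j, M i j • (ContinuousLinearMap.proj j : (Fin 3 → ℝ) →L[ℝ] ℝ).smulRight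
    (Pi.single i 1 : Fin 3 → ℝ)

theorem matCLM_apply (M : Matrix (Fin 3) (Fin 3) ℝ) (u : Fin 3 → ℝ) (i : Fin 3) :
    matCLM M u i = ∑ j, M i j * u j := by
  simp [matCLM, Finset.sum_apply, Pi.single_apply]

theorem contDiffAt_matCLM {M : Plane → Matrix (Fin 3) (Fin 3) ℝ} {x : Plane} {n : WithTop ℕ∞}
    (h : ∀ i j, ContDiffAt ℝ n (fun y => M y i j) x) : ContDiffAt ℝ n (fun y => matCLM (M y)) x :=
  ContDiffAt.sum fun i _ => ContDiffAt.sum fun j _ => (h i j).smul contDiffAt_const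

theorem differentiableAt_matCLM {M : Plane → Matrix (Fin 3) (Fin 3) ℝ} {x : Plane}
    (h : ∀ i j, DifferentiableAt ℝ (fun y => M y i j) x) :
    DifferentiableAt ℝ (fun y => matCLM (M y)) x :=
  DifferentiableAt.fun_sum fun i _ => DifferentiableAt.fun_sum fun j _ => (h i j).smul_const _

theorem fderiv_matCLM_apply {M : Plane → Matrix (Fin 3) (Fin 3) ℝ} {x : Plane}
    (h : ∀ i j, DifferentiableAt ℝ (fun y => M y i j) x) (a : Fin 2) (u : Fin 3 → ℝ) (i : Fin 3) :
    fderiv ℝ (fun y => matCLM (M y)) x (stdVec a) u i = ∑ j, pd a (fun y => M y i j) x * u j := by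
  have h1 : HasFDerivAt (fun y => matCLM (M y) u i)
      (((ContinuousLinearMap.proj i : (Fin 3 → ℝ) →L[ℝ] ℝ).comp
        (ContinuousLinearMap.apply ℝ (Fin 3 → ℝ) u)).comp
        (fderiv ℝ (fun y => matCLM (M y)) x)) x :=
    ((ContinuousLinearMap.proj i : (Fin 3 → ℝ) →L[ℝ] ℝ).comp
        (ContinuousLinearMap.apply ℝ (Fin 3 → ℝ) u)).hasFDerivAt.comp x
      (differentiableAt_matCLM h).hasFDerivAt
  have h2 : pd a (fun y => matCLM (M y) u i) x =
      fderiv ℝ (fun y => matCLM (M y)) x (stdVec a) u i := by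
    rw [pd_eq, h1.fderiv]; rfl
  rw [← h2]
  simp only [matCLM_apply]
  rw [pd_sum _ fun j _ => (h i j).mul_const _]
  refine Finset.sum_congr rfl fun j _ => ?_
  rw [pd_mul (h i j) (by fun_prop), pd_const]
  ring

theorem parallelOn_of_fderiv
    (h : ∀ x ∈ V, DifferentiableAt ℝ u x ∧ ∀ a, fderiv ℝ u x (stdVec a) = matCLM (A a x) (u x)) :
    ParallelOn A V u := fun x hx => by
  obtain ⟨hd, hf⟩ := h x hx
  refine ⟨differentiableAt_pi.1 hd, fun a j => ?_⟩
  rw [← matCLM_apply, ← hf a, pd_eq, fderiv_apply hd]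
  rfl

theorem ParallelOn.fderiv (hu : ParallelOn A V u) {x : Plane} (hx : x ∈ V) :
    DifferentiableAt ℝ u x ∧ ∀ a, fderiv ℝ u x (stdVec a) = matCLM (A a x) (u x) := by
  have hd : DifferentiableAt ℝ u x := differentiableAt_pi.2 (hu x hx).1
  refine ⟨hd, fun a => funext fun j => ?_⟩
  rw [matCLM_apply, ← (hu x hx).2 a j, pd_eq, fderiv_apply hd]
  rfl

/-- The Frobenius theorem with a constraint, in matrix form. -/
theorem exists_parallelOn_of_rows {p : Plane}
    (hA : ∀ a i j, ContDiffAt ℝ 2 (fun x => A a x i j) p) :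
    ∃ r₀ > 0, ∀ r, 0 < r → r ≤ r₀ → ∀ (R : Fin 3 → Plane → Fin 3 → ℝ) (c : ℝ),
      (∀ x ∈ square p r, ∀ i j, DifferentiableAt ℝ (fun y => R i y j) x) →
      (∀ x ∈ square p r, ∀ a i u, |rowD A a (R i) x ⬝ᵥ u| ≤ c * ∑ k, |R k x ⬝ᵥ u|) →
      (∀ x ∈ square p r, ∀ u, (∀ i, R i x ⬝ᵥ u = 0) → curvMat A x *ᵥ u = 0) →
      ∀ u₀, (∀ i, R i p ⬝ᵥ u₀ = 0) → ∃ u, u p = u₀ ∧ ParallelOn A (square p r) u := by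
  obtain ⟨r₁, hr₁, H⟩ := exists_parallel_of_constraint (F := Fin 3 → ℝ)
    (A := fun a x => matCLM (A a x)) (p := p) (fun a => contDiffAt_matCLM (hA a))
  have hev : ∀ᶠ x in 𝓝 p, ∀ a i j, DifferentiableAt ℝ (fun x => A a x i j) x :=
    eventually_all.2 fun a => eventually_all.2 fun i => eventually_all.2 fun j =>
      ((hA a i j).eventually (by simp)).mono fun x hx => hx.differentiableAt (by simp)
  obtain ⟨r₂, hr₂, hd⟩ := exists_square_subset hev
  refine ⟨min r₁ r₂, by positivity, fun r hr hrle R c hR hc hcurv u₀ hu₀ => ?_⟩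
  have hdA : ∀ x ∈ square p r, ∀ a i j, DifferentiableAt ℝ (fun x => A a x i j) x := fun x hx =>
    hd (square_mono (hrle.trans (min_le_right _ _)) hx)
  have hRapp : ∀ x v i, matCLM (fun i j => R i x j) v i = R i x ⬝ᵥ v := fun x v i =>
    matCLM_apply _ _ _
  have hcl : ∀ x ∈ square p r, ∀ a v, ‖fderiv ℝ (fun x => matCLM fun i j => R i x j) x (stdVec a) v +
      matCLM (fun i j => R i x j) (matCLM (A a x) v)‖ ≤
      |c| * 3 * ‖matCLM (fun i j => R i x j) v‖ := by
    intro x hx a v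
    refine (pi_norm_le_iff_of_nonneg (by positivity)).2 fun i => ?_
    have h1 : (fderiv ℝ (fun x => matCLM fun i j => R i x j) x (stdVec a) v +
        matCLM (fun i j => R i x j) (matCLM (A a x) v)) i = rowD A a (R i) x ⬝ᵥ v := by
      rw [Pi.add_apply, fderiv_matCLM_apply (hR x hx), hRapp]
      simp only [dotProduct, rowD, matCLM_apply, Fin.sum_univ_three]
      ring
    rw [h1, Real.norm_eq_abs]
    refine (hc x hx a i v).trans ?_
    have h2 : ∀ k, |R k x ⬝ᵥ v| ≤ ‖matCLM (fun i j => R i x j) v‖ := fun k => by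
      rw [← hRapp]; exact norm_le_pi_norm (matCLM (fun i j => R i x j) v) k
    calc c * ∑ k, |R k x ⬝ᵥ v| ≤ |c| * ∑ k : Fin 3, ‖matCLM (fun i j => R i x j) v‖ :=
          mul_le_mul (le_abs_self c) (Finset.sum_le_sum fun k _ => h2 k) (by positivity)
            (abs_nonneg c)
      _ = _ := by simp; ring
  have hcu : ∀ x ∈ square p r, ∀ v, matCLM (fun i j => R i x j) v = 0 →
      connCurv (fun a x => matCLM (A a x)) x v = 0 := by
    intro x hx v hv
    have h0 : ∀ i, R i x ⬝ᵥ v = 0 := fun i => by rw [← hRapp, hv]; rfl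
    have h1 := hcurv x hx v h0
    ext i
    have h2 := congrFun h1 i
    simp only [connCurv, sub_apply, add_apply, ContinuousLinearMap.comp_apply, Pi.sub_apply,
      Pi.add_apply, fderiv_matCLM_apply (hdA x hx _)]
    rw [← h2]
    simp only [matCLM_apply, Matrix.mulVec, dotProduct, curvMat, Matrix.mul_apply,
      Fin.sum_univ_three]
    ring
  obtain ⟨u, hu, hpar⟩ := H r hr (hrle.trans (min_le_left _ _))
    (fun x => matCLM (fun i j => R i x j)) (|c| * 3)
    (fun x hx => differentiableAt_matCLM (hR x hx)) hcl hcu u₀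
    (funext fun i => by rw [hRapp]; exact hu₀ i)
  exact ⟨u, hu, parallelOn_of_fderiv hpar⟩

/-- Bootstrapping: the right hand side `A u` is as regular as the worse of `A` and `u`, and `u`
gains a derivative until it is one better than `A`. -/
theorem ParallelOn.contDiffAt (hV : IsOpen V) (hu : ParallelOn A V u) (n : ℕ)
    (hA : ∀ x ∈ V, ∀ a i j, ContDiffAt ℝ n (fun y => A a y i j) x) :
    ∀ x ∈ V, ∀ j, ContDiffAt ℝ (n + 1) (fun y => u y j) x := by
  have hpd : ∀ m : ℕ, m ≤ n → (∀ x ∈ V, ∀ j, ContDiffAt ℝ m (fun y => u y j) x) →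
      ∀ x ∈ V, ∀ j, ContDiffAt ℝ (m + 1) (fun y => u y j) x := fun m hm hum x hx j =>
    contDiffAt_of_pd hV (fun y hy => (hu y hy).1 j) (fun a y hy => by
      have hm' : (m : WithTop ℕ∞) ≤ n := by exact_mod_cast hm
      have : ContDiffAt ℝ m (fun z => ∑ k, A a z j k * u z k) y :=
        ContDiffAt.sum fun k _ => ((hA y hy a j k).of_le hm').mul (hum y hy k)
      refine this.congr_of_eventuallyEq ?_
      filter_upwards [hV.mem_nhds hy] with z hz
      exact (hu z hz).2 a j) x hx
  have hall : ∀ m : ℕ, m ≤ n → ∀ x ∈ V, ∀ j, ContDiffAt ℝ m (fun y => u y j) x := fun m => by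
    induction m with
    | zero => exact fun _ x hx j => contDiffAt_zero.2 ⟨V, hV.mem_nhds hx, fun y hy =>
        ((hu y hy).1 j).continuousAt.continuousWithinAt⟩
    | succ m ih =>
        intro hm x hx j
        have := hpd m (by omega) (ih (by omega)) x hx j
        simpa only [Nat.cast_add, Nat.cast_one] using this
  exact hpd n le_rfl (hall n le_rfl)

/-- A parallel section over a convex set that vanishes at a point vanishes. -/
theorem ParallelOn.eq_zero (hu : ParallelOn A V u) (hV : Convex ℝ V)
    (hA : ∀ x ∈ V, ∀ a i j, ContinuousAt (fun y => A a y i j) x) {x y : Plane} (hx : x ∈ V)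
    (hy : y ∈ V) (h0 : u x = 0) : u y = 0 := by
  have hmem : ∀ t ∈ Icc (0 : ℝ) 1, x + t • (y - x) ∈ V := fun t ht =>
    hV.add_smul_sub_mem hx hy ht
  -- Restricted to the segment from `x` to `y`, the section solves the linear equation with
  -- coefficient `B`; Grönwall gives uniqueness.
  set B : ℝ → (Fin 3 → ℝ) →L[ℝ] (Fin 3 → ℝ) := fun t =>
    ∑ a, (y - x) a • matCLM (A a (x + t • (y - x))) with hB
  have hder : ∀ t ∈ Icc (0 : ℝ) 1,
      HasDerivAt (fun t => u (x + t • (y - x))) (B t (u (x + t • (y - x)))) t := fun t ht => by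
    obtain ⟨hd, hf⟩ := hu.fderiv (hmem t ht)
    have hl := hasDerivAt_line x (y - x) t hd
    have hBt : B t (u (x + t • (y - x))) = _root_.fderiv ℝ u (x + t • (y - x)) (y - x) := by
      rw [clm_apply_eq_sum]
      simp only [hB, hf, sum_apply, smul_apply]
    rwa [hBt]
  have hBc : ContinuousOn B (Icc 0 1) := fun t ht => by
    refine ContinuousAt.continuousWithinAt (f := B) (tendsto_finsetSum _ fun a _ => ?_)
    refine Tendsto.const_smul ?_ _
    exact tendsto_finsetSum _ fun i _ => tendsto_finsetSum _ fun j _ =>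
      (((hA _ (hmem t ht) a i j).comp (f := fun t : ℝ => x + t • (y - x))
        (by fun_prop)).smul_const _)
  obtain ⟨C, hC⟩ := isCompact_Icc.exists_bound_of_continuousOn hBc
  have := norm_le_gronwallBound_uIcc (f := fun t => u (x + t • (y - x))) (t := 1) (K := C) (ε := 0)
    (δ := 0) (by rw [uIcc_of_le zero_le_one]; exact hder) (by simp [h0])
    (by
      rw [uIcc_of_le zero_le_one]
      exact fun t ht => by
        rw [add_zero]; exact ((B t).le_opNorm _).trans (by gcongr; exact hC t ht))
  simpa [gronwallBound_ε0_δ0] using this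

/-- Differentiating a linear equation satisfied by a parallel section. -/
theorem ParallelOn.rowD_dotProduct (hu : ParallelOn A V u) (hV : IsOpen V) {ρ : Plane → Fin 3 → ℝ}
    (h : ∀ x ∈ V, ρ x ⬝ᵥ u x = 0) {x : Plane} (hx : x ∈ V)
    (hρ : ∀ j, DifferentiableAt ℝ (fun y => ρ y j) x) (b : Fin 2) : rowD A b ρ x ⬝ᵥ u x = 0 := by
  have h1 : pd b (fun y => ∑ j, ρ y j * u y j) x = 0 := by
    rw [pd_congr (g := fun _ => 0) (by
      filter_upwards [hV.mem_nhds hx] with y hy using h y hy), pd_const]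
  rw [pd_sum _ fun j _ => (hρ j).fun_mul ((hu x hx).1 j)] at h1
  simp only [pd_mul (hρ _) ((hu x hx).1 _), (hu x hx).2] at h1
  rw [← h1]
  simp only [dotProduct, rowD, Fin.sum_univ_three]
  ring

/-- Equality of mixed second derivatives of `u`, with first derivatives replaced by `A u`. -/
theorem ParallelOn.curvMat_mulVec (hu : ParallelOn A V u) (hV : IsOpen V)
    (hA : ∀ x ∈ V, ∀ a i j, ContDiffAt ℝ 1 (fun y => A a y i j) x) {x : Plane} (hx : x ∈ V) :
    curvMat A x *ᵥ u x = 0 := by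
  have hdA : ∀ a i j, DifferentiableAt ℝ (fun y => A a y i j) x := fun a i j =>
    (hA x hx a i j).differentiableAt (by simp)
  have hdu := (hu x hx).1
  have hpd : ∀ a b i, pd a (pd b (fun y => u y i)) x = ∑ k, (pd a (fun y => A b y i k) x * u x k +
      A b x i k * ∑ l, A a x k l * u x l) := fun a b i => by
    rw [pd_congr (g := fun y => ∑ k, A b y i k * u y k) (by
      filter_upwards [hV.mem_nhds hx] with y hy using (hu y hy).2 b i),
      pd_sum _ fun j _ => (hdA b i j).fun_mul (hdu j)]
    exact Finset.sum_congr rfl fun k _ => by rw [pd_mul (hdA b i k) (hdu k), (hu x hx).2]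
  ext i
  have hc := pd_comm (x := x) (f := fun y => u y i)
    (by exact_mod_cast hu.contDiffAt hV 1 (by exact_mod_cast hA) x hx i) 0 1
  rw [hpd, hpd] at hc
  simp only [Matrix.mulVec, dotProduct, curvMat, Matrix.mul_apply, Fin.sum_univ_three,
    Pi.zero_apply] at hc ⊢
  linarith

end

/-! ### The Killing equation in a coordinate domain -/

/-- `k` is a `C^1` solution of `∇_(a k_b) = 0` on `V`. -/
def KillingOn (Γ : Plane → Fin 2 → Fin 2 → Fin 2 → ℝ) (V : Set Plane) (k : Plane → Fin 2 → ℝ) :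
    Prop :=
  ∀ x ∈ V, (∀ a, ContDiffAt ℝ 1 (fun y => k y a) x) ∧
    ∀ a b, pd a (fun y => k y b) x + pd b (fun y => k y a) x = 2 * ∑ c, Γ x c a b * k x c

/-- The jet `(k_1, k_2, (∂_1 k_2 - ∂_2 k_1) / 2)`. -/
noncomputable def killingJet (k : Plane → Fin 2 → ℝ) (x : Plane) : Fin 3 → ℝ :=
  ![k x 0, k x 1, 1 / 2 * (pd 0 (fun y => k y 1) x - pd 1 (fun y => k y 0) x)]

section

variable {Γ : Plane → Fin 2 → Fin 2 → Fin 2 → ℝ} {V : Set Plane}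

theorem contDiffAt_prolong {x : Plane} (hΓ : ∀ c a b, ContDiffAt ℝ 4 (fun y => Γ y c a b) x)
    (a : Fin 2) (i j : Fin 3) : ContDiffAt ℝ 3 (fun y => prolong Γ a y i j) x := by
  have h1 : ∀ c a b, ContDiffAt ℝ 3 (fun y => Γ y c a b) x := fun c a b =>
    (hΓ c a b).of_le (by norm_num)
  have h2 : ∀ a b c d, ContDiffAt ℝ 3 (fun y => curv Γ y a b c d) x := fun a b c d =>
    contDiffAt_curv hΓ (by norm_num) a b c d
  have h3 : ContDiffAt ℝ 3 (fun y => traceGam Γ y a) x := ContDiffAt.sum fun c _ => h1 c a c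
  fin_cases i <;> fin_cases j
  · exact h1 0 a 0
  · exact h1 1 a 0
  · exact contDiffAt_const
  · exact h1 0 a 1
  · exact h1 1 a 1
  · exact contDiffAt_const
  · exact h2 0 1 0 a
  · exact h2 0 1 1 a
  · exact h3

variable (hV : IsOpen V) (hΓ : ∀ x ∈ V, ∀ c a b, ContDiffAt ℝ 4 (fun y => Γ y c a b) x)
  (hsym : ∀ x ∈ V, ∀ c a b, Γ x c a b = Γ x c b a)

include hV hΓ hsym

/-- The form is only `C^1`, so `μ` is a priori merely continuous. The diagonal equations, however,
give `∂_a k_a` as a `C^1` function, and `hasDerivAt_pd_of_pd` then differentiates `∂_b k_a` in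
direction `a`. This suffices for both partial derivatives of `μ`; they are continuous, so `μ` is
differentiable. -/
theorem KillingOn.parallelOn {k : Plane → Fin 2 → ℝ} (hk : KillingOn Γ V k) :
    ParallelOn (prolong Γ) V (killingJet k) := by
  have hdk : ∀ x ∈ V, ∀ a, DifferentiableAt ℝ (fun y => k y a) x := fun x hx a =>
    ((hk x hx).1 a).differentiableAt (by simp)
  have hdΓ : ∀ x ∈ V, ∀ c a b, DifferentiableAt ℝ (fun y => Γ y c a b) x := fun x hx c a b =>
    (hΓ x hx c a b).differentiableAt (by simp)
  set μ : Plane → ℝ := fun x => killingJet k x 2 with hμ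
  have hμx : ∀ x, μ x = 1 / 2 * (pd 0 (fun y => k y 1) x - pd 1 (fun y => k y 0) x) := fun x => rfl
  have hfirst : ∀ x ∈ V, ∀ a b,
      pd a (fun y => k y b) x = ∑ c, Γ x c a b * k x c + alt a b * μ x := by
    intro x hx a b
    have h00 := (hk x hx).2 0 0
    have h01 := (hk x hx).2 0 1
    have h11 := (hk x hx).2 1 1
    have hs : ∀ c, Γ x c 1 0 = Γ x c 0 1 := fun c => hsym x hx c 1 0
    rw [hμx]
    simp only [Fin.sum_univ_two] at h00 h01 h11 ⊢
    fin_cases a <;> fin_cases b <;> simp [alt, hs] <;> linarith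
  set f : Fin 2 → Fin 2 → Plane → ℝ := fun a b x => ∑ c, Γ x c a b * k x c with hf
  have hfC : ∀ x ∈ V, ∀ a b, ContDiffAt ℝ 1 (f a b) x := fun x hx a b =>
    ContDiffAt.sum fun c _ => ((hΓ x hx c a b).of_le (by norm_num)).mul ((hk x hx).1 c)
  have hfpd : ∀ x ∈ V, ∀ a b d, pd d (f a b) x = ∑ c, (pd d (fun y => Γ y c a b) x * k x c +
      Γ x c a b * (∑ e, Γ x e d c * k x e + alt d c * μ x)) := fun x hx a b d => by
    rw [hf, pd_sum _ fun c _ => (hdΓ x hx c a b).fun_mul (hdk x hx c)]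
    exact Finset.sum_congr rfl fun c _ => by
      rw [pd_mul (hdΓ x hx c a b) (hdk x hx c), hfirst x hx]
  have hev : ∀ x ∈ V, ∀ a, ∀ᶠ y in 𝓝 x, DifferentiableAt ℝ (fun y => k y a) y := fun x hx a => by
    filter_upwards [hV.mem_nhds hx] with y hy using hdk y hy a
  have hpure : ∀ x ∈ V, ∀ a, pd a (fun y => k y a) =ᶠ[𝓝 x] f a a := fun x hx a => by
    filter_upwards [hV.mem_nhds hx] with y hy
    rw [hfirst y hy]; simp [alt, hf]
  have hline : ∀ x ∈ V, ∀ a, ∀ᶠ t : ℝ in 𝓝 0, x + t • stdVec a ∈ V := fun x hx a => by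
    have : ContinuousAt (fun t : ℝ => x + t • stdVec a) 0 := by fun_prop
    exact this.preimage_mem_nhds (hV.mem_nhds (by simpa using hx))
  -- The candidate for `∂_a μ`. For `a = 0` it comes from `μ = f_{01} - ∂_1 k_0` and `∂_0 ∂_1 k_0 =
  -- ∂_1 f_{00}`; for `a = 1` from `μ = ∂_0 k_1 - f_{01}` and `∂_1 ∂_0 k_1 = ∂_0 f_{11}`.
  set g : Fin 2 → Plane → ℝ := fun a x =>
    if a = 0 then pd 0 (f 0 1) x - pd 1 (f 0 0) x else pd 0 (f 1 1) x - pd 1 (f 0 1) x with hg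
  have hmixed : ∀ x ∈ V, ∀ a b,
      HasDerivAt (fun t : ℝ => pd b (fun y => k y a) (x + t • stdVec a)) (pd b (f a a) x) 0 := by
    intro x hx a b
    have := hasDerivAt_pd_of_pd a b (hev x hx a) ((hfC x hx a a).congr_of_eventuallyEq
      (hpure x hx a))
    rwa [pd_congr (hpure x hx a)] at this
  have hfl : ∀ x ∈ V, ∀ a b d,
      HasDerivAt (fun t : ℝ => f a b (x + t • stdVec d)) (pd d (f a b) x) 0 := fun x hx a b d => by
    have := hasDerivAt_line (f := f a b) x (stdVec d) 0
      (by simpa using (hfC x hx a b).differentiableAt (by simp))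
    simpa [pd_eq] using! this
  have hμd : ∀ x ∈ V, ∀ a, HasDerivAt (fun t : ℝ => μ (x + t • stdVec a)) (g a x) 0 := by
    intro x hx a
    fin_cases a
    · have h1 := (hfl x hx 0 1 0).sub (hmixed x hx 0 1)
      have h2 : g 0 x = pd 0 (f 0 1) x - pd 1 (f 0 0) x := rfl
      rw [← h2] at h1
      refine h1.congr_of_eventuallyEq ?_
      filter_upwards [hline x hx 0] with t ht
      have := hfirst _ ht 1 0
      have hs : ∀ c, Γ (x + t • stdVec 0) c 1 0 = Γ (x + t • stdVec 0) c 0 1 := fun c =>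
        hsym _ ht c 1 0
      simp [alt, hs] at this
      simp [hf, this]
    · have h1 := (hmixed x hx 1 0).sub (hfl x hx 0 1 1)
      have h2 : g 1 x = pd 0 (f 1 1) x - pd 1 (f 0 1) x := rfl
      rw [← h2] at h1
      refine h1.congr_of_eventuallyEq ?_
      filter_upwards [hline x hx 1] with t ht
      have := hfirst _ ht 0 1
      simp [alt] at this
      simp [hf, this]
  have hgc : ∀ x ∈ V, ∀ a, ContinuousAt (g a) x := fun x hx a => by
    have h1 : ∀ a b d, ContinuousAt (pd d (f a b)) x := fun a b d =>
      ((hfC x hx a b).pd (m := 0) (by norm_num) d).continuousAt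
    fin_cases a
    · exact (h1 0 1 0).sub (h1 0 0 1)
    · exact (h1 1 1 0).sub (h1 0 1 1)
  have hμfd : ∀ x ∈ V, HasFDerivAt μ
      (∑ a, (EuclideanSpace.proj a : Plane →L[ℝ] ℝ).smulRight (g a x)) x := fun x hx =>
    hasFDerivAt_of_partials (mem_of_superset (hV.mem_nhds hx) hμd) (hgc x hx)
  intro x hx
  have hμpd : ∀ a, pd a μ x = g a x := fun a => by
    rw [pd_eq, (hμfd x hx).fderiv]
    fin_cases a <;> simp [Fin.sum_univ_two]
  refine ⟨fun j => ?_, fun a j => ?_⟩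
  · fin_cases j
    · exact hdk x hx 0
    · exact hdk x hx 1
    · exact (hμfd x hx).differentiableAt
  · have hjet : killingJet k x = ![k x 0, k x 1, μ x] := by ext j; fin_cases j <;> rfl
    rw [hjet]
    fin_cases j
    · refine (hfirst x hx a 0).trans ?_
      simp [Fin.sum_univ_two, Fin.sum_univ_three, prolong]
    · refine (hfirst x hx a 1).trans ?_
      simp [Fin.sum_univ_two, Fin.sum_univ_three, prolong]
    · refine (hμpd a).trans ?_
      have hs : ∀ c, Γ x c 1 0 = Γ x c 0 1 := fun c => hsym x hx c 1 0
      have hs' : ∀ d c, pd d (fun y => Γ y c 1 0) x = pd d (fun y => Γ y c 0 1) x := fun d c =>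
        pd_congr (by filter_upwards [hV.mem_nhds hx] with y hy using hsym y hy c 1 0) d
      fin_cases a <;>
        simp [hg, hfpd x hx, Fin.sum_univ_two, Fin.sum_univ_three, prolong, curv, traceGam, alt, hs,
          hs'] <;> ring

/-- The converse uses only the first two rows of the system: the `μ` term drops out on symmetrising,
and skew-symmetrising shows that the third entry is the expected jet component. -/
theorem ParallelOn.killingOn {u : Plane → Fin 3 → ℝ} (hu : ParallelOn (prolong Γ) V u) :
    KillingOn Γ V (fun x a => u x a.castSucc) ∧
      ∀ x ∈ V, killingJet (fun x a => u x a.castSucc) x = u x := by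
  have hpd : ∀ x ∈ V, ∀ a b : Fin 2, pd a (fun y => u y b.castSucc) x =
      Γ x 0 a b * u x 0 + Γ x 1 a b * u x 1 + alt a b * u x 2 := fun x hx a b => by
    rw [(hu x hx).2]
    fin_cases b <;> simp [prolong, Fin.sum_univ_three]
  refine ⟨fun x hx => ⟨fun a => ?_, fun a b => ?_⟩, fun x hx => ?_⟩
  · have := hu.contDiffAt hV 0 (fun y hy a i j => (contDiffAt_prolong (hΓ y hy) a i j).of_le
      (by norm_num)) x hx a.castSucc
    simpa using this
  · rw [hpd x hx, hpd x hx]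
    have hs := fun c => hsym x hx c b a
    rw [hs, hs]
    fin_cases a <;> fin_cases b <;> simp [alt, Fin.sum_univ_two] <;> ring
  · have hs : ∀ c, Γ x c 1 0 = Γ x c 0 1 := fun c => hsym x hx c 1 0
    ext j
    fin_cases j
    · rfl
    · rfl
    · change 1 / 2 * (pd 0 (fun y => u y (Fin.castSucc 1)) x - pd 1 (fun y => u y (Fin.castSucc 0)) x)
        = u x 2
      rw [hpd x hx, hpd x hx]
      simp [alt, hs]
      ring

/-- The obstruction rows annihilate parallel sections. -/
theorem ParallelOn.obsRow_dotProduct {u : Plane → Fin 3 → ℝ} (hu : ParallelOn (prolong Γ) V u) :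
    ∀ x ∈ V, ∀ i, obsRow Γ i x ⬝ᵥ u x = 0 := by
  have hA : ∀ x ∈ V, ∀ a i j, ContDiffAt ℝ 1 (fun y => prolong Γ a y i j) x := fun x hx a i j =>
    (contDiffAt_prolong (hΓ x hx) a i j).of_le (by norm_num)
  have h0 : ∀ x ∈ V, obsRow Γ 0 x ⬝ᵥ u x = 0 := fun x hx => by
    have := congrFun (hu.curvMat_mulVec hV hA hx) 2
    simp only [Matrix.mulVec, dotProduct, curvMat_prolong (hΓ x hx) (hsym x hx), if_true,
      Pi.zero_apply, Fin.sum_univ_three] at this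
    simp only [dotProduct, Fin.sum_univ_three]
    linarith
  intro x hx i
  induction i using Fin.cases with
  | zero => exact h0 x hx
  | succ a =>
    have h1 := hu.rowD_dotProduct hV h0 hx
      (fun j => (contDiffAt_obsRow (hΓ x hx) 0 j).differentiableAt (by simp)) a
    have h2 := h0 x hx
    simp only [dotProduct, rowD_obsRow_zero (hΓ x hx) (hsym x hx), Fin.sum_univ_three] at h1 h2 ⊢
    linear_combination h1 - 2 * traceGam Γ x a * h2

/-- Differentiate the relation for row `a`; the correction terms are multiples of obstruction rows,
which already annihilate `u`. -/
theorem ParallelOn.rowU_dotProduct {u : Plane → Fin 3 → ℝ} (hu : ParallelOn (prolong Γ) V u) :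
    ∀ x ∈ V, ∀ c a, rowU Γ x c a ⬝ᵥ u x = 0 := fun x hx c a => by
  have h := hu.obsRow_dotProduct hV hΓ hsym
  have h1 := hu.rowD_dotProduct hV (fun y hy => h y hy a.succ) hx
    (fun j => (contDiffAt_obsRow (hΓ x hx) a.succ j).differentiableAt (by simp)) c
  have h2 := h x hx a.succ
  have h3 := h x hx 1
  have h4 := h x hx 2
  simp only [dotProduct, rowD_obsRow_succ (hΓ x hx) (hsym x hx), Fin.sum_univ_three,
    Fin.sum_univ_two, Fin.succ_zero_eq_one, Fin.succ_one_eq_two] at h1 h2 h3 h4 ⊢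
  linear_combination h1 - 2 * traceGam Γ x c * h2 - Γ x 0 c a * h3 - Γ x 1 c a * h4

end

/-! ### The row space of the obstruction matrix is parallel where its rank is constant -/

section derivation

variable {A : Fin 2 → Plane → Matrix (Fin 3) (Fin 3) ℝ} {x : Plane} {ρ r s : Plane → Fin 3 → ℝ}

theorem rowD_congr (h : ρ =ᶠ[𝓝 x] r) (b : Fin 2) : rowD A b ρ x = rowD A b r x := by
  ext j
  rw [rowD, rowD, pd_congr (h.mono fun y hy => congrFun hy j), h.eq_of_nhds]

theorem rowD_eq_zero (h : ∀ᶠ y in 𝓝 x, ρ y = 0) (b : Fin 2) : rowD A b ρ x = 0 := by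
  ext j
  rw [rowD_congr (r := fun _ => 0) h, rowD]
  simp [pd_const]

theorem rowD_add (hρ : ∀ j, DifferentiableAt ℝ (fun y => ρ y j) x)
    (hr : ∀ j, DifferentiableAt ℝ (fun y => r y j) x) (b : Fin 2) :
    rowD A b (fun y => ρ y + r y) x = rowD A b ρ x + rowD A b r x := by
  ext j
  simp only [rowD, Pi.add_apply, pd_add (hρ j) (hr j), Fin.sum_univ_three]
  ring

theorem rowD_smul {f : Plane → ℝ} (hf : DifferentiableAt ℝ f x)
    (hρ : ∀ j, DifferentiableAt ℝ (fun y => ρ y j) x) (b : Fin 2) :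
    rowD A b (fun y => f y • ρ y) x = pd b f x • ρ x + f x • rowD A b ρ x := by
  ext j
  simp only [rowD, Pi.add_apply, Pi.smul_apply, smul_eq_mul, pd_mul hf (hρ j), Fin.sum_univ_three]
  ring

/-- `rowD` is the dual connection, whose commutator is right multiplication by the curvature. Two
derivatives are needed, which the first obstruction row has. -/
theorem rowD_comm (hρ : ∀ j, ContDiffAt ℝ 2 (fun y => ρ y j) x)
    (hA : ∀ a i j, DifferentiableAt ℝ (fun y => A a y i j) x) :
    rowD A 0 (rowD A 1 ρ) x - rowD A 1 (rowD A 0 ρ) x = ρ x ᵥ* curvMat A x := by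
  have hd : ∀ j, DifferentiableAt ℝ (fun y => ρ y j) x := fun j =>
    (hρ j).differentiableAt (by simp)
  have hpd : ∀ a j, DifferentiableAt ℝ (pd a fun y => ρ y j) x := fun a j =>
    ((hρ j).pd (m := 1) (by norm_num) a).differentiableAt (by simp)
  have key : ∀ a b j, pd a (fun y => rowD A b ρ y j) x = pd a (pd b fun y => ρ y j) x +
      ∑ k, (pd a (fun y => ρ y k) x * A b x k j + ρ x k * pd a (fun y => A b y k j) x) := by
    intro a b j
    have h : ∀ k, DifferentiableAt ℝ (fun y => ρ y k * A b y k j) x := fun k =>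
      (hd k).fun_mul (hA b k j)
    change pd a (fun y => pd b (fun z => ρ z j) y + ∑ k, ρ y k * A b y k j) x = _
    rw [pd_add (hpd b j) (DifferentiableAt.fun_sum fun k _ => h k), pd_sum _ fun k _ => h k]
    congr 1
    exact Finset.sum_congr rfl fun k _ => pd_mul (hd k) (hA b k j)
  ext j
  have hc := pd_comm (hρ j) 0 1
  change pd 0 (fun y => rowD A 1 ρ y j) x + _ - (pd 1 (fun y => rowD A 0 ρ y j) x + _) = _
  rw [key, key, hc]
  simp only [rowD, Matrix.vecMul, dotProduct, curvMat, Matrix.mul_apply, Fin.sum_univ_three]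
  ring

/-- The derivative of `ρ ∧ r = 0`. The connection terms contribute further `2 × 2` minors at the
same point, which vanish as well. -/
theorem minor_rowD (hρ : ∀ j, DifferentiableAt ℝ (fun y => ρ y j) x)
    (hr : ∀ j, DifferentiableAt ℝ (fun y => r y j) x)
    (h : ∀ᶠ y in 𝓝 x, ∀ i j, ρ y i * r y j - ρ y j * r y i = 0) (b : Fin 2) (i j : Fin 3) :
    rowD A b ρ x i * r x j - rowD A b ρ x j * r x i +
      (ρ x i * rowD A b r x j - ρ x j * rowD A b r x i) = 0 := by
  have h1 : pd b (fun y => ρ y i * r y j - ρ y j * r y i) x = 0 := by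
    rw [pd_congr (g := fun _ => 0) (h.mono fun y hy => hy i j), pd_const]
  rw [pd_sub ((hρ i).fun_mul (hr j)) ((hρ j).fun_mul (hr i)), pd_mul (hρ i) (hr j),
    pd_mul (hρ j) (hr i)] at h1
  have h2 := h.self_of_nhds
  simp only [rowD, Fin.sum_univ_three]
  linear_combination h1 + A b x 0 i * h2 0 j + A b x 1 i * h2 1 j + A b x 2 i * h2 2 j +
    A b x 0 j * h2 i 0 + A b x 1 j * h2 i 1 + A b x 2 j * h2 i 2

/-- The derivative of a vanishing determinant; the connection terms add up to the trace of `A_b`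
times that determinant. -/
theorem det3_rowD (hρ : ∀ j, DifferentiableAt ℝ (fun y => ρ y j) x)
    (hr : ∀ j, DifferentiableAt ℝ (fun y => r y j) x)
    (hs : ∀ j, DifferentiableAt ℝ (fun y => s y j) x)
    (h : ∀ᶠ y in 𝓝 x, det3 (ρ y) (r y) (s y) = 0) (b : Fin 2) :
    det3 (rowD A b ρ x) (r x) (s x) + det3 (ρ x) (rowD A b r x) (s x) +
      det3 (ρ x) (r x) (rowD A b s x) = 0 := by
  have h1 : pd b (fun y => det3 (ρ y) (r y) (s y)) x = 0 := by
    rw [pd_congr (g := fun _ => 0) h, pd_const]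
  have h2 := h.self_of_nhds
  have hm : ∀ i j, DifferentiableAt ℝ (fun y => r y i * s y j) x := fun i j =>
    (hr i).fun_mul (hs j)
  have hm' : ∀ i j, DifferentiableAt ℝ (fun y => r y i * s y j - r y j * s y i) x := fun i j =>
    (hm i j).fun_sub (hm j i)
  have hpm : ∀ i j, pd b (fun y => r y i * s y j - r y j * s y i) x =
      pd b (fun y => r y i) x * s x j + r x i * pd b (fun y => s y j) x -
      (pd b (fun y => r y j) x * s x i + r x j * pd b (fun y => s y i) x) := fun i j => by
    rw [pd_sub (hm i j) (hm j i), pd_mul (hr i) (hs j), pd_mul (hr j) (hs i)]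
  have hpt : ∀ k i j, pd b (fun y => ρ y k * (r y i * s y j - r y j * s y i)) x =
      pd b (fun y => ρ y k) x * (r x i * s x j - r x j * s x i) + ρ x k *
      (pd b (fun y => r y i) x * s x j + r x i * pd b (fun y => s y j) x -
      (pd b (fun y => r y j) x * s x i + r x j * pd b (fun y => s y i) x)) := fun k i j => by
    rw [pd_mul (hρ k) (hm' i j), hpm]
  have ht : ∀ k i j, DifferentiableAt ℝ (fun y => ρ y k * (r y i * s y j - r y j * s y i)) x :=
    fun k i j => (hρ k).fun_mul (hm' i j)
  simp only [det3] at h1 h2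
  rw [pd_add ((ht 0 1 2).fun_sub (ht 1 0 2)) (ht 2 0 1), pd_sub (ht 0 1 2) (ht 1 0 2), hpt, hpt,
    hpt] at h1
  simp only [det3, rowD, Fin.sum_univ_three]
  linear_combination h1 + (A b x 0 0 + A b x 1 1 + A b x 2 2) * h2

end derivation

theorem det3_add_right (a b c d : Fin 3 → ℝ) : det3 a b (c + d) = det3 a b c + det3 a b d := by
  simp only [det3, Pi.add_apply]; ring

theorem det3_sub_right (a b c d : Fin 3 → ℝ) : det3 a b (c - d) = det3 a b c - det3 a b d := by
  simp only [det3, Pi.sub_apply]; ring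

theorem det3_smul_right (t : ℝ) (a b c : Fin 3 → ℝ) : det3 a b (t • c) = t * det3 a b c := by
  simp only [det3, Pi.smul_apply, smul_eq_mul]; ring

theorem det3_self_left (a c : Fin 3 → ℝ) : det3 a a c = 0 := by simp only [det3]; ring

theorem det3_self_right (a b : Fin 3 → ℝ) : det3 a b b = 0 := by simp only [det3]; ring

theorem det3_self_outer (a b : Fin 3 → ℝ) : det3 a b a = 0 := by simp only [det3]; ring

theorem det3_swap_right (a b c : Fin 3 → ℝ) : det3 a c b = -det3 a b c := by
  simp only [det3]; ring

theorem det3_rotate (a b c : Fin 3 → ℝ) : det3 b c a = det3 a b c := by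
  simp only [det3]; ring

/-- Given a plane of rows spanned by `ρ, r` and containing `s`, linear relations for the four
derivatives of `r` and `s` force these to lie in the plane. -/
theorem mem_span_of_det3_relations {ρ r s X Y Z W : Fin 3 → ℝ}
    (hLI : LinearIndependent ℝ ![ρ, r]) (hs : det3 ρ r s = 0) (hX : det3 ρ r X = 0)
    (hXY : det3 ρ X s + det3 ρ r Y = 0) (hYZ : det3 ρ r (Y - Z) = 0)
    (hZW : det3 ρ Z s + det3 ρ r W = 0) {T : Fin 3 → ℝ} (hT : T = X ∨ T = Y ∨ T = Z ∨ T = W) :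
    T ∈ Submodule.span ℝ {ρ, r} := by
  have hs' := mem_span_of_det3_eq_zero hs hLI
  obtain ⟨α, β, rfl⟩ := Submodule.mem_span_pair.1 hs'
  have hkey : ∀ Q : Fin 3 → ℝ, det3 ρ Q (α • ρ + β • r) = -β * det3 ρ r Q := fun Q => by
    simp only [det3, Pi.add_apply, Pi.smul_apply, smul_eq_mul]; ring
  rw [hkey, hX] at hXY
  rw [det3_sub_right] at hYZ
  have hY : det3 ρ r Y = 0 := by linarith
  have hZ : det3 ρ r Z = 0 := by linarith
  rw [hkey, hZ] at hZW
  have hW : det3 ρ r W = 0 := by linarith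
  rcases hT with rfl | rfl | rfl | rfl
  · exact mem_span_of_det3_eq_zero hX hLI
  · exact mem_span_of_det3_eq_zero hY hLI
  · exact mem_span_of_det3_eq_zero hZ hLI
  · exact mem_span_of_det3_eq_zero hW hLI

/-! ### Differential closure of the obstruction rows and existence of parallel sections. -/

section

variable {Γ : Plane → Fin 2 → Fin 2 → Fin 2 → ℝ} {V : Set Plane}

/-- The row space of the obstruction matrix. -/
noncomputable def obsSpace (Γ : Plane → Fin 2 → Fin 2 → Fin 2 → ℝ) (x : Plane) :
    Submodule ℝ (Fin 3 → ℝ) := Submodule.span ℝ (Set.range fun i => obsRow Γ i x)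

theorem obsRow_mem_obsSpace (i : Fin 3) (x : Plane) : obsRow Γ i x ∈ obsSpace Γ x :=
  Submodule.subset_span ⟨i, rfl⟩

theorem rowD_obsRow_zero' {x : Plane} (hΓ : ∀ c a b, ContDiffAt ℝ 4 (fun y => Γ y c a b) x)
    (hsym : ∀ c a b, Γ x c a b = Γ x c b a) (a : Fin 2) : rowD (prolong Γ) a (obsRow Γ 0) x =
      obsRow Γ a.succ x + (2 * traceGam Γ x a) • obsRow Γ 0 x :=
  funext fun j => rowD_obsRow_zero hΓ hsym a j

theorem rowD_obsRow_succ' {x : Plane} (hΓ : ∀ c a b, ContDiffAt ℝ 4 (fun y => Γ y c a b) x)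
    (hsym : ∀ c a b, Γ x c a b = Γ x c b a) (c a : Fin 2) :
    rowD (prolong Γ) c (obsRow Γ a.succ) x = rowU Γ x c a +
      (2 * traceGam Γ x c) • obsRow Γ a.succ x + (Γ x 0 c a • obsRow Γ 1 x +
        Γ x 1 c a • obsRow Γ 2 x) := funext fun j => by
  rw [rowD_obsRow_succ hΓ hsym c a j, Fin.sum_univ_two]
  rfl

variable (hV : IsOpen V) (hΓ : ∀ x ∈ V, ∀ c a b, ContDiffAt ℝ 4 (fun y => Γ y c a b) x)
  (hsym : ∀ x ∈ V, ∀ c a b, Γ x c a b = Γ x c b a)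

include hV hΓ hsym

/-- The commutator of the two derivatives of the first row is that row times the curvature, hence a
multiple of the row. Inserting the formula for its first derivatives leaves the stated difference
modulo the row space; no assumption on the invariants is needed. -/
theorem obsRow_commutator {x : Plane} (hx : x ∈ V) :
    rowD (prolong Γ) 0 (obsRow Γ 2) x - rowD (prolong Γ) 1 (obsRow Γ 1) x ∈ obsSpace Γ x := by
  have hdA : ∀ a i j, DifferentiableAt ℝ (fun y => prolong Γ a y i j) x := fun a i j =>
    (contDiffAt_prolong (hΓ x hx) a i j).differentiableAt (by simp)
  have hd : ∀ i j, DifferentiableAt ℝ (fun y => obsRow Γ i y j) x := fun i j =>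
    (contDiffAt_obsRow (hΓ x hx) i j).differentiableAt (by simp)
  have htr : ∀ a, DifferentiableAt ℝ (fun y => 2 * traceGam Γ y a) x := fun a =>
    (DifferentiableAt.fun_sum fun c _ => (hΓ x hx c a c).differentiableAt (by simp)).const_mul 2
  have hDD : ∀ a b, rowD (prolong Γ) a (rowD (prolong Γ) b (obsRow Γ 0)) x =
      rowD (prolong Γ) a (obsRow Γ b.succ) x + (pd a (fun y => 2 * traceGam Γ y b) x • obsRow Γ 0 x +
        (2 * traceGam Γ x b) • (obsRow Γ a.succ x + (2 * traceGam Γ x a) • obsRow Γ 0 x)) := by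
    intro a b
    rw [rowD_congr (r := fun y => obsRow Γ b.succ y + (2 * traceGam Γ y b) • obsRow Γ 0 y) (by
      filter_upwards [hV.mem_nhds hx] with y hy using rowD_obsRow_zero' (hΓ y hy) (hsym y hy) b),
      rowD_add (r := fun y => (2 * traceGam Γ y b) • obsRow Γ 0 y) (hd b.succ)
        (fun j => (htr b).fun_mul (hd 0 j)), rowD_smul (htr b) (hd 0),
      rowD_obsRow_zero' (hΓ x hx) (hsym x hx)]
  have hc := rowD_comm (A := prolong Γ) (fun j => contDiffAt_obsRow_zero (hΓ x hx) j) hdA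
  have hv : obsRow Γ 0 x ᵥ* curvMat (prolong Γ) x = (3 * obsRow Γ 0 x 2) • obsRow Γ 0 x := by
    ext j
    simp only [Matrix.vecMul, dotProduct, curvMat_prolong (hΓ x hx) (hsym x hx),
      Fin.sum_univ_three, Pi.smul_apply, smul_eq_mul]
    simp
    ring
  rw [hDD, hDD, hv] at hc
  have h1 : rowD (prolong Γ) 0 (obsRow Γ 2) x - rowD (prolong Γ) 1 (obsRow Γ 1) x =
      (3 * obsRow Γ 0 x 2) • obsRow Γ 0 x
        - (pd 0 (fun y => 2 * traceGam Γ y 1) x • obsRow Γ 0 x +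
          (2 * traceGam Γ x 1) • (obsRow Γ 1 x + (2 * traceGam Γ x 0) • obsRow Γ 0 x))
        + (pd 1 (fun y => 2 * traceGam Γ y 0) x • obsRow Γ 0 x +
          (2 * traceGam Γ x 0) • (obsRow Γ 2 x + (2 * traceGam Γ x 1) • obsRow Γ 0 x)) := by
    rw [← hc]
    simp only [Fin.succ_zero_eq_one, Fin.succ_one_eq_two]
    abel
  rw [h1]
  have m := fun i => obsRow_mem_obsSpace (Γ := Γ) i x
  exact Submodule.add_mem _ (Submodule.sub_mem _ (Submodule.smul_mem _ _ (m 0))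
    (Submodule.add_mem _ (Submodule.smul_mem _ _ (m 0)) (Submodule.smul_mem _ _
      (Submodule.add_mem _ (m 1) (Submodule.smul_mem _ _ (m 0))))))
    (Submodule.add_mem _ (Submodule.smul_mem _ _ (m 0)) (Submodule.smul_mem _ _
      (Submodule.add_mem _ (m 2) (Submodule.smul_mem _ _ (m 0)))))

/-- In rank one, differentiating the vanishing minors suffices. In rank two, four derivatives `D_b
r_a` must be shown to lie in a plane, and four relations are at hand: `I_S` settles one of them, the
derivative of `I_N` in each direction relates those with equal `b`, and the commutator relates `D_0
r_2` to `D_1 r_1`. -/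
theorem rowD_obsRow_mem_of_ne_zero {k : ℕ}
    (hrank : ∀ x ∈ V, (obstructionMatrix Γ unitVol x).rank = k)
    (hdet : ∀ x ∈ V, det3 (obsRow Γ 0 x) (obsRow Γ 1 x) (obsRow Γ 2 x) = 0)
    (hW : ∀ x ∈ V, ∀ a, det3 (obsRow Γ 0 x) (obsRow Γ a.succ x) (rowU Γ x a a) = 0)
    {x : Plane} (hx : x ∈ V) (h0 : obsRow Γ 0 x ≠ 0) (b a : Fin 2) :
    rowD (prolong Γ) b (obsRow Γ a.succ) x ∈ obsSpace Γ x := by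
  have hd : ∀ i j, DifferentiableAt ℝ (fun y => obsRow Γ i y j) x := fun i j =>
    (contDiffAt_obsRow (hΓ x hx) i j).differentiableAt (by simp)
  have hρ := rowD_obsRow_zero' (hΓ x hx) (hsym x hx)
  by_cases hk : k ≤ 1
  · have hmin : ∀ y ∈ V, ∀ a i j, obsRow Γ 0 y i * obsRow Γ (Fin.succ a) y j -
        obsRow Γ 0 y j * obsRow Γ (Fin.succ a) y i = 0 := fun y hy a i j => by
      by_contra hne
      have := two_le_rank_of_linearIndependent (M := obstructionMatrix Γ unitVol y) (i := 0)
        (j := Fin.succ a) (linearIndependent_of_minor_ne_zero hne)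
      rw [hrank y hy] at this
      omega
    have hmem : ∀ a, obsRow Γ (Fin.succ a) x ∈ Submodule.span ℝ {obsRow Γ 0 x} := fun a =>
      mem_span_singleton_of_minors h0 (hmin x hx a)
    refine Submodule.span_mono (s := {obsRow Γ 0 x})
      (by rintro _ rfl; exact ⟨0, rfl⟩) (mem_span_singleton_of_minors h0 fun i j => ?_)
    have h1 := minor_rowD (A := prolong Γ) (hd 0) (hd a.succ) (by
      filter_upwards [hV.mem_nhds hx] with y hy using hmin y hy a) b i j
    obtain ⟨α, hα⟩ := Submodule.mem_span_singleton.1 (hmem a)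
    obtain ⟨β, hβ⟩ := Submodule.mem_span_singleton.1 (hmem b)
    rw [hρ b, ← hβ, ← hα] at h1
    simp only [Pi.add_apply, Pi.smul_apply, smul_eq_mul] at h1
    linear_combination h1
  · have hdet' := hdet x hx
    -- In the derivative of the determinant, the term with the differentiated first row drops out:
    -- `D_b r_0` is a combination of obstruction rows, whose determinant with `r_1, r_2` vanishes.
    have hS : ∀ b, det3 (obsRow Γ 0 x) (rowD (prolong Γ) b (obsRow Γ 1) x) (obsRow Γ 2 x) +
        det3 (obsRow Γ 0 x) (obsRow Γ 1 x) (rowD (prolong Γ) b (obsRow Γ 2) x) = 0 := fun b => by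
      have := det3_rowD (A := prolong Γ) (hd 0) (hd 1) (hd 2) (by
        filter_upwards [hV.mem_nhds hx] with y hy using hdet y hy) b
      have h1 : det3 (rowD (prolong Γ) b (obsRow Γ 0) x) (obsRow Γ 1 x) (obsRow Γ 2 x) = 0 := by
        rw [hρ b, ← det3_rotate, det3_add_right, det3_smul_right,
          det3_rotate (obsRow Γ 0 x) (obsRow Γ 1 x), hdet']
        fin_cases b
        · simp [det3]; ring
        · simp [det3]; ring
      linarith
    have hdiag : ∀ a : Fin 2, det3 (obsRow Γ 0 x) (obsRow Γ a.succ x)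
        (rowD (prolong Γ) a (obsRow Γ a.succ) x) = 0 := fun a => by
      rw [rowD_obsRow_succ' (hΓ x hx) (hsym x hx)]
      simp only [det3_add_right, det3_smul_right, hW x hx a, det3_self_right]
      fin_cases a
      · simp [det3_self_right, hdet']
      · simp [det3_self_right, det3_swap_right (obsRow Γ 0 x) (obsRow Γ 1 x), hdet']
    have hvan : ∀ i, ∀ t ∈ obsSpace Γ x, det3 (obsRow Γ 0 x) (obsRow Γ i x) t = 0 := by
      intro i t ht
      induction ht using Submodule.span_induction with
      | mem t ht =>
        obtain ⟨j, rfl⟩ := ht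
        fin_cases i <;> fin_cases j <;>
          simp [det3_self_left, det3_self_right, det3_self_outer, hdet',
            det3_swap_right (obsRow Γ 0 x) (obsRow Γ 1 x)]
      | zero => simp [det3]
      | add t t' _ _ h h' => rw [det3_add_right, h, h', add_zero]
      | smul α t _ h => rw [det3_smul_right, h, mul_zero]
    have hcomm := obsRow_commutator hV hΓ hsym hx
    have hspan : ∀ i, Submodule.span ℝ {obsRow Γ 0 x, obsRow Γ i x} ≤ obsSpace Γ x := fun i =>
      Submodule.span_le.2 (by
        rintro _ (rfl | rfl)
        · exact obsRow_mem_obsSpace 0 x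
        · exact obsRow_mem_obsSpace i x)
    -- The plane is spanned by `r_0` and `r_1`, or by `r_0` and `r_2`; the second case repeats the
    -- chain of relations backwards, starting from the other component of `I_S`. If neither pair is
    -- independent, the rank is at most one.
    by_cases hL1 : LinearIndependent ℝ ![obsRow Γ 0 x, obsRow Γ 1 x]
    · refine hspan 1 (mem_span_of_det3_relations hL1 hdet' (hdiag 0) (hS 0) (hvan 1 _ hcomm) (hS 1)
        ?_)
      fin_cases a <;> fin_cases b <;> simp
    by_cases hL2 : LinearIndependent ℝ ![obsRow Γ 0 x, obsRow Γ 2 x]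
    · have hcomm' := hvan 2 _ (Submodule.neg_mem _ hcomm)
      rw [neg_sub] at hcomm'
      refine hspan 2 (mem_span_of_det3_relations hL2 (by rw [det3_swap_right, hdet', neg_zero])
        (hdiag 1) (Y := rowD (prolong Γ) 1 (obsRow Γ 1) x) (W := rowD (prolong Γ) 0 (obsRow Γ 1) x)
        ?_ hcomm' ?_ ?_)
      · have := hS 1
        rw [det3_swap_right, det3_swap_right (obsRow Γ 0 x) (rowD (prolong Γ) 1 (obsRow Γ 1) x)]
        simp only [Fin.succ_one_eq_two] at this ⊢
        linarith
      · have := hS 0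
        rw [det3_swap_right, det3_swap_right (obsRow Γ 0 x) (rowD (prolong Γ) 0 (obsRow Γ 1) x)]
        linarith
      · fin_cases a <;> fin_cases b <;> simp
    · exfalso
      rw [LinearIndependent.pair_iff' h0] at hL1 hL2
      push Not at hL1 hL2
      obtain ⟨α, hα⟩ := hL1
      obtain ⟨β, hβ⟩ := hL2
      have hle : obsSpace Γ x ≤ Submodule.span ℝ {obsRow Γ 0 x} := Submodule.span_le.2 (by
        rintro _ ⟨i, rfl⟩
        rw [SetLike.mem_coe, Submodule.mem_span_singleton]
        fin_cases i
        · exact ⟨1, one_smul _ _⟩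
        · exact ⟨α, hα⟩
        · exact ⟨β, hβ⟩)
      have h1 := (Submodule.finrank_mono hle).trans (finrank_span_singleton h0).le
      have h2 := hrank x hx
      rw [rank_eq_finrank_rows] at h2
      exact hk (h2 ▸ h1)

omit hV hsym in
theorem continuousAt_rowD_obsRow_dotProduct {x : Plane} (hx : x ∈ V) (b : Fin 2) (i : Fin 3)
    (u : Fin 3 → ℝ) : ContinuousAt (fun y => rowD (prolong Γ) b (obsRow Γ i) y ⬝ᵥ u) x := by
  have hd : ∀ i j, ContinuousAt (fun y => obsRow Γ i y j) x := fun i j =>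
    (contDiffAt_obsRow (hΓ x hx) i j).continuousAt
  have hp : ∀ j, ContinuousAt (pd b fun y => obsRow Γ i y j) x := fun j =>
    ((contDiffAt_obsRow (hΓ x hx) i j).pd (m := 0) (by norm_num) b).continuousAt
  have hA : ∀ i j, ContinuousAt (fun y => prolong Γ b y i j) x := fun i j =>
    (contDiffAt_prolong (hΓ x hx) b i j).continuousAt
  exact tendsto_finsetSum _ fun j _ => (((hp j).add (tendsto_finsetSum _ fun k _ =>
    (hd i k).mul (hA k j))).mul continuousAt_const)

/-- Membership in the row space is proved only where the first row is nonzero. Stated as an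
inequality with a uniform constant it is a closed condition, and so it survives at the zeros of that
row. -/
theorem exists_rowD_obsRow_bound {p : Plane} (hp : p ∈ V)
    (hreg : ∀ᶠ x in 𝓝 p, (obstructionMatrix Γ unitVol x).rank =
      (obstructionMatrix Γ unitVol p).rank) :
    ∃ r₀ > 0, ∀ r, r ≤ r₀ →
      (∀ x ∈ square p r, det3 (obsRow Γ 0 x) (obsRow Γ 1 x) (obsRow Γ 2 x) = 0) →
      (∀ x ∈ square p r, ∀ a, det3 (obsRow Γ 0 x) (obsRow Γ a.succ x) (rowU Γ x a a) = 0) →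
      ∃ c, ∀ x ∈ square p r, ∀ b i u,
        |rowD (prolong Γ) b (obsRow Γ i) x ⬝ᵥ u| ≤ c * ∑ k, |obsRow Γ k x ⬝ᵥ u| := by
  obtain ⟨C, hC⟩ := eventually_rank_le_and_rowSpace_bound
    (M := obstructionMatrix Γ unitVol) (p := p)
    (fun i j => (contDiffAt_obsRow (hΓ p hp) i j).continuousAt)
  have hnorm : ∀ᶠ x in 𝓝 p, ∀ b i j, |rowD (prolong Γ) b (obsRow Γ i) x j| ≤
      |rowD (prolong Γ) b (obsRow Γ i) p j| + 1 :=
    eventually_all.2 fun b => eventually_all.2 fun i => eventually_all.2 fun j => by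
      have := continuousAt_rowD_obsRow_dotProduct hΓ hp b i (Pi.single j 1)
      simp only [dotProduct_single_one] at this
      exact (this.abs.eventually_lt continuousAt_const (lt_add_one _)).mono fun x hx => le_of_lt hx
  obtain ⟨r₀, hr₀, hsub⟩ := exists_square_subset
    (hreg.and (hC.and (hnorm.and (hV.mem_nhds hp))))
  refine ⟨r₀, hr₀, fun r hr hdet hW => ?_⟩
  have hsub' : square p r ⊆ _ := (square_mono hr).trans hsub
  set D : ℝ := ∑ b, ∑ i, ∑ j, (|rowD (prolong Γ) b (obsRow Γ i) p j| + 1) with hD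
  have hDle : ∀ b i j, |rowD (prolong Γ) b (obsRow Γ i) p j| + 1 ≤ D := fun b i j =>
    (Finset.single_le_sum (f := fun j => |rowD (prolong Γ) b (obsRow Γ i) p j| + 1)
      (fun _ _ => by positivity) (Finset.mem_univ j)).trans
    ((Finset.single_le_sum (f := fun i => ∑ j, (|rowD (prolong Γ) b (obsRow Γ i) p j| + 1))
      (fun _ _ => by positivity) (Finset.mem_univ i)).trans
    (Finset.single_le_sum (f := fun b => ∑ i, ∑ j, (|rowD (prolong Γ) b (obsRow Γ i) p j| + 1))
      (fun _ _ => by positivity) (Finset.mem_univ b)))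
  have hD0 : 0 ≤ D := by positivity
  have hV' : ∀ x ∈ square p r, x ∈ V := fun x hx => (hsub' hx).2.2.2
  have hin : ∀ x ∈ square p r, ∀ b i, rowD (prolong Γ) b (obsRow Γ i) x ∈ obsSpace Γ x → ∀ u,
      |rowD (prolong Γ) b (obsRow Γ i) x ⬝ᵥ u| ≤ (|C| * D) * ∑ k, |obsRow Γ k x ⬝ᵥ u| := by
    intro x hx b i hmem u
    obtain ⟨h1, h2, h3, -⟩ := hsub' hx
    refine (h2.2 h1 _ hmem u).trans ?_
    have h4 : ‖rowD (prolong Γ) b (obsRow Γ i) x‖ ≤ D :=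
      (pi_norm_le_iff_of_nonneg hD0).2 fun j => (h3 b i j).trans (hDle b i j)
    have h5 : 0 ≤ ∑ k, |obsRow Γ k x ⬝ᵥ u| := by positivity
    have h6 : C * ‖rowD (prolong Γ) b (obsRow Γ i) x‖ ≤ |C| * D :=
      mul_le_mul (le_abs_self C) h4 (norm_nonneg _) (abs_nonneg C)
    exact mul_le_mul_of_nonneg_right h6 h5
  refine ⟨|C| * D, fun x hx b i u => ?_⟩
  induction i using Fin.cases with
  | zero =>
    refine hin x hx b 0 ?_ u
    rw [rowD_obsRow_zero' (hΓ x (hV' x hx)) (hsym x (hV' x hx))]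
    exact Submodule.add_mem _ (obsRow_mem_obsSpace _ _)
      (Submodule.smul_mem _ _ (obsRow_mem_obsSpace _ _))
  | succ a =>
    have hopen := isOpen_square p r
    have hne : ∀ y ∈ square p r, obsRow Γ 0 y ≠ 0 →
        rowD (prolong Γ) b (obsRow Γ a.succ) y ∈ obsSpace Γ y := fun y hy h0 =>
      rowD_obsRow_mem_of_ne_zero hopen (fun z hz => hΓ z (hV' z hz)) (fun z hz => hsym z (hV' z hz))
        (fun z hz => (hsub' hz).1) hdet hW hy h0 b a
    -- Either `x` is a limit of points where the first row is nonzero and the inequality passes to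
    -- the limit, or the first row vanishes near `x`; then so do its derivatives, and thereby the
    -- other rows.
    by_cases hcl : ∃ᶠ y in 𝓝 x, obsRow Γ 0 y ≠ 0
    · by_contra hlt
      rw [not_le] at hlt
      have hcont : ContinuousAt (fun y => (|C| * D) * ∑ k, |obsRow Γ k y ⬝ᵥ u|) x :=
        continuousAt_const.mul (tendsto_finsetSum _ fun k _ => ContinuousAt.abs
          (tendsto_finsetSum _ fun j _ =>
            ((contDiffAt_obsRow (hΓ x (hV' x hx)) k j).continuousAt.mul continuousAt_const)))
      have hev := hcont.eventually_lt
        (continuousAt_rowD_obsRow_dotProduct hΓ (hV' x hx) b a.succ u).abs hlt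
      obtain ⟨y, hy0, hy1, hy2⟩ := (hcl.and_eventually (hev.and (hopen.mem_nhds hx))).exists
      exact absurd (hin y hy2 b a.succ (hne y hy2 hy0) u) (not_le.2 hy1)
    · rw [not_frequently] at hcl
      simp only [not_not] at hcl
      have hz : ∀ᶠ y in 𝓝 x, obsRow Γ a.succ y = 0 := by
        filter_upwards [hcl.eventually_nhds, hopen.mem_nhds hx] with y hy hyV
        have := rowD_obsRow_zero' (hΓ y (hV' y hyV)) (hsym y (hV' y hyV)) a
        rw [rowD_eq_zero hy, hy.self_of_nhds, smul_zero, add_zero] at this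
        exact this.symm
      refine hin x hx b a.succ ?_ u
      rw [rowD_eq_zero hz]
      exact Submodule.zero_mem _

/-- Existence of parallel sections of the prolonged connection over small squares: if the first
obstruction row vanishes, or at regular points if the rank is at most two and the secondary
obstructions vanish. -/
theorem exists_parallelOn_prolong {p : Plane} (hp : p ∈ V) :
    ∃ r₀ > 0, ∀ r, 0 < r → r ≤ r₀ →
      ((∀ x ∈ square p r, obsRow Γ 0 x = 0) →
        ∀ u₀, ∃ u, u p = u₀ ∧ ParallelOn (prolong Γ) (square p r) u) ∧
      ((∀ᶠ x in 𝓝 p, (obstructionMatrix Γ unitVol x).rank =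
          (obstructionMatrix Γ unitVol p).rank) →
        (∀ x ∈ square p r, det3 (obsRow Γ 0 x) (obsRow Γ 1 x) (obsRow Γ 2 x) = 0) →
        (∀ x ∈ square p r, ∀ a, det3 (obsRow Γ 0 x) (obsRow Γ a.succ x) (rowU Γ x a a) = 0) →
        ∀ u₀, obstructionMatrix Γ unitVol p *ᵥ u₀ = 0 →
          ∃ u, u p = u₀ ∧ ParallelOn (prolong Γ) (square p r) u) := by
  obtain ⟨r₁, hr₁, H⟩ := exists_parallelOn_of_rows (A := prolong Γ) (p := p) fun a i j =>
    (contDiffAt_prolong (hΓ p hp) a i j).of_le (by norm_num)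
  obtain ⟨r₂, hr₂, hsub⟩ := exists_square_subset (hV.mem_nhds hp)
  have hcurv : ∀ x ∈ V, ∀ u, obsRow Γ 0 x ⬝ᵥ u = 0 → curvMat (prolong Γ) x *ᵥ u = 0 := by
    intro x hx u hu
    ext i
    simp only [Matrix.mulVec, dotProduct, curvMat_prolong (hΓ x hx) (hsym x hx)] at hu ⊢
    split_ifs
    · simp only [mul_assoc, ← Finset.mul_sum, hu, mul_zero, Pi.zero_apply]
    · simp
  have hbd : ∃ r₃ > 0, ∀ r, r ≤ r₃ → (∀ᶠ x in 𝓝 p, (obstructionMatrix Γ unitVol x).rank =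
          (obstructionMatrix Γ unitVol p).rank) →
      (∀ x ∈ square p r, det3 (obsRow Γ 0 x) (obsRow Γ 1 x) (obsRow Γ 2 x) = 0) →
      (∀ x ∈ square p r, ∀ a, det3 (obsRow Γ 0 x) (obsRow Γ a.succ x) (rowU Γ x a a) = 0) →
      ∃ c, ∀ x ∈ square p r, ∀ b i u,
        |rowD (prolong Γ) b (obsRow Γ i) x ⬝ᵥ u| ≤ c * ∑ k, |obsRow Γ k x ⬝ᵥ u| := by
    by_cases hreg : ∀ᶠ x in 𝓝 p, (obstructionMatrix Γ unitVol x).rank =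
          (obstructionMatrix Γ unitVol p).rank
    · obtain ⟨r₃, hr₃, h⟩ := exists_rowD_obsRow_bound hV hΓ hsym hp hreg
      exact ⟨r₃, hr₃, fun r hr _ => h r hr⟩
    · exact ⟨1, one_pos, fun r _ h => absurd h hreg⟩
  obtain ⟨r₃, hr₃, hbd⟩ := hbd
  refine ⟨min r₁ (min r₂ r₃), by positivity, fun r hr hle => ⟨fun h0 u₀ => ?_,
    fun hreg hdet hW u₀ hu₀ => ?_⟩⟩
  · have hV' : ∀ x ∈ square p r, x ∈ V := fun x hx =>
      hsub (square_mono (hle.trans ((min_le_right _ _).trans (min_le_left _ _))) hx)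
    -- If the first row vanishes the connection is flat, and the empty constraint `R = 0` will do.
    -- Regularity of `p` plays no role here.
    refine H r hr (hle.trans (min_le_left _ _)) (fun _ _ => 0) 0 (fun x hx i j => by simp)
      (fun x hx a i u => ?_) (fun x hx u _ => hcurv x (hV' x hx) u ?_) u₀ (fun i => zero_dotProduct _)
    · rw [rowD_eq_zero (Eventually.of_forall fun _ => rfl)]; simp
    · rw [h0 x hx, zero_dotProduct]
  · have hV' : ∀ x ∈ square p r, x ∈ V := fun x hx =>
      hsub (square_mono (hle.trans ((min_le_right _ _).trans (min_le_left _ _))) hx)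
    obtain ⟨c, hc⟩ := hbd r (hle.trans ((min_le_right _ _).trans (min_le_right _ _))) hreg hdet hW
    exact H r hr (hle.trans (min_le_left _ _)) (obsRow Γ) c
      (fun x hx i j => (contDiffAt_obsRow (hΓ x (hV' x hx)) i j).differentiableAt (by simp))
      (fun x hx a i u => hc x hx a i u) (fun x hx u hu => hcurv x (hV' x hx) u (hu 0)) u₀
      (fun i => congrFun hu₀ i)

end

/-! ### Charts of a surface -/

section chart

variable {S : Type*} [TopologicalSpace S] [ChartedSpace Plane S] [IsManifold (𝓡 2) 6 S]
  {e : OpenPartialHomeomorph S Plane}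

/-- The derivative of a chart, with values in the plane. -/
noncomputable def chartD (e : OpenPartialHomeomorph S Plane) (q : S) :
    TangentSpace (𝓡 2) q →L[ℝ] Plane := mfderiv (𝓡 2) (𝓡 2) e q

variable (he : e ∈ IsManifold.maximalAtlas (𝓡 2) 6 S)

include he

omit [IsManifold (𝓡 2) 6 S] in
theorem chart_mdifferentiable : e.MDifferentiable (𝓡 2) (𝓡 2) :=
  ⟨(contMDiffOn_of_mem_maximalAtlas he).mdifferentiableOn (by simp),
    (contMDiffOn_symm_of_mem_maximalAtlas he).mdifferentiableOn (by simp)⟩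

omit [IsManifold (𝓡 2) 6 S] in
theorem isInvertible_mfderiv_chart {q : S} (hq : q ∈ e.source) :
    (mfderiv (𝓡 2) (𝓡 2) e q).IsInvertible :=
  ⟨(chart_mdifferentiable he).mfderiv hq, rfl⟩

omit [IsManifold (𝓡 2) 6 S] in
theorem isInvertible_mfderiv_chart_symm {x : Plane} (hx : x ∈ e.target) :
    (mfderiv (𝓡 2) (𝓡 2) e.symm x).IsInvertible :=
  ⟨(chart_mdifferentiable he).symm.mfderiv hx, rfl⟩

omit [IsManifold (𝓡 2) 6 S] in
theorem chartD_coordField {q : S} (hq : q ∈ e.source) (a : Fin 2) :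
    chartD e q (coordField e a q) = stdVec a :=
  (isInvertible_mfderiv_chart he hq).self_apply_inverse _

omit [IsManifold (𝓡 2) 6 S] in
theorem eq_sum_coordField {q : S} (hq : q ∈ e.source) (w : TangentSpace (𝓡 2) q) :
    w = ∑ a, chartD e q w a • coordField e a q := by
  have hinj : Function.Injective (chartD e q) := (chart_mdifferentiable he).mfderiv_injective hq
  refine hinj ?_
  rw [map_sum]
  simp only [map_smul, chartD_coordField he hq]
  exact plane_eq_sum _

omit [IsManifold (𝓡 2) 6 S] in
theorem inverse_mfderiv_symm {x : Plane} (hx : x ∈ e.target) :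
    (mfderiv (𝓡 2) (𝓡 2) e.symm x).inverse = chartD e (e.symm x) := by
  have h := (chart_mdifferentiable he).comp_symm_deriv hx
  ext v : 1
  obtain ⟨w, rfl⟩ := (chart_mdifferentiable he).symm.mfderiv_surjective hx v
  exact ((isInvertible_mfderiv_chart_symm he hx).inverse_apply_self w).trans
    (congrArg (fun L => L w) h).symm

theorem contMDiffAt_coordField {q : S} (hq : q ∈ e.source) (a : Fin 2) :
    ContMDiffAt (𝓡 2) (𝓡 2).tangent 5
      (fun r => (⟨r, coordField e a r⟩ : TangentBundle (𝓡 2) S)) q := by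
  refine ContMDiffAt.mpullback_vectorField_preimage (n := 6) ?_
    (contMDiffAt_of_mem_maximalAtlas he hq) (isInvertible_mfderiv_chart he hq) (by norm_num)
  exact contMDiffAt_vectorSpace_iff_contDiffAt.2 contDiffAt_const

theorem contDiffAt_chartD {X : (r : S) → TangentSpace (𝓡 2) r} {x : Plane} (hx : x ∈ e.target)
    {m : WithTop ℕ∞} (hm : m + 1 ≤ 6)
    (hX : ContMDiffAt (𝓡 2) (𝓡 2).tangent m (fun r => (⟨r, X r⟩ : TangentBundle (𝓡 2) S))
      (e.symm x)) :
    ContDiffAt ℝ m (fun y => chartD e (e.symm y) (X (e.symm y))) x := by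
  have h := ContMDiffAt.mpullback_vectorField_preimage (n := 6) hX
    (contMDiffAt_symm_of_mem_maximalAtlas he hx) (isInvertible_mfderiv_chart_symm he hx) hm
  rw [contMDiffAt_vectorSpace_iff_contDiffAt] at h
  refine h.congr_of_eventuallyEq ?_
  filter_upwards [e.open_target.mem_nhds hx] with y hy
  rw [VectorField.mpullback_apply, inverse_mfderiv_symm he hy]
  rfl

/-- The pointwise version is needed because the Killing condition is tested on fields differentiable
at a single point. -/
theorem differentiableAt_chartD {X : (r : S) → TangentSpace (𝓡 2) r} {x : Plane} (hx : x ∈ e.target)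
    (hX : MDifferentiableAt (𝓡 2) (𝓡 2).tangent (fun r => (⟨r, X r⟩ : TangentBundle (𝓡 2) S))
      (e.symm x)) :
    DifferentiableAt ℝ (fun y => chartD e (e.symm y) (X (e.symm y))) x := by
  have h := MDifferentiableAt.mpullback_vectorField (n := 6) hX
    (contMDiffAt_symm_of_mem_maximalAtlas he hx) (isInvertible_mfderiv_chart_symm he hx)
    (by norm_num)
  have h' := ((contMDiff_snd_tangentBundle_modelSpace Plane (𝓡 2) (n := 1)).contMDiffAt.mdifferentiableAt
    (by simp)).comp x h
  rw [mdifferentiableAt_iff_differentiableAt] at h'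
  refine h'.congr_of_eventuallyEq ?_
  filter_upwards [e.open_target.mem_nhds hx] with y hy
  rw [← inverse_mfderiv_symm he hy]
  rfl

omit [IsManifold (𝓡 2) 6 S] in
theorem mdifferentiableAt_iff_chart {f : S → ℝ} {q : S} (hq : q ∈ e.source) :
    MDifferentiableAt (𝓡 2) 𝓘(ℝ, ℝ) f q ↔ DifferentiableAt ℝ (f ∘ e.symm) (e q) := by
  constructor
  · intro h
    rw [← mdifferentiableAt_iff_differentiableAt]
    refine MDifferentiableAt.comp (e q) (I' := 𝓡 2) ?_
      ((chart_mdifferentiable he).mdifferentiableAt_symm (e.map_source hq))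
    rwa [e.left_inv hq]
  · intro h
    rw [← mdifferentiableAt_iff_differentiableAt] at h
    have := MDifferentiableAt.comp (I' := 𝓡 2) q h ((chart_mdifferentiable he).mdifferentiableAt hq)
    refine this.congr_of_eventuallyEq ?_
    filter_upwards [e.open_source.mem_nhds hq] with r hr
    simp [e.left_inv hr]

omit [IsManifold (𝓡 2) 6 S] in
theorem mvfderiv_chart {f : S → ℝ} {q : S} (hq : q ∈ e.source)
    (hf : MDifferentiableAt (𝓡 2) 𝓘(ℝ, ℝ) f q) (w : TangentSpace (𝓡 2) q) :
    mvfderiv (𝓡 2) f q w = ∑ a, chartD e q w a * pd a (f ∘ e.symm) (e q) := by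
  have hd := (mdifferentiableAt_iff_chart he hq).1 hf
  have h1 : f =ᶠ[𝓝 q] (f ∘ e.symm) ∘ e := by
    filter_upwards [e.open_source.mem_nhds hq] with r hr
    simp [e.left_inv hr]
  rw [← fderiv_eq_sum_pd]
  have h2 : mvfderiv (𝓡 2) f q w = mvfderiv (𝓡 2) ((f ∘ e.symm) ∘ e) q w := by
    rw [mvfderiv, mvfderiv, h1.mfderiv_eq]
    rfl
  rw [h2, mvfderiv_comp_apply (I' := 𝓡 2) q (mdifferentiableAt_iff_differentiableAt.2 hd)
    ((chart_mdifferentiable he).mdifferentiableAt hq)]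
  rw [mvfderiv, mfderiv_eq_fderiv]
  rfl

end chart

/-! ### Christoffel symbols -/

section christoffel

variable {S : Type*} [TopologicalSpace S] [ChartedSpace Plane S] [IsManifold (𝓡 2) 6 S]
  {conn : CovariantDerivative (𝓡 2) Plane (TangentSpace (𝓡 2) : S → Type)}
  {e : OpenPartialHomeomorph S Plane} (he : e ∈ IsManifold.maximalAtlas (𝓡 2) 6 S)

theorem christoffel_eq (x : Plane) (c a b : Fin 2) : christoffel conn e x c a b =
    chartD e (e.symm x) (conn (coordField e b) (e.symm x) (coordField e a (e.symm x))) c := rfl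

/-- A constant vector field on the plane. -/
noncomputable def constField (a : Fin 2) (x : Plane) : TangentSpace (𝓡 2) x := stdVec a

include he

theorem mdifferentiableAt_coordField {q : S} (hq : q ∈ e.source) (a : Fin 2) :
    MDifferentiableAt (𝓡 2) (𝓡 2).tangent
      (fun r => (⟨r, coordField e a r⟩ : TangentBundle (𝓡 2) S)) q :=
  (contMDiffAt_coordField he hq a).mdifferentiableAt (by simp)

/-- Pullback along the chart respects brackets, and constant fields on the plane commute. -/
theorem mlieBracket_coordField {q : S} (hq : q ∈ e.source) (a b : Fin 2) :
    VectorField.mlieBracket (𝓡 2) (coordField e a) (coordField e b) q = 0 := by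
  have : IsManifold (𝓡 2) (minSmoothness ℝ 2) S := by
    rw [minSmoothness_of_isRCLikeNormedField]; exact isManifoldTwo
  have hc : ∀ a, MDifferentiableAt (𝓡 2) (𝓡 2).tangent
      (fun x => (⟨x, constField a x⟩ : TangentBundle (𝓡 2) Plane)) (e q) := fun a =>
    (contMDiffAt_vectorSpace_iff_contDiffAt (n := 1)
      (V := constField a)).2 contDiffAt_const |>.mdifferentiableAt (by simp)
  have h := VectorField.mpullback_mlieBracket (n := 6) (hc a) (hc b)
    (contMDiffAt_of_mem_maximalAtlas he hq)
    (by rw [minSmoothness_of_isRCLikeNormedField]; norm_num)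
  have h0 : VectorField.mlieBracket (𝓡 2) (constField a) (constField b) = 0 := by
    have h1 : VectorField.lieBracketWithin ℝ (fun _ : Plane => stdVec a) (fun _ => stdVec b) univ =
        0 := by
      ext x : 1
      simp [VectorField.lieBracketWithin]
    rw [← VectorField.mlieBracketWithin_univ, VectorField.mlieBracketWithin_eq_lieBracketWithin]
    exact h1
  rw [h0, VectorField.mpullback_zero] at h
  exact h.symm

theorem christoffel_symm (ht : conn.torsion = 0) {x : Plane} (hx : x ∈ e.target) (c a b : Fin 2) :
    christoffel conn e x c a b = christoffel conn e x c b a := by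
  have hq := e.map_target hx
  have h := (CovariantDerivative.torsion_eq_zero_iff conn).1 ht (mdifferentiableAt_coordField he hq a)
    (mdifferentiableAt_coordField he hq b)
  rw [mlieBracket_coordField he hq, sub_eq_zero] at h
  rw [christoffel_eq, christoffel_eq, h]

/-- The regularity hypothesis on the connection is applied below to global fields, so the coordinate
field is cut off by a bump function. The Hausdorff property enters here: the compact support is
closed, so extension by zero is regular. -/
theorem exists_global_coordField [T2Space S] {q : S} (hq : q ∈ e.source) (a : Fin 2) :
    ∃ X : (r : S) → TangentSpace (𝓡 2) r,
      ContMDiff (𝓡 2) (𝓡 2).tangent 5 (fun r => (⟨r, X r⟩ : TangentBundle (𝓡 2) S)) ∧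
      ∀ᶠ r in 𝓝 q, X r = coordField e a r := by
  classical
  obtain ⟨ε, hε, hball⟩ := Metric.nhds_basis_closedBall.mem_iff.1
    (e.open_target.mem_nhds (e.map_source hq))
  let f : ContDiffBump (e q) := ⟨ε / 2, ε, by positivity, by linarith⟩
  set φ : S → ℝ := fun r => if r ∈ e.source then f (e r) else 0 with hφ
  set K : Set S := e.symm '' Metric.closedBall (e q) ε with hK
  have hKc : IsCompact K := (isCompact_closedBall _ _).image_of_continuousOn
    (e.continuousOn_symm.mono hball)
  have hφK : ∀ r, r ∉ K → φ r = 0 := fun r hr => by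
    rw [hφ]
    dsimp only
    split_ifs with hs
    · apply f.zero_of_le_dist
      by_contra hlt
      exact hr ⟨e r, by simpa using (not_le.1 hlt).le, e.left_inv hs⟩
    · rfl
  refine ⟨fun r => φ r • coordField e a r, fun r => ?_, ?_⟩
  · by_cases hr : r ∈ e.source
    · have h1 : ContMDiffAt (𝓡 2) 𝓘(ℝ, ℝ) 5 φ r := by
        have h2 : ContMDiffAt (𝓡 2) 𝓘(ℝ, ℝ) 5 (f ∘ e) r :=
          ContMDiffAt.comp (I' := 𝓡 2) r f.contDiff.contMDiff.contMDiffAt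
            ((contMDiffAt_of_mem_maximalAtlas he hr).of_le (by norm_num))
        refine h2.congr_of_eventuallyEq ?_
        filter_upwards [e.open_source.mem_nhds hr] with s hs
        simp [hφ, hs]
      exact h1.smul_section (contMDiffAt_coordField he hr a)
    · have hrK : r ∉ K := by
        rintro ⟨y, hy, rfl⟩
        exact hr (e.map_target (hball hy))
      have h0 := (Bundle.contMDiff_zeroSection (n := 5) ℝ (TangentSpace (𝓡 2) : S → Type)
        (IB := 𝓡 2) (F := Plane)).contMDiffAt (x := r)
      refine h0.congr_of_eventuallyEq ?_
      filter_upwards [hKc.isClosed.isOpen_compl.mem_nhds hrK] with s hs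
      simp only [hφK s hs, zero_smul]
      rfl
  · have h1 : ∀ᶠ r in 𝓝 q, e r ∈ Metric.ball (e q) (ε / 2) :=
      (e.continuousAt hq).preimage_mem_nhds (Metric.ball_mem_nhds _ (by positivity))
    filter_upwards [h1, e.open_source.mem_nhds hq] with r hr hs
    simp only [hφ, hs, if_true]
    rw [f.one_of_mem_closedBall (Metric.ball_subset_closedBall hr), one_smul]

/-- A covariant derivative depends only on the germ of the field, so the cut-off extension yields
the same Christoffel symbols near the point. -/
theorem contDiffAt_christoffel [T2Space S] (hc : conn.ContMDiffCovariantDerivative 4) {x : Plane}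
    (hx : x ∈ e.target) (c a b : Fin 2) :
    ContDiffAt ℝ 4 (fun y => christoffel conn e y c a b) x := by
  have hq := e.map_target hx
  obtain ⟨X, hX, hXe⟩ := exists_global_coordField he hq b
  have h1 := hc.contMDiff.contMDiff (σ := X) (by
    rw [contMDiffOn_univ]; exact hX)
  rw [contMDiffOn_univ] at h1
  have h2 := (h1.contMDiffAt (x := e.symm x)).clm_bundle_apply
    ((contMDiffAt_coordField he hq a).of_le (by norm_num))
  have h3 : ContMDiffAt (𝓡 2) (𝓡 2).tangent 4
      (fun r => (⟨r, conn (coordField e b) r (coordField e a r)⟩ : TangentBundle (𝓡 2) S))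
      (e.symm x) := by
    refine h2.congr_of_eventuallyEq ?_
    filter_upwards [hXe.eventually_nhds, e.open_source.mem_nhds hq] with r hr hs
    have : conn X r = conn (coordField e b) r :=
      conn.isCovariantDerivativeOnUniv.congr_of_eventuallyEq
        ((hX.contMDiffAt).mdifferentiableAt (by simp)) (mdifferentiableAt_coordField he hs b)
        univ_mem hr
    rw [← this]
  have h4 := contDiffAt_chartD he hx (by norm_num) h3
  exact (EuclideanSpace.proj c : Plane →L[ℝ] ℝ).contDiff.contDiffAt.comp x h4

end christoffel

/-! ### First integrals in coordinates -/

section firstIntegral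

variable {S : Type*} [TopologicalSpace S] [ChartedSpace Plane S]

/-- The components of a one-form in a chart. -/
noncomputable def covecComp (e : OpenPartialHomeomorph S Plane) (K : OneForm S) (x : Plane)
    (a : Fin 2) : ℝ := K (e.symm x) (coordField e a (e.symm x))

/-- The one-form with given components in a chart. -/
noncomputable def formOfComp (e : OpenPartialHomeomorph S Plane) (k : Plane → Fin 2 → ℝ) :
    OneForm S := fun q => ∑ a, k (e q) a • (EuclideanSpace.proj a : Plane →L[ℝ] ℝ).comp (chartD e q)

theorem contMDiffAt_trivial {f : S → ℝ} {q : S} {n : WithTop ℕ∞}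
    (h : ContMDiffAt (𝓡 2) ((𝓡 2).prod 𝓘(ℝ, ℝ)) n
      (fun r => Bundle.TotalSpace.mk' ℝ (E := Bundle.Trivial S ℝ) r (f r)) q) :
    ContMDiffAt (𝓡 2) 𝓘(ℝ, ℝ) n f q :=
  (Bundle.contMDiffAt_totalSpace.1 h).2

variable [IsManifold (𝓡 2) 6 S]
  {conn : CovariantDerivative (𝓡 2) Plane (TangentSpace (𝓡 2) : S → Type)}
  {e : OpenPartialHomeomorph S Plane} (he : e ∈ IsManifold.maximalAtlas (𝓡 2) 6 S)

include he

omit [IsManifold (𝓡 2) 6 S] in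
theorem oneForm_apply {q : S} (hq : q ∈ e.source) (K : OneForm S) (w : TangentSpace (𝓡 2) q) :
    K q w = ∑ a, chartD e q w a * covecComp e K (e q) a := by
  conv_lhs => rw [eq_sum_coordField he hq w]
  rw [map_sum]
  refine Finset.sum_congr rfl fun a _ => ?_
  rw [map_smul, covecComp, e.left_inv hq, smul_eq_mul]

omit [IsManifold (𝓡 2) 6 S] in
theorem covecComp_formOfComp {x : Plane} (hx : x ∈ e.target) (k : Plane → Fin 2 → ℝ) (a : Fin 2) :
    covecComp e (formOfComp e k) x a = k x a := by
  rw [covecComp, formOfComp, sum_apply, e.right_inv hx]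
  simp only [smul_apply, ContinuousLinearMap.comp_apply,
    chartD_coordField he (e.map_target hx)]
  fin_cases a <;> simp

theorem contMDiffAt_oneForm_apply {U : Set S} {K : OneForm S} (hU : IsOpen U)
    (hK : IsFirstIntegralOn conn U K) {q : S} (hqU : q ∈ U) (hq : q ∈ e.source) (a : Fin 2) :
    ContMDiffAt (𝓡 2) 𝓘(ℝ, ℝ) 1 (fun r => K r (coordField e a r)) q :=
  contMDiffAt_trivial ((hK.contMDiffOn.contMDiffAt (hU.mem_nhds hqU)).clm_bundle_apply
    ((contMDiffAt_coordField he hq a).of_le (by norm_num)))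

theorem differentiableAt_chartD_apply {X : (r : S) → TangentSpace (𝓡 2) r} {q : S}
    (hq : q ∈ e.source)
    (hX : MDifferentiableAt (𝓡 2) (𝓡 2).tangent (fun r => (⟨r, X r⟩ : TangentBundle (𝓡 2) S)) q)
    (a : Fin 2) :
    DifferentiableAt ℝ (fun y => chartD e (e.symm y) (X (e.symm y)) a) (e q) :=
  (EuclideanSpace.proj a : Plane →L[ℝ] ℝ).differentiableAt.comp (e q)
    (differentiableAt_chartD he (e.map_source hq) (by rwa [e.left_inv hq]))

omit he [IsManifold (𝓡 2) 6 S] in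
theorem chartD_symm_apply {q : S} (hq : q ∈ e.source) (X : (r : S) → TangentSpace (𝓡 2) r) :
    chartD e (e.symm (e q)) (X (e.symm (e q))) = chartD e q (X q) :=
  congrArg (fun r : S => (chartD e r (X r) : Plane)) (e.left_inv hq)

/-- The connection in coordinates. -/
theorem chartD_conn {X : (r : S) → TangentSpace (𝓡 2) r} {q : S} (hq : q ∈ e.source)
    (hX : MDifferentiableAt (𝓡 2) (𝓡 2).tangent (fun r => (⟨r, X r⟩ : TangentBundle (𝓡 2) S)) q)
    (w : TangentSpace (𝓡 2) q) (c : Fin 2) :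
    chartD e q (conn X q w) c = ∑ b, chartD e q w b *
      (pd b (fun y => chartD e (e.symm y) (X (e.symm y)) c) (e q) +
        ∑ a, christoffel conn e (e q) c b a * chartD e q (X q) a) := by
  set ξ : Fin 2 → Plane → ℝ := fun a y => chartD e (e.symm y) (X (e.symm y)) a with hξ
  have hξd : ∀ a, DifferentiableAt ℝ (ξ a) (e q) := fun a =>
    differentiableAt_chartD_apply he hq hX a
  have hcomp : ∀ a, (fun r => ξ a (e r)) ∘ e.symm =ᶠ[𝓝 (e q)] ξ a := fun a => by
    filter_upwards [e.open_target.mem_nhds (e.map_source hq)] with y hy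
    simp [e.right_inv hy]
  have hgd : ∀ a, MDifferentiableAt (𝓡 2) 𝓘(ℝ, ℝ) (fun r => ξ a (e r)) q := fun a =>
    (mdifferentiableAt_iff_chart he hq).2 ((hξd a).congr_of_eventuallyEq (hcomp a))
  have hcf := fun a => mdifferentiableAt_coordField he hq a
  have hsm := fun a => (hgd a).smul_section (hcf a)
  have hXY : ∀ᶠ r in 𝓝 q, X r = ((fun r => ξ 0 (e r)) • coordField e 0 +
      (fun r => ξ 1 (e r)) • coordField e 1) r := by
    filter_upwards [e.open_source.mem_nhds hq] with r hr
    have := eq_sum_coordField he hr (X r)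
    rw [Fin.sum_univ_two] at this
    simpa [hξ, chartD_symm_apply hr] using this
  have hXq : ∀ a, chartD e q (X q) a = ξ a (e q) := fun a => by simp only [hξ, chartD_symm_apply hq]
  have hΓ : ∀ c a b, chartD e q (conn (coordField e b) q (coordField e a q)) c =
      christoffel conn e (e q) c a b := fun c a b => by rw [christoffel_eq, e.left_inv hq]
  have hconn : ∀ b, chartD e q (conn (coordField e b) q w) c =
      ∑ a, chartD e q w a * christoffel conn e (e q) c a b := fun b => by
    conv_lhs => rw [eq_sum_coordField he hq w]
    simp [Fin.sum_univ_two, hΓ]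
  rw [conn.isCovariantDerivativeOnUniv.congr_of_eventuallyEq hX
      (mdifferentiableAt_add_section (hsm 0) (hsm 1)) univ_mem hXY,
    conn.isCovariantDerivativeOnUniv.add (hsm 0) (hsm 1),
    conn.isCovariantDerivativeOnUniv.leibniz (hcf 0) (hgd 0),
    conn.isCovariantDerivativeOnUniv.leibniz (hcf 1) (hgd 1)]
  simp only [add_apply, smul_apply, ContinuousLinearMap.smulRight_apply, map_add, map_smul,
    mvfderiv_chart he hq (hgd _), chartD_coordField he hq, PiLp.add_apply, PiLp.smul_apply,
    smul_eq_mul, hconn, pd_congr (hcomp _), hXq, Fin.sum_univ_two]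
  fin_cases c <;> simp <;> ring

/-- Polarisation: the quadratic condition is evaluated on `∂_a`, `∂_b` and `∂_a + ∂_b`, and
torsion-freeness merges the two mixed Christoffel terms. -/
theorem IsFirstIntegralOn.killingOn (ht : conn.torsion = 0) {U : Set S} {K : OneForm S}
    (hU : IsOpen U) (hK : IsFirstIntegralOn conn U K) :
    KillingOn (christoffel conn e) (e.target ∩ e.symm ⁻¹' U) (covecComp e K) := by
  rintro x ⟨hx, hxU⟩
  have hq := e.map_target hx
  have hC := contMDiffAt_oneForm_apply he hU hK hxU hq
  have hC' : ∀ a, ContDiffAt ℝ 1 (fun y => covecComp e K y a) x := fun a => by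
    rw [← contMDiffAt_iff_contDiffAt]
    exact ContMDiffAt.comp (I' := 𝓡 2) x (hC a)
      ((contMDiffAt_symm_of_mem_maximalAtlas he hx).of_le (by norm_num))
  refine ⟨hC', ?_⟩
  have hd : ∀ a, MDifferentiableAt (𝓡 2) 𝓘(ℝ, ℝ) (fun r => K r (coordField e a r)) (e.symm x) :=
    fun a => (hC a).mdifferentiableAt (by simp)
  have hX := fun a => mdifferentiableAt_coordField he hq a
  have hder : ∀ a b, mvfderiv (𝓡 2) (fun r => K r (coordField e a r)) (e.symm x)
      (coordField e b (e.symm x)) = pd b (fun y => covecComp e K y a) x := fun a b => by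
    rw [mvfderiv_chart he hq (hd a), chartD_coordField he hq, e.right_inv hx]
    fin_cases b <;> simp <;> rfl
  have hconn : ∀ a b, K (e.symm x) (conn (coordField e b) (e.symm x) (coordField e a (e.symm x))) =
      ∑ c, christoffel conn e x c a b * covecComp e K x c := fun a b => by
    rw [oneForm_apply he hq, e.right_inv hx]
    rfl
  have h1 : ∀ a, pd a (fun y => covecComp e K y a) x =
      ∑ c, christoffel conn e x c a a * covecComp e K x c := fun a => by
    have := hK.killing _ hxU (coordField e a) (hX a)
    rw [hder, hconn] at this
    linarith
  intro a b
  have h2 := hK.killing _ hxU (coordField e a + coordField e b)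
    (mdifferentiableAt_add_section (hX a) (hX b))
  rw [conn.isCovariantDerivativeOnUniv.add (hX a) (hX b)] at h2
  have h3 : (fun r => K r ((coordField e a + coordField e b) r)) =
      (fun r => K r (coordField e a r)) + fun r => K r (coordField e b r) := by
    ext r; simp
  rw [h3, mvfderiv_add (hd a) (hd b)] at h2
  simp only [Pi.add_apply, add_apply, map_add] at h2
  simp only [hder, hconn] at h2
  have h4 := h1 a
  have h5 := h1 b
  have h6 : ∀ c, christoffel conn e x c b a = christoffel conn e x c a b := fun c =>
    christoffel_symm he ht hx c b a
  simp only [h6] at h2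
  linarith

theorem isFirstIntegralOn_formOfComp (ht : conn.torsion = 0) {U : Set S} (hUe : U ⊆ e.source)
    {k : Plane → Fin 2 → ℝ} (hk : KillingOn (christoffel conn e) (e.target ∩ e.symm ⁻¹' U) k) :
    IsFirstIntegralOn conn U (formOfComp e k) where
  contMDiffOn := fun q hqU => by
    have hq := hUe hqU
    have hx : e q ∈ e.target ∩ e.symm ⁻¹' U := ⟨e.map_source hq, by simpa [e.left_inv hq] using hqU⟩
    refine ContMDiffAt.contMDiffWithinAt ?_
    rw [contMDiffAt_hom_bundle]
    refine ⟨contMDiffAt_id, ?_⟩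
    have h1 := ContMDiffAt.mfderiv_const (m := 1) (contMDiffAt_of_mem_maximalAtlas he hq)
      (by norm_num)
    have h2 : ∀ a, ContMDiffAt (𝓡 2) 𝓘(ℝ, ℝ) 1 (fun r => k (e r) a) q := fun a =>
      ContMDiffAt.comp (I' := 𝓡 2) q (((hk _ hx).1 a).contMDiffAt)
        ((contMDiffAt_of_mem_maximalAtlas he hq).of_le (by norm_num))
    have h3 : ContMDiffAt (𝓡 2) 𝓘(ℝ, Plane →L[ℝ] ℝ) 1
        (fun r => ∑ a, k (e r) a • (EuclideanSpace.proj a : Plane →L[ℝ] ℝ).comp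
          (inTangentCoordinates (𝓡 2) (𝓡 2) id e (mfderiv (𝓡 2) (𝓡 2) e) q r)) q :=
      ContMDiffAt.sum fun a _ => (h2 a).smul (contMDiffAt_const.clm_comp h1)
    refine h3.congr_of_eventuallyEq (Eventually.of_forall fun r => ?_)
    ext w
    have h5 : ∀ v : TangentSpace (𝓡 2) (e r), (trivializationAt Plane (TangentSpace (𝓡 2))
        (e q)).continuousLinearMapAt ℝ (e r) v = v := fun v => by
      rw [TangentBundle.continuousLinearMapAt_model_space]; rfl
    simp only [ContinuousLinearMap.inCoordinates, inTangentCoordinates, sum_apply, smul_apply,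
      ContinuousLinearMap.comp_apply, formOfComp, id, h5]
    exact congrArg (fun L : ℝ →L[ℝ] ℝ => L _)
      (Bundle.Trivial.continuousLinearMapAt_trivialization ℝ S ℝ r)
  killing := fun q hqU X hX => by
    have hq := hUe hqU
    have hx : e q ∈ e.target ∩ e.symm ⁻¹' U := ⟨e.map_source hq, by simpa [e.left_inv hq] using hqU⟩
    set ξ : Fin 2 → Plane → ℝ := fun a y => chartD e (e.symm y) (X (e.symm y)) a with hξ
    have hξd : ∀ a, DifferentiableAt ℝ (ξ a) (e q) := fun a =>
      differentiableAt_chartD_apply he hq hX a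
    have hkd : ∀ a, DifferentiableAt ℝ (fun y => k y a) (e q) := fun a =>
      ((hk _ hx).1 a).differentiableAt (by simp)
    have heq : ∀ᶠ y in 𝓝 (e q), ((fun r => formOfComp e k r (X r)) ∘ e.symm) y =
        ∑ a, k y a * ξ a y := by
      filter_upwards [e.open_target.mem_nhds hx.1] with y hy
      rw [Function.comp_apply, oneForm_apply he (e.map_target hy), e.right_inv hy]
      exact Finset.sum_congr rfl fun a _ => by rw [covecComp_formOfComp he hy, mul_comm]
    have hdd : DifferentiableAt ℝ (fun y => ∑ a, k y a * ξ a y) (e q) :=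
      DifferentiableAt.fun_sum fun a _ => (hkd a).fun_mul (hξd a)
    have hmd : MDifferentiableAt (𝓡 2) 𝓘(ℝ, ℝ) (fun r => formOfComp e k r (X r)) q :=
      (mdifferentiableAt_iff_chart he hq).2 (hdd.congr_of_eventuallyEq heq)
    have hXq : ∀ a, chartD e q (X q) a = ξ a (e q) := fun a => by simp only [hξ, chartD_symm_apply hq]
    rw [mvfderiv_chart he hq hmd, oneForm_apply he hq]
    have hcn : ∀ c, chartD e q (conn X q (X q)) c = ∑ b, ξ b (e q) *
        (pd b (ξ c) (e q) + ∑ a, christoffel conn e (e q) c b a * ξ a (e q)) := fun c => by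
      rw [chartD_conn he hq hX]
      simp only [hXq]
      rfl
    have hpd : ∀ b, pd b (fun y => ∑ a, k y a * ξ a y) (e q) = ∑ a, (pd b (fun y => k y a) (e q) *
        ξ a (e q) + k (e q) a * pd b (ξ a) (e q)) := fun b => by
      rw [pd_sum _ fun a _ => (hkd a).fun_mul (hξd a)]
      exact Finset.sum_congr rfl fun a _ => pd_mul (hkd a) (hξd a)
    have h00 := (hk _ hx).2 0 0
    have h01 := (hk _ hx).2 0 1
    have h11 := (hk _ hx).2 1 1
    have hs := fun c => christoffel_symm he ht hx.1 c 1 0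
    simp only [pd_congr heq, hcn, hXq, covecComp_formOfComp he (e.map_source hq), hpd]
    simp only [Fin.sum_univ_two, hs] at h00 h01 h11 ⊢
    -- The derivatives of the components of `X` cancel between the two terms, leaving the
    -- symmetrised Killing equation contracted with `ξ ξ`.
    linear_combination (ξ 0 (e q)) ^ 2 / 2 * h00 + ξ 0 (e q) * ξ 1 (e q) * h01 +
      (ξ 1 (e q)) ^ 2 / 2 * h11

end firstIntegral

/-! ### A first integral is determined by its jet at a point -/

theorem KillingOn.sum_smul {Γ : Plane → Fin 2 → Fin 2 → Fin 2 → ℝ} {V : Set Plane} {n : ℕ}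
    {k : Fin n → Plane → Fin 2 → ℝ} (hk : ∀ i, KillingOn Γ V (k i)) (w : Fin n → ℝ) :
    KillingOn Γ V (fun x a => ∑ i, w i * k i x a) := by
  intro x hx
  have hd : ∀ i a, DifferentiableAt ℝ (fun y => k i y a) x := fun i a =>
    ((hk i x hx).1 a).differentiableAt (by simp)
  refine ⟨fun a => ContDiffAt.sum fun i _ => contDiffAt_const.mul ((hk i x hx).1 a), fun a b => ?_⟩
  have h : ∀ a b, pd a (fun y => ∑ i, w i * k i y b) x = ∑ i, w i * pd a (fun y => k i y b) x :=
    fun a b => by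
      rw [pd_sum _ fun i _ => (hd i b).const_mul (w i)]
      exact Finset.sum_congr rfl fun i _ => pd_const_mul (w i)
  rw [h, h, ← Finset.sum_add_distrib]
  calc _ = ∑ i, w i * (2 * ∑ c, Γ x c a b * k i x c) :=
        Finset.sum_congr rfl fun i _ => by rw [← mul_add, (hk i x hx).2 a b]
    _ = _ := by
        simp only [Finset.mul_sum]
        rw [Finset.sum_comm]
        exact Finset.sum_congr rfl fun i _ => Finset.sum_congr rfl fun j _ => by ring

theorem killingJet_sum_smul {n : ℕ} {k : Fin n → Plane → Fin 2 → ℝ} {x : Plane}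
    (hd : ∀ i a, DifferentiableAt ℝ (fun y => k i y a) x) (w : Fin n → ℝ) :
    killingJet (fun x a => ∑ i, w i * k i x a) x = ∑ i, w i • killingJet (k i) x := by
  have h : ∀ a b, pd a (fun y => ∑ i, w i * k i y b) x = ∑ i, w i * pd a (fun y => k i y b) x :=
    fun a b => by
      rw [pd_sum _ fun i _ => (hd i b).const_mul (w i)]
      exact Finset.sum_congr rfl fun i _ => pd_const_mul (w i)
  ext j
  rw [Finset.sum_apply]
  fin_cases j
  · simp [killingJet]
  · simp [killingJet]
  · simp only [killingJet, h]
    simp [← Finset.sum_sub_distrib, Finset.mul_sum]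
    exact Finset.sum_congr rfl fun i _ => by ring

theorem killingJet_eq_zero_of_eventually {k : Plane → Fin 2 → ℝ} {x : Plane}
    (h : ∀ᶠ y in 𝓝 x, ∀ a, k y a = 0) : killingJet k x = 0 := by
  have hpd : ∀ a b, pd a (fun y => k y b) x = 0 := fun a b => by
    have : (fun y => k y b) =ᶠ[𝓝 x] fun _ => 0 := h.mono fun y hy => hy b
    rw [pd_congr this]
    simp [pd]
  have h0 := h.self_of_nhds
  ext j
  fin_cases j <;> simp [killingJet, hpd, h0]

section jet

variable {S : Type*} [TopologicalSpace S] [ChartedSpace Plane S] [IsManifold (𝓡 2) 6 S]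
  {conn : CovariantDerivative (𝓡 2) Plane (TangentSpace (𝓡 2) : S → Type)}
  {e : OpenPartialHomeomorph S Plane} (he : e ∈ IsManifold.maximalAtlas (𝓡 2) 6 S)

/-- The part of a chart domain in a given set, in coordinates. -/
def chartSet (e : OpenPartialHomeomorph S Plane) (U : Set S) : Set Plane := e.target ∩ e.symm ⁻¹' U

omit [IsManifold (𝓡 2) 6 S] [ChartedSpace Plane S] in
theorem isOpen_chartSet {U : Set S} (hU : IsOpen U) : IsOpen (chartSet e U) :=
  e.isOpen_inter_preimage_symm hU

omit [IsManifold (𝓡 2) 6 S] [ChartedSpace Plane S] in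
theorem mem_chartSet {U : Set S} {q : S} (hq : q ∈ e.source) (hqU : q ∈ U) :
    e q ∈ chartSet e U := ⟨e.map_source hq, by simpa [e.left_inv hq] using hqU⟩

variable (conn) in
/-- A one-form that satisfies the Killing equation in all charts. -/
def IsKillingForm (U : Set S) (K : OneForm S) : Prop :=
  ∀ e ∈ IsManifold.maximalAtlas (𝓡 2) 6 S, KillingOn (christoffel conn e) (chartSet e U)
    (covecComp e K)

theorem IsFirstIntegralOn.isKillingForm (ht : conn.torsion = 0) {U : Set S} {K : OneForm S}
    (hU : IsOpen U) (hK : IsFirstIntegralOn conn U K) : IsKillingForm conn U K :=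
  fun _ he => hK.killingOn he ht hU

omit [IsManifold (𝓡 2) 6 S] in
theorem covecComp_sum_smul {n : ℕ} (K : Fin n → OneForm S) (w : Fin n → ℝ) :
    covecComp e (fun q => ∑ i, w i • K i q) = fun x a => ∑ i, w i * covecComp e (K i) x a := by
  ext x a
  simp [covecComp]

theorem IsKillingForm.sum_smul {U : Set S} {n : ℕ} {K : Fin n → OneForm S}
    (hK : ∀ i, IsKillingForm conn U (K i)) (w : Fin n → ℝ) :
    IsKillingForm conn U (fun q => ∑ i, w i • K i q) := fun e he => by
  rw [covecComp_sum_smul]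
  exact KillingOn.sum_smul (fun i => hK i e he) w

omit [IsManifold (𝓡 2) 6 S] in
include he in
theorem oneForm_eq_zero {q : S} (hq : q ∈ e.source) {K : OneForm S}
    (h : ∀ a, covecComp e K (e q) a = 0) : K q = 0 := by
  ext w
  rw [oneForm_apply he hq]
  simp [h]

variable [T2Space S] (hc : conn.ContMDiffCovariantDerivative 4) (ht : conn.torsion = 0)

include he hc ht

theorem IsKillingForm.eventually_eq_zero {U : Set S} (hU : IsOpen U) {K : OneForm S}
    (hK : IsKillingForm conn U K) {q : S} {r : ℝ}
    (hr : square (e q) r ⊆ chartSet e U) {x : Plane} (hx : x ∈ square (e q) r)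
    (h0 : killingJet (covecComp e K) x = 0) {y : Plane} (hy : y ∈ square (e q) r) (a : Fin 2) :
    covecComp e K y a = 0 := by
  have hpar := (hK e he).parallelOn (isOpen_chartSet hU)
    (fun x hx => contDiffAt_christoffel he hc hx.1) (fun x hx => christoffel_symm he ht hx.1)
  have h := (hpar.mono hr).eq_zero (convex_square _ _)
    (fun x hx a i j => (contDiffAt_prolong
      (fun c a b => contDiffAt_christoffel he hc (hr hx).1 c a b) a i j).continuousAt) hx hy h0
  fin_cases a
  · exact congrFun h 0
  · exact congrFun h 1

/-- Unique continuation. The set `Z` where `K` vanishes locally is open, and it is closed in `U`: a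
coordinate square about a limit point meets `Z`, the jet vanishes there, and so `K` vanishes on the
whole square. -/
theorem IsKillingForm.eq_zero {U : Set S} (hU : IsOpen U) (hUc : IsPreconnected U) {K : OneForm S}
    (hK : IsKillingForm conn U K) {q : S} (hq : q ∈ e.source) (hqU : q ∈ U)
    (h0 : killingJet (covecComp e K) (e q) = 0) : ∀ r ∈ U, K r = 0 := by
  have key : ∀ {e : OpenPartialHomeomorph S Plane}, e ∈ IsManifold.maximalAtlas (𝓡 2) 6 S →
      ∀ q ∈ e.source, q ∈ U → (∃ r > 0, square (e q) r ⊆ chartSet e U) := fun {e} he q hq hqU =>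
    exists_square_subset ((isOpen_chartSet hU).mem_nhds (mem_chartSet hq hqU))
  have zero_near : ∀ {e : OpenPartialHomeomorph S Plane}, e ∈ IsManifold.maximalAtlas (𝓡 2) 6 S →
      ∀ q ∈ e.source, ∀ r > 0, square (e q) r ⊆ chartSet e U → (∃ x ∈ square (e q) r,
      killingJet (covecComp e K) x = 0) → ∀ᶠ s in 𝓝 q, K s = 0 := by
    rintro e he q hq r hr hrU ⟨x, hx, hx0⟩
    have h1 : ∀ᶠ s in 𝓝 q, e s ∈ square (e q) r :=
      (e.continuousAt hq).preimage_mem_nhds (square_mem_nhds hr)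
    filter_upwards [h1, e.open_source.mem_nhds hq] with s hs hse
    exact oneForm_eq_zero he hse (hK.eventually_eq_zero he hc ht hU hrU hx hx0 hs)
  set Z : Set S := {s | ∀ᶠ t in 𝓝 s, K t = 0} with hZ
  have hZo : IsOpen Z := isOpen_setOfPred_eventually_nhds
  have hsub : U ⊆ Z := by
    refine hUc.subset_of_closure_inter_subset hZo ⟨q, hqU, ?_⟩ ?_
    · obtain ⟨r, hr, hrU⟩ := key he q hq hqU
      exact zero_near he q hq r hr hrU ⟨_, mem_square_self hr, h0⟩
    · rintro s ⟨hs, hsU⟩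
      have hse := mem_chart_source Plane s
      have hem := IsManifold.chart_mem_maximalAtlas (I := 𝓡 2) (n := 6) s
      obtain ⟨r, hr, hrU⟩ := key hem s hse hsU
      have h1 : (chartAt Plane s).source ∩ chartAt Plane s ⁻¹' square (chartAt Plane s s) r ∈ 𝓝 s :=
        inter_mem ((chartAt Plane s).open_source.mem_nhds hse)
          (((chartAt Plane s).continuousAt hse).preimage_mem_nhds (square_mem_nhds hr))
      obtain ⟨t, ⟨hte, ht⟩, htZ⟩ := mem_closure_iff_nhds.1 hs _ h1
      refine zero_near hem s hse r hr hrU ⟨_, ht, killingJet_eq_zero_of_eventually ?_⟩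
      have h2 : ∀ᶠ y in 𝓝 (chartAt Plane s t), K ((chartAt Plane s).symm y) = 0 := by
        have := (chartAt Plane s).continuousAt_symm ((chartAt Plane s).map_source hte)
        rw [ContinuousAt, (chartAt Plane s).left_inv hte] at this
        exact this.eventually htZ
      filter_upwards [h2] with y hy a
      simp [covecComp, hy]
  exact fun r hr => (hsub hr).self_of_nhds

/-- Independent first integrals have independent jets everywhere. -/
theorem HasIndepFirstIntegrals.exists_parallelOn {U : Set S} (hU : IsOpen U)
    (hUc : IsPreconnected U) {n : ℕ} (h : HasIndepFirstIntegrals conn n U) :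
    ∃ u : Fin n → Plane → Fin 3 → ℝ,
      (∀ i, ParallelOn (prolong (christoffel conn e)) (chartSet e U) (u i)) ∧
      ∀ x ∈ chartSet e U, LinearIndependent ℝ (fun i => u i x) := by
  obtain ⟨K, hK, hli⟩ := h
  have hKf := fun i => (hK i).isKillingForm ht hU
  refine ⟨fun i => killingJet (covecComp e (K i)), fun i => (hKf i e he).parallelOn
    (isOpen_chartSet hU) (fun x hx => contDiffAt_christoffel he hc hx.1)
    (fun x hx => christoffel_symm he ht hx.1), fun x hx => ?_⟩
  rw [Fintype.linearIndependent_iff] at hli ⊢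
  intro w hw
  apply hli w
  have h1 := (IsKillingForm.sum_smul hKf w).eq_zero he hc ht hU hUc (e.map_target hx.1) hx.2 (by
    rw [e.right_inv hx.1, covecComp_sum_smul, killingJet_sum_smul]
    · exact hw
    · exact fun i a => ((hKf i e he x hx).1 a).differentiableAt (by simp))
  ext q : 1
  simpa using h1 q q.2

/-- Parallel sections with independent values at a point give independent first integrals. -/
theorem hasIndepFirstIntegrals_of_parallelOn {U : Set S} (hU : IsOpen U) (hUe : U ⊆ e.source)
    {n : ℕ} {u : Fin n → Plane → Fin 3 → ℝ}
    (hu : ∀ i, ParallelOn (prolong (christoffel conn e)) (chartSet e U) (u i))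
    {x : Plane} (hx : x ∈ chartSet e U) (hli : LinearIndependent ℝ (fun i => u i x)) :
    HasIndepFirstIntegrals conn n U := by
  have hk := fun i => (hu i).killingOn (isOpen_chartSet hU)
    (fun x hx => contDiffAt_christoffel he hc hx.1) (fun x hx => christoffel_symm he ht hx.1)
  set k : Fin n → Plane → Fin 2 → ℝ := fun i x a => u i x a.castSucc with hkdef
  refine ⟨fun i => formOfComp e (k i), fun i =>
    isFirstIntegralOn_formOfComp he ht hUe (hk i).1, ?_⟩
  rw [Fintype.linearIndependent_iff] at hli ⊢
  intro w hw
  apply hli w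
  have h1 : ∑ i, w i • u i x = ∑ i, w i • killingJet (k i) x :=
    Finset.sum_congr rfl fun i _ => by rw [(hk i).2 x hx]
  rw [h1, ← killingJet_sum_smul fun i a => (((hk i).1 x hx).1 a).differentiableAt (by simp)]
  apply killingJet_eq_zero_of_eventually
  filter_upwards [(isOpen_chartSet hU).mem_nhds hx] with y hy a
  have h2 := congrArg (fun L => L (coordField e a (e.symm y))) (congrFun hw ⟨e.symm y, hy.2⟩)
  have h3 := congrFun (congrFun (covecComp_sum_smul (e := e) (fun i => formOfComp e (k i)) w) y) a
  simp only [covecComp_formOfComp he hy.1] at h3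
  rw [← h3]
  simpa [covecComp] using h2

omit he hc ht [T2Space S] in
theorem hasFirstIntegral_iff {U : Set S} :
    HasFirstIntegral conn U ↔ HasIndepFirstIntegrals conn 1 U := by
  constructor
  · rintro ⟨K, hK, q, hq, h0⟩
    refine ⟨fun _ => K, fun _ => hK, ?_⟩
    rw [linearIndependent_unique_iff]
    exact fun h => h0 (congrFun h ⟨q, hq⟩)
  · rintro ⟨K, hK, hli⟩
    refine ⟨K 0, hK 0, ?_⟩
    have h := hli.ne_zero 0
    by_contra! hne
    exact h (funext fun q => hne q q.2)

end jet

/-! ### The obstruction matrix and its rank -/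

section pointwise

variable {Γ : Plane → Fin 2 → Fin 2 → Fin 2 → ℝ} {v : Plane → ℝ} {x : Plane}

theorem minor_eq_zero_of_rank_le_one (h : (obstructionMatrix Γ unitVol x).rank ≤ 1)
    (i k : Fin 3) (j l : Fin 3) :
    obsRow Γ i x j * obsRow Γ k x l - obsRow Γ k x j * obsRow Γ i x l = 0 := by
  rw [mul_comm (obsRow Γ k x j)]
  by_contra hne
  have := two_le_rank_of_linearIndependent (M := obstructionMatrix Γ unitVol x)
    (i := i) (j := k) (linearIndependent_of_minor_ne_zero (i := j) (j := l) fun h' => hne h')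
  omega

theorem det3_obsRow_eq_zero (h : (obstructionMatrix Γ unitVol x).rank ≤ 2) :
    det3 (obsRow Γ 0 x) (obsRow Γ 1 x) (obsRow Γ 2 x) = 0 := by
  by_contra hne
  have := (rank_eq_three_iff (obstructionMatrix Γ unitVol x)).2 hne
  omega

theorem rank_le_two_of_det3 (h : det3 (obsRow Γ 0 x) (obsRow Γ 1 x) (obsRow Γ 2 x) = 0) :
    (obstructionMatrix Γ unitVol x).rank ≤ 2 := by
  have h3 := rank_le_three (obstructionMatrix Γ unitVol x)
  have : (obstructionMatrix Γ unitVol x).rank ≠ 3 := fun h' => (rank_eq_three_iff _).1 h' h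
  omega

theorem det3_rowU_eq_zero (h : (obstructionMatrix Γ unitVol x).rank ≤ 1) (a : Fin 2)
    (s : Fin 3 → ℝ) : det3 (obsRow Γ 0 x) (obsRow Γ a.succ x) s = 0 := by
  have h01 := minor_eq_zero_of_rank_le_one h 0 a.succ 0 1
  have h02 := minor_eq_zero_of_rank_le_one h 0 a.succ 0 2
  have h12 := minor_eq_zero_of_rank_le_one h 0 a.succ 1 2
  rw [det3]
  linear_combination s 2 * h01 - s 1 * h02 + s 0 * h12

theorem tensorT_eq_zero_of_rank_le_one (hv : v x ≠ 0)
    (h : (obstructionMatrix Γ unitVol x).rank ≤ 1) (a b : Fin 2) : tensorT Γ v x a b = 0 := by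
  rw [tensorT_eq hv, minor_eq_zero_of_rank_le_one h, mul_zero]

/-- With `β ≠ 0`, the equation `T = 0` says that row `a` is `N_a / β` times the first row, so the
matrix is an outer product, nonzero because of its entry `β`. -/
theorem rank_eq_one_of_tensorT (hv : v x ≠ 0) (hT : ∀ a b, tensorT Γ v x a b = 0)
    (hβ : beta Γ unitVol x ≠ 0) : (obstructionMatrix Γ unitVol x).rank = 1 := by
  have hβ' : obsRow Γ 0 x 2 ≠ 0 := hβ
  have h : ∀ (a b : Fin 2), obsRow Γ a.succ x b.castSucc =
      obsRow Γ a.succ x 2 / obsRow Γ 0 x 2 * obsRow Γ 0 x b.castSucc := fun a b => by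
    have := hT a b
    rw [tensorT_eq hv] at this
    have h2 := (mul_eq_zero.1 this).resolve_left (pow_ne_zero _ (inv_ne_zero hv))
    field_simp
    linarith
  have hM : obstructionMatrix Γ unitVol x =
      Matrix.vecMulVec (fun i => obsRow Γ i x 2 / obsRow Γ 0 x 2) (obsRow Γ 0 x) := by
    ext i j
    rw [Matrix.vecMulVec_apply]
    change obsRow Γ i x j = _
    have h2 : ∀ a : Fin 2, obsRow Γ a.succ x 2 =
      obsRow Γ a.succ x 2 / obsRow Γ 0 x 2 * obsRow Γ 0 x 2 := fun a => by field_simp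
    fin_cases i
    · simp [hβ']
    · fin_cases j
      · exact h 0 0
      · exact h 0 1
      · exact h2 0
    · fin_cases j
      · exact h 1 0
      · exact h 1 1
      · exact h2 1
  refine le_antisymm ?_ (Nat.one_le_iff_ne_zero.2 fun h0 => hβ' ?_)
  · rw [hM]
    exact Matrix.rank_vecMulVec_le _ _
  · rw [rank_eq_zero_iff] at h0
    exact congrFun (congrFun h0 0) 2

theorem beta_unitVol_eq_ricci :
    beta Γ unitVol x = 2 / 3 * (ricci Γ x 1 0 - ricci Γ x 0 1) := by
  simp [beta_unitVol, skewB, schouten]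
  ring

theorem ricciSkew_ne_zero_iff :
    ricci Γ x 0 1 - ricci Γ x 1 0 ≠ 0 ↔ beta Γ unitVol x ≠ 0 := by
  rw [beta_unitVol_eq_ricci]
  constructor
  · intro h h'
    exact h (by linarith)
  · intro h h'
    exact h (by linarith)

theorem skewB_eq_zero_of_beta (h : beta Γ unitVol x = 0) (i : Fin 2 → Fin 2) :
    skewB Γ x i = 0 := by
  rw [beta_unitVol_eq_ricci] at h
  have h' : ricci Γ x 1 0 = ricci Γ x 0 1 := by linarith
  have hs : ∀ a b, ricci Γ x a b = ricci Γ x b a := fun a b => by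
    fin_cases a <;> fin_cases b <;> simp [h']
  simp only [skewB, schouten]
  simp [hs (i 1) (i 0)]

theorem nabla_skewB_eq_zero_of_beta (h : ∀ᶠ y in 𝓝 x, beta Γ unitVol y = 0)
    (i : Fin 3 → Fin 2) : nabla Γ (skewB Γ) x i = 0 := by
  have h0 : ∀ i, (fun y => skewB Γ y i) =ᶠ[𝓝 x] fun _ => 0 := fun i =>
    h.mono fun y hy => skewB_eq_zero_of_beta hy i
  rw [nabla, pd_congr (h0 _)]
  simp [pd, skewB_eq_zero_of_beta h.self_of_nhds]

/-- If `T = 0` and the Ricci tensor is symmetric, then the first obstruction vanishes. -/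
theorem obsRow_zero_eq_zero_of_tensorT (hv : v x ≠ 0) (hT : ∀ a b, tensorT Γ v x a b = 0)
    (hβ : ∀ᶠ y in 𝓝 x, beta Γ unitVol y = 0) : obsRow Γ 0 x = 0 := by
  have hβ0 := hβ.self_of_nhds
  -- If `β` vanishes near `x`, then `∇B = 0` and `N = -F`, so `T_a^b = -F_a F^b`. Lowering an index
  -- swaps the two components of `F` up to sign, so the off-diagonal entries are squares of the
  -- components up to sign.
  have hN : ∀ a, covN Γ unitVol x a = -covF Γ unitVol x a := fun a => by
    rw [covN]
    simp [nabla_skewB_eq_zero_of_beta hβ]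
  have h : ∀ a b, covF Γ unitVol x a * vecF Γ unitVol x b = 0 := fun a b => by
    have := hT a b
    rw [tensorT_eq hv] at this
    have h2 := (mul_eq_zero.1 this).resolve_left (pow_ne_zero _ (inv_ne_zero hv))
    rw [obsRow_zero, obsRow_succ] at h2
    fin_cases b <;> simp [hβ0, hN] at h2 ⊢ <;> tauto
  simp only [covF_unitVol] at h
  have h0 : vecF Γ unitVol x 0 = 0 := by
    have := h 1 0
    simpa [alt, Fin.sum_univ_two] using this
  have h1 : vecF Γ unitVol x 1 = 0 := by
    have := h 0 1
    simpa [alt, Fin.sum_univ_two] using this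
  rw [obsRow_zero, h0, h1, hβ0]
  ext j
  fin_cases j <;> rfl

end pointwise

/-! ### Nonvanishing of the volume form in coordinates. -/

section volume

variable {S : Type*} [TopologicalSpace S] [ChartedSpace Plane S] [IsManifold (𝓡 2) 6 S]
  {e : OpenPartialHomeomorph S Plane} (he : e ∈ IsManifold.maximalAtlas (𝓡 2) 6 S)

include he in
theorem VolumeForm.comp_ne_zero (ε : VolumeForm S) {x : Plane} (hx : x ∈ e.target) :
    ε.comp e x ≠ 0 := by
  have hq := e.map_target hx
  have hli : LinearIndependent ℝ (fun a => coordField e a (e.symm x)) := by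
    rw [Fintype.linearIndependent_iff]
    intro w hw a
    have h : chartD e (e.symm x) (∑ a, w a • coordField e a (e.symm x)) = 0 := by
      rw [hw, map_zero]
    rw [map_sum] at h
    simp only [map_smul, chartD_coordField he hq] at h
    have h' := congrArg (fun t : Plane => t a) h
    simp only [Fin.sum_univ_two] at h'
    fin_cases a <;> simpa using h'
  have hspan : ⊤ ≤ Submodule.span ℝ (range fun a => coordField e a (e.symm x)) := by
    intro w _
    rw [eq_sum_coordField he hq w]
    exact Submodule.sum_mem _ fun a _ => Submodule.smul_mem _ _ (Submodule.subset_span ⟨a, rfl⟩)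
  let b := Module.Basis.mk hli hspan
  have hb : ⇑b = fun a => coordField e a (e.symm x) := Module.Basis.coe_mk _ _
  have h := (AlternatingMap.map_basis_ne_zero_iff (e := b)
    (ε.form (e.symm x)).toAlternatingMap).2 (by
      intro h0
      apply ε.ne_zero (e.symm x)
      ext w
      exact congrArg (fun f : AlternatingMap ℝ (TangentSpace (𝓡 2) (e.symm x)) ℝ (Fin 2) => f w) h0)
  rw [hb] at h
  exact h

end volume

/-! ### Counting first integrals -/

section squares

variable {S : Type*} [TopologicalSpace S] {e : OpenPartialHomeomorph S Plane}

/-- The part of a surface that corresponds to a coordinate square. -/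
def chartSquare (e : OpenPartialHomeomorph S Plane) (p : S) (r : ℝ) : Set S :=
  e.source ∩ e ⁻¹' square (e p) r

theorem isOpen_chartSquare (p : S) (r : ℝ) : IsOpen (chartSquare e p r) :=
  e.isOpen_inter_preimage (isOpen_square _ _)

theorem mem_chartSquare_self {p : S} (hp : p ∈ e.source) {r : ℝ} (hr : 0 < r) :
    p ∈ chartSquare e p r := ⟨hp, mem_square_self hr⟩

theorem chartSet_chartSquare {p : S} {r : ℝ} (h : square (e p) r ⊆ e.target) :
    chartSet e (chartSquare e p r) = square (e p) r := by
  ext x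
  constructor
  · rintro ⟨hx, -, hx'⟩
    simpa [e.right_inv hx] using hx'
  · intro hx
    exact ⟨h hx, e.map_target (h hx), by simpa [e.right_inv (h hx)] using hx⟩

theorem isPreconnected_chartSquare {p : S} {r : ℝ} (h : square (e p) r ⊆ e.target) :
    IsPreconnected (chartSquare e p r) := by
  rw [chartSquare, ← e.symm_image_eq_source_inter_preimage h]
  exact (convex_square _ _).isPreconnected.image _ (e.continuousOn_symm.mono h)

theorem isConnected_chartSquare {p : S} {r : ℝ} (hp : p ∈ e.source) (hr : 0 < r)
    (h : square (e p) r ⊆ e.target) : IsConnected (chartSquare e p r) :=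
  ⟨⟨p, mem_chartSquare_self hp hr⟩, isPreconnected_chartSquare h⟩

theorem exists_chartSquare_subset {p : S} (hp : p ∈ e.source) {O : Set S} (hO : O ∈ 𝓝 p) :
    ∃ r₀ > 0, ∀ r ≤ r₀, square (e p) r ⊆ e.target ∧ chartSquare e p r ⊆ O ∩ e.source := by
  have h1 : e.symm ⁻¹' O ∈ 𝓝 (e p) := by
    refine (e.continuousAt_symm (e.map_source hp)).preimage_mem_nhds ?_
    rwa [e.left_inv hp]
  obtain ⟨r, hr, h⟩ := exists_square_subset
    (inter_mem (e.open_target.mem_nhds (e.map_source hp)) h1)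
  refine ⟨r, hr, fun r' hr' => ⟨fun x hx => (h (square_mono hr' hx)).1, ?_⟩⟩
  rintro q ⟨hq, hqr⟩
  refine ⟨?_, hq⟩
  have := (h (square_mono hr' hqr)).2
  simpa [e.left_inv hq] using this

end squares

/-! ### Upper bounds from rank, density of regular points, and existence on squares. -/

section count

variable {S : Type*} [TopologicalSpace S] [T2Space S] [ChartedSpace Plane S]
  [IsManifold (𝓡 2) 6 S]
  {conn : CovariantDerivative (𝓡 2) Plane (TangentSpace (𝓡 2) : S → Type)}
  {e : OpenPartialHomeomorph S Plane} (he : e ∈ IsManifold.maximalAtlas (𝓡 2) 6 S)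
  (hc : conn.ContMDiffCovariantDerivative 4) (ht : conn.torsion = 0)

include he hc ht

/-- By unique continuation, independent integrals have independent jets at every point, and all
these jets lie in the kernel of the matrix; rank–nullity does the rest. -/
theorem HasIndepFirstIntegrals.rank_add_le {U : Set S} (hU : IsOpen U) (hUc : IsPreconnected U)
    {n : ℕ} (h : HasIndepFirstIntegrals conn n U) {x : Plane} (hx : x ∈ chartSet e U) :
    (obstructionMatrix (christoffel conn e) unitVol x).rank + n ≤ 3 := by
  obtain ⟨u, hu, hli⟩ := h.exists_parallelOn he hc ht hU hUc
  refine rank_add_card_le (hli x hx) fun i => ?_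
  ext j
  exact (hu i).obsRow_dotProduct (isOpen_chartSet hU)
    (fun x hx => contDiffAt_christoffel he hc hx.1) (fun x hx => christoffel_symm he ht hx.1) x hx j

/-- The necessary conditions for a first integral. -/
theorem HasFirstIntegral.invariants {U : Set S} (hU : IsOpen U) (hUc : IsPreconnected U)
    (h : HasFirstIntegral conn U) (ε : VolumeForm S) : InvariantsVanishOn conn ε e U := by
  rintro q ⟨hqU, hq⟩
  have hx := mem_chartSet hq hqU
  have hv := ε.comp_ne_zero he hx.1
  obtain ⟨u, hu, hli⟩ := (hasFirstIntegral_iff.1 h).exists_parallelOn he hc ht hU hUc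
  have hΓ := fun x (hx : x ∈ chartSet e U) => contDiffAt_christoffel he hc hx.1
  have hsym := fun x (hx : x ∈ chartSet e U) => christoffel_symm he ht hx.1
  have hu0 : u 0 (e q) ≠ 0 := (hli _ hx).ne_zero 0
  have hr := (hu 0).obsRow_dotProduct (isOpen_chartSet hU) hΓ hsym _ hx
  have hrU := (hu 0).rowU_dotProduct (isOpen_chartSet hU) hΓ hsym _ hx
  have hW : ∀ a, tensorW (christoffel conn e) (ε.comp e) (e q) a a a = 0 := fun a => by
    rw [tensorW_eq hv, det3_eq_zero_of_dotProduct hu0 (hr 0) (hr a.succ) (hrU a a), mul_zero]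
  refine ⟨?_, ?_⟩
  · rw [invN_eq hv, det3_eq_zero_of_dotProduct hu0 (hr 0) (hr 1) (hr 2), mul_zero]
  · rw [invS, hW, hW]; rfl

omit ht in
/-- Regular points are dense. -/
theorem subset_closure_regular (ε : VolumeForm S) :
    e.source ⊆ closure {p ∈ e.source | IsRegularPoint conn ε e p} := by
  intro p hp
  rw [mem_closure_iff]
  intro O hO hpO
  set M := obstructionMatrix (christoffel conn e) unitVol with hM
  -- A point of `O` where the rank is maximal is regular: nearby the rank cannot drop by
  -- semicontinuity, and it cannot rise by maximality.
  set k := sSup ((fun q => (M (e q)).rank) '' (O ∩ e.source)) with hk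
  have hbdd : BddAbove ((fun q => (M (e q)).rank) '' (O ∩ e.source)) :=
    ⟨3, by rintro _ ⟨q, -, rfl⟩; exact rank_le_three _⟩
  obtain ⟨q, ⟨hqO, hq⟩, hqk⟩ := Nat.sSup_mem (s := (fun q => (M (e q)).rank) '' (O ∩ e.source))
    ⟨_, p, ⟨hpO, hp⟩, rfl⟩ hbdd
  refine ⟨q, hqO, hq, ?_⟩
  have hx := e.map_source hq
  obtain ⟨C, hC⟩ := eventually_rank_le_and_rowSpace_bound (M := M) (p := e q) fun i j =>
    (contDiffAt_obsRow (contDiffAt_christoffel he hc hx) i j).continuousAt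
  have hO' : ∀ᶠ x in 𝓝 (e q), e.symm x ∈ O := by
    refine (e.continuousAt_symm hx).preimage_mem_nhds ?_
    rw [e.left_inv hq]
    exact hO.mem_nhds hqO
  rw [IsRegularPoint]
  filter_upwards [hC, hO', e.open_target.mem_nhds hx] with x hx1 hx2 hx3
  rw [rank_obstructionMatrix_eq (ε.comp_ne_zero he hx3),
    rank_obstructionMatrix_eq (ε.comp_ne_zero he hx)]
  refine le_antisymm ?_ hx1.1
  have h1 := le_csSup hbdd ⟨e.symm x, ⟨hx2, e.map_target hx3⟩, rfl⟩
  simp only [e.right_inv hx3] at h1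
  simp only at hqk
  rw [hqk]
  exact h1

omit [T2Space S] hc ht in
theorem isRegularPoint_iff {ε : VolumeForm S} {p : S} (hp : p ∈ e.source) :
    IsRegularPoint conn ε e p ↔
      ∀ᶠ x in 𝓝 (e p), (obstructionMatrix (christoffel conn e) unitVol x).rank =
        (obstructionMatrix (christoffel conn e) unitVol (e p)).rank := by
  have hx := e.map_source hp
  rw [IsRegularPoint]
  refine eventually_congr ?_
  filter_upwards [e.open_target.mem_nhds hx] with x hx3
  rw [rank_obstructionMatrix_eq (ε.comp_ne_zero he hx3),
    rank_obstructionMatrix_eq (ε.comp_ne_zero he hx)]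

/-- Existence of first integrals on small squares. -/
theorem exists_square_hasIndepFirstIntegrals (ε : VolumeForm S) {p : S} (hp : p ∈ e.source) :
    ∃ r₀ > 0, ∀ r, 0 < r → r ≤ r₀ → square (e p) r ⊆ e.target →
      ((∀ x ∈ square (e p) r, obsRow (christoffel conn e) 0 x = 0) →
        HasIndepFirstIntegrals conn 3 (chartSquare e p r)) ∧
      (IsRegularPoint conn ε e p → InvariantsVanishOn conn ε e (chartSquare e p r) →
        ∀ n, (obstructionMatrix (christoffel conn e) unitVol (e p)).rank + n ≤ 3 →
          HasIndepFirstIntegrals conn n (chartSquare e p r)) := by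
  obtain ⟨r₀, hr₀, H⟩ := exists_parallelOn_prolong (Γ := christoffel conn e) e.open_target
    (fun x hx => contDiffAt_christoffel he hc hx) (fun x hx => christoffel_symm he ht hx)
    (e.map_source hp)
  refine ⟨r₀, hr₀, fun r hr hle hsq => ?_⟩
  obtain ⟨H1, H2⟩ := H r hr hle
  have key : ∀ n (w : Fin n → Fin 3 → ℝ), LinearIndependent ℝ w →
      (∀ i, ∃ u, u (e p) = w i ∧ ParallelOn (prolong (christoffel conn e)) (square (e p) r) u) →
      HasIndepFirstIntegrals conn n (chartSquare e p r) := by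
    intro n w hw hex
    choose u hu0 hu using hex
    rw [← chartSet_chartSquare hsq] at hu
    refine hasIndepFirstIntegrals_of_parallelOn he hc ht (isOpen_chartSquare _ _)
      inter_subset_left hu (mem_chartSet hp (mem_chartSquare_self hp hr)) ?_
    simpa [hu0] using hw
  refine ⟨fun h0 => ?_, fun hreg hinv n hn => ?_⟩
  · exact key 3 _ (Pi.basisFun ℝ (Fin 3)).linearIndependent fun i => H1 h0 _
  -- A basis of the kernel at `p` supplies the initial values.
  · obtain ⟨w, hw, hker⟩ := exists_linearIndependent_ker _ hn
    refine key n w hw fun i => H2 ((isRegularPoint_iff he hp).1 hreg) ?_ ?_ _ (hker i)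
    all_goals
      intro x hx
      have hxq : e.symm x ∈ chartSquare e p r ∩ e.source := by
        have := e.map_target (hsq hx)
        exact ⟨⟨this, by simpa [e.right_inv (hsq hx)] using hx⟩, this⟩
      have hI := hinv _ hxq
      rw [e.right_inv (hsq hx)] at hI
      have hv := ε.comp_ne_zero he (hsq hx)
    · have := hI.1
      rw [invN_eq hv] at this
      exact (mul_eq_zero.1 this).resolve_left (pow_ne_zero _ (inv_ne_zero hv))
    · intro a
      have h1 := hI.2
      rw [invS, Prod.mk_eq_zero] at h1
      have : tensorW (christoffel conn e) (ε.comp e) x a a a = 0 := by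
        fin_cases a
        exacts [h1.1, h1.2]
      rw [tensorW_eq hv] at this
      exact (mul_eq_zero.1 this).resolve_left (pow_ne_zero _ (inv_ne_zero hv))

end count

/-! ### Projectively flat coordinates -/

section flatCoordinates

variable {Γ : Plane → Fin 2 → Fin 2 → Fin 2 → ℝ} {V : Set Plane} {x : Plane}

variable (Γ) in
/-- The prolongation `u = (σ, ∂_1 σ, ∂_2 σ)` of the system `∇_a ∇_b σ + P_{ab} σ = 0`. -/
noncomputable def hessProlong (a : Fin 2) (x : Plane) : Matrix (Fin 3) (Fin 3) ℝ :=
  !![0, kron 0 a, kron 1 a;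
     -schouten Γ x ![a, 0], Γ x 0 a 0, Γ x 1 a 0;
     -schouten Γ x ![a, 1], Γ x 0 a 1, Γ x 1 a 1]

theorem contDiffAt_hessProlong (hΓ : ∀ c a b, ContDiffAt ℝ 4 (fun y => Γ y c a b) x) (a : Fin 2)
    (i j : Fin 3) : ContDiffAt ℝ 3 (fun y => hessProlong Γ a y i j) x := by
  have hP := fun i => contDiffAt_schouten (m := 3) hΓ (by norm_num) i
  have hΓ' : ∀ c a b, ContDiffAt ℝ 3 (fun y => Γ y c a b) x := fun c a b =>
    (hΓ c a b).of_le (by norm_num)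
  fin_cases i <;> fin_cases j
  exacts [contDiffAt_const, contDiffAt_const, contDiffAt_const, (hP _).neg, hΓ' _ _ _, hΓ' _ _ _,
    (hP _).neg, hΓ' _ _ _, hΓ' _ _ _]

theorem tensorY_eq_zero_of_obsRow (h : ∀ᶠ y in 𝓝 x, obsRow Γ 0 y = 0) (b : Fin 2) :
    tensorY Γ x ![0, 1, b] = 0 := by
  have hβ : ∀ᶠ y in 𝓝 x, beta Γ unitVol y = 0 := h.mono fun y hy => congrFun hy 2
  have h0 : vecF Γ unitVol x 0 = 0 := congrFun h.self_of_nhds 0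
  have h1 : vecF Γ unitVol x 1 = 0 := congrFun h.self_of_nhds 1
  simp only [vecF_unitVol, nabla_skewB_eq_zero_of_beta hβ, Fin.sum_univ_two] at h0 h1
  fin_cases b
  · simpa [alt] using h1
  · simpa [alt] using h0

theorem schouten_symm_of_obsRow (h : obsRow Γ 0 x = 0) :
    schouten Γ x ![1, 0] = schouten Γ x ![0, 1] := by
  have h1 := skewB_eq_zero_of_beta (congrFun h 2) ![0, 1]
  simp only [skewB] at h1
  simpa [sub_eq_zero] using h1

/-- The first row vanishes by symmetry of `Γ` and `P`. In the other rows, the curvature of `∇`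
cancels against the terms in `P`, as it is algebraic in `P` on a surface, and what is left is `Y`,
which is zero. -/
theorem curvMat_hessProlong (hsym : ∀ c a b, Γ x c a b = Γ x c b a) (h : ∀ᶠ y in 𝓝 x, obsRow Γ 0 y = 0) :
    curvMat (hessProlong Γ) x = 0 := by
  have hs : ∀ c, Γ x c 1 0 = Γ x c 0 1 := fun c => hsym c 1 0
  have hP := schouten_symm_of_obsRow h.self_of_nhds
  have hY := fun b => tensorY_eq_zero_of_obsRow h b
  have c0 := fun d => curv_zero_one_zero (Γ := Γ) x d
  have c1 := fun d => curv_zero_one_one (Γ := Γ) x d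
  simp only [tensorY, nabla_two, Fin.sum_univ_two] at hY
  have hY0 := hY 0
  have hY1 := hY 1
  simp [hs, hP] at hY0 hY1
  have c00 := c0 0
  have c01 := c0 1
  have c10 := c1 0
  have c11 := c1 1
  simp [curv, Fin.sum_univ_two, hs, hP] at c00 c01 c10 c11
  ext i j
  fin_cases i <;> fin_cases j <;>
    simp [curvMat, hessProlong, Matrix.mul_apply, Fin.sum_univ_three, kron, pd_const, pd_neg, hs,
      hP]
  exacts [by linear_combination -hY0, by linear_combination c00, by linear_combination c10,
    by linear_combination -hY1, by linear_combination c01, by linear_combination c11]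

/-- Local solutions of `∇_a ∇_b σ + P_{ab} σ = 0`. -/
theorem exists_hess_solutions (hV : IsOpen V)
    (hΓ : ∀ x ∈ V, ∀ c a b, ContDiffAt ℝ 4 (fun y => Γ y c a b) x)
    (hsym : ∀ x ∈ V, ∀ c a b, Γ x c a b = Γ x c b a) (h : ∀ x ∈ V, obsRow Γ 0 x = 0)
    {p : Plane} (hp : p ∈ V) :
    ∃ r > 0, square p r ⊆ V ∧ ∀ u₀ : Fin 3 → ℝ, ∃ σ : Plane → ℝ, σ p = u₀ 0 ∧
      (∀ a : Fin 2, pd a σ p = u₀ a.succ) ∧ ∀ x ∈ square p r, ContDiffAt ℝ 5 σ x ∧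
        ∀ a b, pd a (pd b σ) x = ∑ c, Γ x c a b * pd c σ x - schouten Γ x ![a, b] * σ x := by
  obtain ⟨r₁, hr₁, H⟩ := exists_parallelOn_of_rows (A := hessProlong Γ) (p := p) fun a i j =>
    (contDiffAt_hessProlong (hΓ p hp) a i j).of_le (by norm_num)
  obtain ⟨r₂, hr₂, hsub⟩ := exists_square_subset (hV.mem_nhds hp)
  have hr : 0 < min r₁ r₂ := lt_min hr₁ hr₂
  have hsub' : square p (min r₁ r₂) ⊆ V := fun x hx => hsub (square_mono (min_le_right _ _) hx)
  refine ⟨min r₁ r₂, hr, hsub', fun u₀ => ?_⟩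
  obtain ⟨u, hu0, hu⟩ := H _ hr (min_le_left _ _) (fun _ _ => 0) 0 (fun x _ i j => by simp)
    (fun x _ a i u => by rw [rowD_eq_zero (Eventually.of_forall fun _ => rfl)]; simp)
    (fun x hx u _ => by
      rw [curvMat_hessProlong (hsym x (hsub' hx))
        (by filter_upwards [hV.mem_nhds (hsub' hx)] with y hy using h y hy), Matrix.zero_mulVec]) u₀ (fun i => zero_dotProduct _)
  have hpd0 : ∀ x ∈ square p (min r₁ r₂), ∀ a : Fin 2, pd a (fun y => u y 0) x = u x a.succ := by
    intro x hx a
    rw [(hu x hx).2, Fin.sum_univ_three]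
    fin_cases a <;> simp [hessProlong, kron]
  have hpd1 : ∀ x ∈ square p (min r₁ r₂), ∀ a b : Fin 2, pd a (fun y => u y b.succ) x =
      ∑ c, Γ x c a b * u x c.succ - schouten Γ x ![a, b] * u x 0 := by
    intro x hx a b
    rw [(hu x hx).2, Fin.sum_univ_three, Fin.sum_univ_two]
    fin_cases b <;> simp [hessProlong] <;> ring
  have hC := hu.contDiffAt (isOpen_square _ _) 3 fun x hx => contDiffAt_hessProlong (hΓ x (hsub' hx))
  have hev : ∀ x ∈ square p (min r₁ r₂), ∀ a : Fin 2,
      pd a (fun y => u y 0) =ᶠ[𝓝 x] fun y => u y a.succ := fun x hx a => by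
    filter_upwards [(isOpen_square _ _).mem_nhds hx] with y hy using hpd0 y hy a
  refine ⟨fun y => u y 0, by simp [hu0], fun a => by rw [hpd0 p (mem_square_self hr), hu0],
    fun x hx => ⟨?_, fun a b => ?_⟩⟩
  -- The section is `C^4`, one better than its `C^3` coefficients. Its first entry has the other
  -- entries as derivatives, so it is `C^5`.
  · have := contDiffAt_of_pd (isOpen_square p (min r₁ r₂)) (n := 4) (f := fun y => u y 0)
      (fun x hx => (hu x hx).1 0)
      (fun a x hx => ((hC x hx a.succ).congr_of_eventuallyEq (hev x hx a)).of_le (by norm_num)) x hx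
    exact this.of_le (by norm_num)
  · rw [pd_congr (hev x hx b), hpd1 x hx]
    simp only [hpd0 x hx]

/-- Local coordinate functions in which the connection is projectively equivalent to the flat
connection. -/
theorem exists_flat_coordinates (hV : IsOpen V)
    (hΓ : ∀ x ∈ V, ∀ c a b, ContDiffAt ℝ 4 (fun y => Γ y c a b) x)
    (hsym : ∀ x ∈ V, ∀ c a b, Γ x c a b = Γ x c b a) (h : ∀ x ∈ V, obsRow Γ 0 x = 0)
    {p : Plane} (hp : p ∈ V) :
    ∃ W, IsOpen W ∧ p ∈ W ∧ W ⊆ V ∧ ∃ φ υ : Fin 2 → Plane → ℝ,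
      (∀ i a, pd a (φ i) p = kron i a) ∧ ∀ x ∈ W, (∀ i, ContDiffAt ℝ 6 (φ i) x) ∧
        ∀ i a b, pd a (pd b (φ i)) x =
          ∑ c, Γ x c a b * pd c (φ i) x - υ a x * pd b (φ i) x - υ b x * pd a (φ i) x := by
  obtain ⟨r, hr, hsub, H⟩ := exists_hess_solutions hV hΓ hsym h hp
  -- The coordinates are the quotients `σ_i / s`, with `s = 1`, `ds = 0`, `σ_i = 0` and `∂_a σ_i =
  -- δ_{ia}` at `p`. The `P` terms cancel in the Hessian of a quotient, leaving `υ = d log |s|`.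
  obtain ⟨s, hs0, hs1, hs⟩ := H ![1, 0, 0]
  choose σ hσ0 hσ1 hσ using fun i : Fin 2 => H (fun j => if j = i.succ then 1 else 0)
  set W := square p r ∩ {x | s x ≠ 0} with hW
  have hsc : ContinuousOn s (square p r) := fun x hx => (hs x hx).1.continuousAt.continuousWithinAt
  have hWo : IsOpen W := hsc.isOpen_inter_preimage (isOpen_square _ _) isOpen_ne
  have hdf : ∀ {f : Plane → ℝ} {x : Plane}, ContDiffAt ℝ 5 f x → DifferentiableAt ℝ f x :=
    fun hf => hf.differentiableAt (by norm_num)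
  have hφ5 : ∀ i, ∀ x ∈ W, ContDiffAt ℝ 5 (fun y => σ i y / s y) x := fun i x hx =>
    (hσ i x hx.1).1.div (hs x hx.1).1 hx.2
  have hpd : ∀ i, ∀ x ∈ W, ∀ a, pd a (σ i) x = pd a (fun y => σ i y / s y) x * s x +
      σ i x / s x * pd a s x := by
    intro i x hx a
    rw [← pd_mul (hdf (hφ5 i x hx)) (hdf (hs x hx.1).1)]
    refine pd_congr ?_ a
    filter_upwards [hWo.mem_nhds hx] with y hy
    have := hy.2
    simp only [mem_ofPred_eq] at this
    field_simp
  have hpdφ : ∀ i, ∀ x ∈ W, ∀ a b, pd a (pd b (fun y => σ i y / s y)) x =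
      ∑ c, Γ x c a b * pd c (fun y => σ i y / s y) x -
        pd a s x / s x * pd b (fun y => σ i y / s y) x -
        pd b s x / s x * pd a (fun y => σ i y / s y) x := by
    intro i x hx a b
    have hsx : s x ≠ 0 := hx.2
    have hpφ : ∀ a, DifferentiableAt ℝ (pd a (fun y => σ i y / s y)) x := fun a =>
      ((hφ5 i x hx).pd (m := 4) (by norm_num) a).differentiableAt (by norm_num)
    have hps : ∀ a, DifferentiableAt ℝ (pd a s) x := fun a =>
      ((hs x hx.1).1.pd (m := 4) (by norm_num) a).differentiableAt (by norm_num)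
    have hev : pd b (σ i) =ᶠ[𝓝 x] fun y => pd b (fun y => σ i y / s y) y * s y +
        σ i y / s y * pd b s y := by
      filter_upwards [hWo.mem_nhds hx] with y hy using hpd i y hy b
    have h1 := (hσ i x hx.1).2 a b
    rw [pd_congr hev, pd_add ((hpφ b).fun_mul (hdf (hs x hx.1).1))
      ((hdf (hφ5 i x hx)).fun_mul (hps b)), pd_mul (hpφ b) (hdf (hs x hx.1).1),
      pd_mul (hdf (hφ5 i x hx)) (hps b), (hs x hx.1).2 a b] at h1
    simp only [hpd i x hx, Fin.sum_univ_two] at h1 ⊢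
    field_simp at h1 ⊢
    refine mul_left_cancel₀ hsx ?_
    linear_combination h1
  refine ⟨W, hWo, ⟨mem_square_self hr, by simp [hs0]⟩, fun x hx => hsub hx.1,
    fun i y => σ i y / s y, fun a y => pd a s y / s y, fun i a => ?_,
    fun x hx => ⟨fun i => ?_, fun i a b => hpdφ i x hx a b⟩⟩
  · have h1 := hpd i p ⟨mem_square_self hr, by simp [hs0]⟩ a
    rw [hs0, hs1, hσ0, hσ1] at h1
    fin_cases i <;> fin_cases a <;> simp [kron] at h1 ⊢ <;> linarith
  -- A chart has to be `C^6`, while the quotients are so far `C^5`. The Hessian equation expresses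
  -- their second derivatives by `C^4` functions and provides the missing order.
  · have h5 : ∀ b, ∀ x ∈ W, ContDiffAt ℝ 5 (pd b (fun y => σ i y / s y)) x := fun b x hx => by
      have := contDiffAt_of_pd hWo (n := 4) (f := pd b (fun y => σ i y / s y))
        (fun x hx => ((hφ5 i x hx).pd (m := 4) (by norm_num) b).differentiableAt (by norm_num))
        (fun a x hx => by
          have h4 : ∀ a, ContDiffAt ℝ 4 (pd a (fun y => σ i y / s y)) x := fun a =>
            (hφ5 i x hx).pd (by norm_num) a
          have h4s : ∀ a, ContDiffAt ℝ 4 (fun y => pd a s y / s y) x := fun a =>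
            ((hs x hx.1).1.pd (m := 4) (by norm_num) a).div ((hs x hx.1).1.of_le (by norm_num)) hx.2
          have hev : pd a (pd b (fun y => σ i y / s y)) =ᶠ[𝓝 x] fun x =>
              ∑ c, Γ x c a b * pd c (fun y => σ i y / s y) x -
                pd a s x / s x * pd b (fun y => σ i y / s y) x -
                pd b s x / s x * pd a (fun y => σ i y / s y) x := by
            filter_upwards [hWo.mem_nhds hx] with y hy using hpdφ i y hy a b
          refine ContDiffAt.congr_of_eventuallyEq ?_ hev
          exact ((ContDiffAt.sum fun c _ => (hΓ x (hsub hx.1) c a b).mul (h4 c)).sub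
            ((h4s a).mul (h4 b))).sub ((h4s b).mul (h4 a))) x hx
      exact this.of_le (by norm_num)
    have := contDiffAt_of_pd hWo (n := 5) (fun x hx => hdf (hφ5 i x hx))
      (fun b x hx => h5 b x hx) x hx
    exact this.of_le (by norm_num)

end flatCoordinates

/-! ### Projective flatness -/

section change

variable {S : Type*} [TopologicalSpace S] [ChartedSpace Plane S] [IsManifold (𝓡 2) 6 S]
  {conn : CovariantDerivative (𝓡 2) Plane (TangentSpace (𝓡 2) : S → Type)}
  {e e' : OpenPartialHomeomorph S Plane} (he : e ∈ IsManifold.maximalAtlas (𝓡 2) 6 S)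
  (he' : e' ∈ IsManifold.maximalAtlas (𝓡 2) 6 S)

include he he'

omit [IsManifold (𝓡 2) 6 S] in
theorem chartD_change {φ : Fin 2 → Plane → ℝ} {q : S} (hq : q ∈ e.source) (hq' : q ∈ e'.source)
    (hφ : ∀ᶠ r in 𝓝 q, ∀ i, e' r i = φ i (e r)) (w : TangentSpace (𝓡 2) q) (i : Fin 2) :
    chartD e' q w i = ∑ a, chartD e q w a * pd a (φ i) (e q) := by
  have hm : MDifferentiableAt (𝓡 2) 𝓘(ℝ, ℝ) (fun r => e' r i) q :=
    (mdifferentiableAt_iff_chart he' hq').2 (by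
      refine ((EuclideanSpace.proj i : Plane →L[ℝ] ℝ).differentiableAt).congr_of_eventuallyEq ?_
      filter_upwards [e'.open_target.mem_nhds (e'.map_source hq')] with y hy
      simp [e'.right_inv hy])
  have h1 := mvfderiv_chart he' hq' hm w
  have h2 := mvfderiv_chart he hq hm w
  have h3 : ∀ a, pd a ((fun r => e' r i) ∘ e'.symm) (e' q) = kron i a := fun a => by
    have : (fun r => e' r i) ∘ e'.symm =ᶠ[𝓝 (e' q)] (EuclideanSpace.proj i : Plane →L[ℝ] ℝ) := by
      filter_upwards [e'.open_target.mem_nhds (e'.map_source hq')] with y hy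
      simp [e'.right_inv hy]
    rw [pd_congr this, pd, ContinuousLinearMap.fderiv]
    simp [kron]
  have h4 : (fun r => e' r i) ∘ e.symm =ᶠ[𝓝 (e q)] φ i := by
    have := e.continuousAt_symm (e.map_source hq)
    rw [ContinuousAt, e.left_inv hq] at this
    filter_upwards [this.eventually hφ, e.open_target.mem_nhds (e.map_source hq)] with y hy hye
    simp [hy i, e.right_inv hye]
  rw [h1] at h2
  simp only [h3, pd_congr h4] at h2
  rw [← h2]
  fin_cases i <;> simp [kron]

/-- The Christoffel symbols in coordinates adapted to the projective structure. -/
theorem christoffel_change {φ υ : Fin 2 → Plane → ℝ} {q : S} (hq : q ∈ e.source)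
    (hq' : q ∈ e'.source) (hφ : ∀ᶠ r in 𝓝 q, ∀ i, e' r i = φ i (e r))
    (hφ2 : ∀ i, ContDiffAt ℝ 2 (φ i) (e q))
    (hess : ∀ i a b, pd a (pd b (φ i)) (e q) = ∑ c, christoffel conn e (e q) c a b *
      pd c (φ i) (e q) - υ a (e q) * pd b (φ i) (e q) - υ b (e q) * pd a (φ i) (e q))
    (i a b : Fin 2) : christoffel conn e' (e' q) i a b =
      (∑ d, υ d (e q) * chartD e q (coordField e' a q) d) * kron i b +
      (∑ d, υ d (e q) * chartD e q (coordField e' b q) d) * kron i a := by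
  set ξ : Fin 2 → Fin 2 → Plane → ℝ := fun a c y =>
    chartD e (e.symm y) (coordField e' a (e.symm y)) c with hξ
  have hξd : ∀ a c, DifferentiableAt ℝ (ξ a c) (e q) := fun a c =>
    differentiableAt_chartD_apply he hq (mdifferentiableAt_coordField he' hq' a) c
  have hξq : ∀ a c, chartD e q (coordField e' a q) c = ξ a c (e q) := fun a c => by
    simp only [hξ, chartD_symm_apply hq]
  have hpφ : ∀ i c, DifferentiableAt ℝ (pd c (φ i)) (e q) := fun i c =>
    ((hφ2 i).pd (m := 1) (by norm_num) c).differentiableAt (by norm_num)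
  have hsymm := e.continuousAt_symm (e.map_source hq)
  rw [ContinuousAt, e.left_inv hq] at hsymm
  -- The new coordinate fields are dual to the differentials `dφ_i`. Differentiating this duality
  -- replaces derivatives of the fields by Hessians of `φ`, which are known.
  have hdual : ∀ i b, (fun y => ∑ c, ξ b c y * pd c (φ i) y) =ᶠ[𝓝 (e q)] fun _ => kron i b := by
    intro i b
    filter_upwards [hsymm.eventually hφ.eventually_nhds, e.open_target.mem_nhds (e.map_source hq),
      hsymm.eventually (e'.open_source.mem_nhds hq')] with y hy hye hye'
    have h := chartD_change he he' (e.map_target hye) hye' hy (coordField e' b (e.symm y)) i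
    rw [chartD_coordField he' hye', e.right_inv hye] at h
    rw [← h]
    fin_cases i <;> fin_cases b <;> simp [kron]
  have hdual0 : ∀ i b, ∑ c, ξ b c (e q) * pd c (φ i) (e q) = kron i b := fun i b =>
    (hdual i b).self_of_nhds
  have hdual1 : ∀ i b d, ∑ c, (pd d (ξ b c) (e q) * pd c (φ i) (e q) +
      ξ b c (e q) * pd d (pd c (φ i)) (e q)) = 0 := fun i b d => by
    have h := pd_congr (hdual i b) d
    rw [pd_const, pd_sum _ fun c _ => (hξd b c).fun_mul (hpφ i c)] at h
    rw [← h]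
    exact Finset.sum_congr rfl fun c _ => (pd_mul (hξd b c) (hpφ i c)).symm
  rw [christoffel_eq, e'.left_inv hq', chartD_change he he' hq hq' hφ]
  simp only [chartD_conn he hq (mdifferentiableAt_coordField he' hq' b), hξq]
  have hξ' : ∀ c, (fun y => (chartD e (e.symm y) (coordField e' b (e.symm y))).ofLp c) = ξ b c :=
    fun c => rfl
  simp only [hξ']
  have k0 := hdual1 i b 0
  have k1 := hdual1 i b 1
  have ja := hdual0 i a
  have jb := hdual0 i b
  simp only [hess, Fin.sum_univ_two] at k0 k1 ja jb ⊢
  rw [← ja, ← jb]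
  linear_combination ξ a 0 (e q) * k0 + ξ a 1 (e q) * k1

end change

section flat

/-- The inverse function theorem at a point where the differential is the identity, restricted to
where both the map and its inverse are `C^6`. -/
theorem exists_openPartialHomeomorph {W : Set Plane} (hW : IsOpen W) {p : Plane} (hp : p ∈ W)
    {φ : Fin 2 → Plane → ℝ} (hφ : ∀ i, ContDiffAt ℝ 6 (φ i) p)
    (hd : ∀ i a, pd a (φ i) p = kron i a) :
    ∃ f : OpenPartialHomeomorph Plane Plane, p ∈ f.source ∧ f.source ⊆ W ∧
      (∀ x i, f x i = φ i x) ∧ ContDiffOn ℝ 6 f f.source ∧ ContDiffOn ℝ 6 f.symm f.target := by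
  set Φ : Plane → Plane := fun x => WithLp.toLp 2 fun i => φ i x with hΦ
  have hΦ6 : ContDiffAt ℝ 6 Φ p := contDiffAt_euclidean.2 hφ
  have hder : fderiv ℝ Φ p = ContinuousLinearMap.id ℝ Plane := by
    ext v i
    have h1 : fderiv ℝ (fun x => Φ x i) p v = fderiv ℝ Φ p v i := by
      have := ((EuclideanSpace.proj i : Plane →L[ℝ] ℝ).hasFDerivAt.comp p
        (hΦ6.differentiableAt (by norm_num)).hasFDerivAt).fderiv
      exact congrArg (fun L => L v) this
    rw [← h1]
    change fderiv ℝ (φ i) p v = v i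
    rw [fderiv_eq_sum_pd]
    simp only [hd]
    fin_cases i <;> simp [kron]
  have hderiv : HasFDerivAt Φ ((ContinuousLinearEquiv.refl ℝ Plane : Plane ≃L[ℝ] Plane) :
      Plane →L[ℝ] Plane) p := by
    have := (hΦ6.differentiableAt (by norm_num)).hasFDerivAt
    rwa [hder] at this
  set f₀ := hΦ6.toOpenPartialHomeomorph Φ hderiv (by norm_num) with hf₀
  have hp₀ : p ∈ f₀.source := hΦ6.mem_toOpenPartialHomeomorph_source hderiv (by norm_num)
  have hsymm : ContDiffAt ℝ 6 f₀.symm (f₀ p) := hΦ6.to_localInverse hderiv (by norm_num)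
  refine ⟨(f₀.restrContDiff ℝ 6 (by norm_num)).restrOpen W hW, ?_, ?_, fun x i => rfl, ?_, ?_⟩
  · exact ⟨⟨hp₀, hΦ6, hsymm⟩, hp⟩
  · exact fun x hx => hx.2
  · exact (f₀.contDiffOn_restrContDiff_source ℝ (n := 6) (by norm_num)).mono fun x hx => hx.1
  · exact (f₀.contDiffOn_restrContDiff_target ℝ (n := 6) (by norm_num)).mono fun x hx => hx.1

variable {S : Type*} [TopologicalSpace S] [ChartedSpace Plane S] [IsManifold (𝓡 2) 6 S]
  {conn : CovariantDerivative (𝓡 2) Plane (TangentSpace (𝓡 2) : S → Type)}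

theorem trans_mem_maximalAtlas {e : OpenPartialHomeomorph S Plane}
    (he : e ∈ IsManifold.maximalAtlas (𝓡 2) 6 S) {f : OpenPartialHomeomorph Plane Plane}
    (hf : ContDiffOn ℝ 6 f f.source) (hf' : ContDiffOn ℝ 6 f.symm f.target) :
    e ≫ₕ f ∈ IsManifold.maximalAtlas (𝓡 2) 6 S := by
  refine OpenPartialHomeomorph.mem_maximalAtlas_of_contMDiffOn _ ?_ ?_
  · exact hf.contMDiffOn.comp (I' := 𝓡 2) ((contMDiffOn_of_mem_maximalAtlas he).mono
      fun x hx => hx.1) fun x hx => hx.2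
  · exact (contMDiffOn_symm_of_mem_maximalAtlas he).comp (I' := 𝓡 2)
      (hf'.contMDiffOn.mono fun x hx => hx.1) fun x hx => hx.2

theorem projectivelyFlatOn_of_obsRow [T2Space S] (hc : conn.ContMDiffCovariantDerivative 4)
    (ht : conn.torsion = 0) {U : Set S} (hU : IsOpen U)
    (h : ∀ e ∈ IsManifold.maximalAtlas (𝓡 2) 6 S, ∀ x ∈ chartSet e U,
      obsRow (christoffel conn e) 0 x = 0) : ProjectivelyFlatOn conn U := by
  intro q hqU
  set e := chartAt Plane q with he_def
  have he : e ∈ IsManifold.maximalAtlas (𝓡 2) 6 S := IsManifold.chart_mem_maximalAtlas q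
  have hq : q ∈ e.source := mem_chart_source Plane q
  obtain ⟨W, hWo, hqW, hWV, φ, υ, hφ1, hφ⟩ := exists_flat_coordinates (isOpen_chartSet hU)
    (fun x hx => contDiffAt_christoffel he hc hx.1) (fun x hx => christoffel_symm he ht hx.1)
    (h e he) (mem_chartSet hq hqU)
  obtain ⟨f, hqf, hfW, hfφ, hf, hf'⟩ := exists_openPartialHomeomorph hWo hqW (hφ _ hqW).1 hφ1
  have he' := trans_mem_maximalAtlas he hf hf'
  refine ⟨e ≫ₕ f, he', ⟨hq, hqf⟩, ?_, ?_⟩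
  · rintro r ⟨hr, hrf⟩
    have := (hWV (hfW hrf)).2
    simpa [e.left_inv hr] using this
  · refine ⟨fun x a => ∑ d, υ d (e ((e ≫ₕ f).symm x)) *
      chartD e ((e ≫ₕ f).symm x) (coordField (e ≫ₕ f) a ((e ≫ₕ f).symm x)) d,
      fun x hx a b c => ?_⟩
    have hr := (e ≫ₕ f).map_target hx
    have hrW := hφ _ (hfW hr.2)
    have := christoffel_change he he' (φ := φ) (υ := υ) (conn := conn) hr.1 hr
      (Eventually.of_forall fun s i => hfφ (e s) i)
      (fun i => (hrW.1 i).of_le (by norm_num)) hrW.2 c a b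
    rw [(e ≫ₕ f).right_inv hx] at this
    exact this

end flat

/-! ### The obstruction in projectively flat coordinates -/

section flatObstruction

variable {Γ : Plane → Fin 2 → Fin 2 → Fin 2 → ℝ} {V : Set Plane}

/-- The first obstruction vanishes if `Γ^c_{ab} = Υ_a δ^c_b + Υ_b δ^c_a` and the Ricci tensor is
symmetric. -/
theorem obsRow_eq_zero_of_flat (hV : IsOpen V)
    (hΓ : ∀ x ∈ V, ∀ c a b, ContDiffAt ℝ 4 (fun y => Γ y c a b) x) {Υ : Plane → Fin 2 → ℝ}
    (hΥ : ∀ x ∈ V, ∀ a b c, Γ x c a b = Υ x a * kron c b + Υ x b * kron c a)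
    (hR : ∀ x ∈ V, ∀ a b, ricci Γ x a b = ricci Γ x b a) : ∀ x ∈ V, obsRow Γ 0 x = 0 := by
  -- No regularity of `Υ` is assumed; it is inherited from `Γ`, since `1 - a` is the other index.
  have hΥ' : ∀ x ∈ V, ∀ a, Υ x a = Γ x (1 - a) a (1 - a) := fun x hx a => by
    rw [hΥ x hx]
    fin_cases a <;> simp [kron]
  have hev : ∀ x ∈ V, ∀ c a b, (fun y => Γ y c a b) =ᶠ[𝓝 x]
      fun y => Υ y a * kron c b + Υ y b * kron c a := fun x hx c a b => by
    filter_upwards [hV.mem_nhds hx] with y hy using hΥ y hy a b c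
  have hC : ∀ x ∈ V, ∀ a, ContDiffAt ℝ 4 (fun y => Υ y a) x := fun x hx a =>
    (hΓ x hx (1 - a) a (1 - a)).congr_of_eventuallyEq (by
      filter_upwards [hV.mem_nhds hx] with y hy using hΥ' y hy a)
  have hd : ∀ x ∈ V, ∀ a, DifferentiableAt ℝ (fun y => Υ y a) x := fun x hx a =>
    (hC x hx a).differentiableAt (by norm_num)
  have hpd : ∀ x ∈ V, ∀ d c a b, pd d (fun y => Γ y c a b) x =
      pd d (fun y => Υ y a) x * kron c b + pd d (fun y => Υ y b) x * kron c a := by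
    intro x hx d c a b
    rw [pd_congr (hev x hx c a b), pd_add ((hd x hx a).mul_const _) ((hd x hx b).mul_const _)]
    simp only [mul_comm _ (kron _ _), pd_const_mul]
  have hric : ∀ x ∈ V, ∀ a b, ricci Γ x a b = pd b (fun y => Υ y a) x - 2 * pd a (fun y => Υ y b) x
      + Υ x a * Υ x b := by
    intro x hx a b
    simp only [ricci, curv, hpd x hx, hΥ x hx, Fin.sum_univ_two]
    fin_cases a <;> fin_cases b <;> simp [kron] <;> ring
  -- Symmetry of the Ricci tensor means that `Υ` is closed. Then `P = Υ ⊗ Υ - ∂Υ`, and its Cotton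
  -- tensor vanishes.
  have hcl : ∀ x ∈ V, ∀ a b, pd a (fun y => Υ y b) x = pd b (fun y => Υ y a) x := by
    intro x hx a b
    have := hR x hx a b
    rw [hric x hx, hric x hx] at this
    linarith
  have hP : ∀ x ∈ V, ∀ a b, schouten Γ x ![a, b] = Υ x a * Υ x b - pd a (fun y => Υ y b) x := by
    intro x hx a b
    simp only [schouten]
    simp only [Matrix.cons_val_zero, Matrix.cons_val_one]
    rw [hric x hx, hric x hx, hcl x hx b a]
    ring
  have hpdP : ∀ x ∈ V, ∀ d a b, pd d (fun y => schouten Γ y ![a, b]) x =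
      pd d (fun y => Υ y a) x * Υ x b + Υ x a * pd d (fun y => Υ y b) x
        - pd d (pd a (fun y => Υ y b)) x := by
    intro x hx d a b
    have h1 : (fun y => schouten Γ y ![a, b]) =ᶠ[𝓝 x] fun y => Υ y a * Υ y b -
        pd a (fun y => Υ y b) y := by
      filter_upwards [hV.mem_nhds hx] with y hy using hP y hy a b
    rw [pd_congr h1, pd_sub ((hd x hx a).fun_mul (hd x hx b))
      (((hC x hx b).pd (m := 3) (by norm_num) a).differentiableAt (by norm_num)),
      pd_mul (hd x hx a) (hd x hx b)]
  have hβ : ∀ x ∈ V, beta Γ unitVol x = 0 := fun x hx => by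
    rw [beta_unitVol_eq_ricci, hR x hx 1 0, sub_self, mul_zero]
  intro x hx
  have hβx : ∀ᶠ y in 𝓝 x, beta Γ unitVol y = 0 := by
    filter_upwards [hV.mem_nhds hx] with y hy using hβ y hy
  have hY : ∀ b, tensorY Γ x ![0, 1, b] = 0 := by
    intro b
    have hcomm := pd_comm ((hC x hx b).of_le (by norm_num)) 0 1
    have h01 := hcl x hx 1 0
    simp only [tensorY, Matrix.cons_val, nabla_two, hpdP x hx, hP x hx, hΥ x hx, hcomm]
    fin_cases b <;> simp [kron, h01] <;> ring
  rw [obsRow_zero, hβ x hx]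
  simp only [vecF_unitVol, nabla_skewB_eq_zero_of_beta hβx, hY]
  ext j
  fin_cases j <;> simp

end flatObstruction

/-! ### The local statements -/

section main

variable {S : Type*} [TopologicalSpace S] [T2Space S] [ChartedSpace Plane S]
  [IsManifold (𝓡 2) 6 S]
  {conn : CovariantDerivative (𝓡 2) Plane (TangentSpace (𝓡 2) : S → Type)}
  (hc : conn.ContMDiffCovariantDerivative 4) (ht : conn.torsion = 0)

include hc ht

theorem HasIndepFirstIntegrals.obsRow_eq_zero {U : Set S} (hU : IsOpen U) (hUc : IsPreconnected U)
    (h : HasIndepFirstIntegrals conn 3 U) {e : OpenPartialHomeomorph S Plane}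
    (he : e ∈ IsManifold.maximalAtlas (𝓡 2) 6 S) {x : Plane} (hx : x ∈ chartSet e U) :
    obsRow (christoffel conn e) 0 x = 0 := by
  have h0 := h.rank_add_le he hc ht hU hUc hx
  have h1 := (rank_eq_zero_iff (obstructionMatrix (christoffel conn e) unitVol x)).1 (by omega)
  exact congrFun h1 0

omit hc ht [T2Space S] in
theorem ricci_symm_of_beta {Γ : Plane → Fin 2 → Fin 2 → Fin 2 → ℝ} {x : Plane}
    (h : beta Γ unitVol x = 0) (a b : Fin 2) : ricci Γ x a b = ricci Γ x b a := by
  rw [beta_unitVol_eq_ricci] at h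
  have h' : ricci Γ x 1 0 = ricci Γ x 0 1 := by linarith
  fin_cases a <;> fin_cases b <;> simp [h']

theorem HasIndepFirstIntegrals.projectivelyFlat {U : Set S} (hU : IsOpen U)
    (hUc : IsPreconnected U) (h : HasIndepFirstIntegrals conn 3 U) :
    ProjectivelyFlatOn conn U ∧ RicciSymmetricOn conn U :=
  ⟨projectivelyFlatOn_of_obsRow hc ht hU fun _ he _ hx => h.obsRow_eq_zero hc ht hU hUc he hx,
    fun _ he _ hq => ricci_symm_of_beta
      (congrFun (h.obsRow_eq_zero hc ht hU hUc he (mem_chartSet hq.2 hq.1)) 2)⟩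

/-- The first row is computed to be zero in the flat chart. It is carried to an arbitrary chart
without a transformation law: near the point there are three independent first integrals, a notion
free of coordinates, and these force rank zero in every chart. -/
theorem obsRow_eq_zero_of_projectivelyFlat {U : Set S} (hf : ProjectivelyFlatOn conn U)
    (hR : RicciSymmetricOn conn U) {e : OpenPartialHomeomorph S Plane}
    (he : e ∈ IsManifold.maximalAtlas (𝓡 2) 6 S) {x : Plane} (hx : x ∈ chartSet e U) :
    obsRow (christoffel conn e) 0 x = 0 := by
  obtain ⟨e', he', hq', hU', Υ, hΥ⟩ := hf _ hx.2
  have h0 := obsRow_eq_zero_of_flat e'.open_target (fun x hx => contDiffAt_christoffel he' hc hx)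
    hΥ (fun y hy a b => by
      have hy' := e'.map_target hy
      have := hR e' he' _ ⟨hU' hy', hy'⟩ a b
      rwa [e'.right_inv hy] at this)
  obtain ⟨r₀, hr₀, H⟩ := exists_parallelOn_prolong (Γ := christoffel conn e') e'.open_target
    (fun x hx => contDiffAt_christoffel he' hc hx) (fun x hx => christoffel_symm he' ht hx)
    (e'.map_source hq')
  obtain ⟨r₁, hr₁, H₁⟩ := exists_chartSquare_subset hq' (univ_mem (f := 𝓝 (e.symm x)))
  have hr : 0 < min r₀ r₁ := lt_min hr₀ hr₁
  obtain ⟨hsq, -⟩ := H₁ _ (min_le_right r₀ r₁)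
  have hex := fun i => (H _ hr (min_le_left _ _)).1 (fun y hy => h0 y (hsq hy))
    (Pi.basisFun ℝ (Fin 3) i)
  choose u hu0 hu using hex
  rw [← chartSet_chartSquare hsq] at hu
  have h3 : HasIndepFirstIntegrals conn 3 (chartSquare e' (e.symm x) (min r₀ r₁)) :=
    hasIndepFirstIntegrals_of_parallelOn he' hc ht (isOpen_chartSquare _ _)
      inter_subset_left hu (mem_chartSet hq' (mem_chartSquare_self hq' hr)) (by
        simp only [hu0]
        exact (Pi.basisFun ℝ (Fin 3)).linearIndependent)
  exact h3.obsRow_eq_zero hc ht (isOpen_chartSquare _ _) (isPreconnected_chartSquare hsq) he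
    ⟨hx.1, mem_chartSquare_self hq' hr⟩

variable {e : OpenPartialHomeomorph S Plane} (he : e ∈ IsManifold.maximalAtlas (𝓡 2) 6 S)

include he

/-- The local characterisations on a square on which first integrals can be constructed. -/
theorem local_characterisation (ε : VolumeForm S) {p : S} (hp : p ∈ e.source) {O : Set S}
    (hO : O ∈ 𝓝 p) :
    ∃ U : Set S, IsOpen U ∧ IsConnected U ∧ p ∈ U ∧ U ⊆ O ∩ e.source ∧
      (IsRegularPoint conn ε e p →
        (InvariantsVanishOn conn ε e U → HasFirstIntegral conn U) ∧
        (HasExactlyFirstIntegrals conn 2 U ↔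
          TensorTVanishesOn conn ε e U ∧ ∃ q ∈ U, RicciSkewNeZeroAt conn e q)) ∧
      (HasExactlyFirstIntegrals conn 2 U →
        TensorTVanishesOn conn ε e U ∧ ∃ q ∈ U, RicciSkewNeZeroAt conn e q) ∧
      (TensorTVanishesOn conn ε e U ∧ (∀ q ∈ U, RicciSkewNeZeroAt conn e q) →
        HasExactlyFirstIntegrals conn 2 U) ∧
      (HasExactlyFirstIntegrals conn 3 U ↔
        ProjectivelyFlatOn conn U ∧ RicciSymmetricOn conn U) := by
  set Γ := christoffel conn e with hΓ
  set M := obstructionMatrix Γ unitVol with hM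
  have hxp := e.map_source hp
  obtain ⟨r₁, hr₁, H⟩ := exists_square_hasIndepFirstIntegrals he hc ht ε hp
  obtain ⟨r₂, hr₂, hsub⟩ := exists_chartSquare_subset hp hO
  have hreg : ∃ r₃ > 0, IsRegularPoint conn ε e p → ∀ r ≤ r₃, ∀ x ∈ square (e p) r,
      (M x).rank = (M (e p)).rank := by
    by_cases h : IsRegularPoint conn ε e p
    · obtain ⟨r₃, hr₃, h3⟩ := exists_square_subset ((isRegularPoint_iff he hp).1 h)
      exact ⟨r₃, hr₃, fun _ r hr x hx => h3 (square_mono hr hx)⟩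
    · exact ⟨1, one_pos, fun h' => absurd h' h⟩
  obtain ⟨r₃, hr₃, hrank⟩ := hreg
  set r := min r₁ (min r₂ r₃) with hr_def
  have hr : 0 < r := by positivity
  have hr2 : r ≤ r₂ := (min_le_right _ _).trans (min_le_left _ _)
  obtain ⟨hsq, hUO⟩ := hsub r hr2
  obtain ⟨H3, Hreg⟩ := H r hr (min_le_left _ _) hsq
  replace hrank := fun h => hrank h r ((min_le_right _ _).trans (min_le_right _ _))
  set U := chartSquare e p r with hU
  have hUo : IsOpen U := isOpen_chartSquare _ _
  have hUc := isConnected_chartSquare hp hr hsq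
  have hcs : chartSet e U = square (e p) r := chartSet_chartSquare hsq
  have hv : ∀ x ∈ square (e p) r, ε.comp e x ≠ 0 := fun x hx => ε.comp_ne_zero he (hsq hx)
  have hpU : p ∈ U := mem_chartSquare_self hp hr
  have hsquare : ∀ x ∈ square (e p) r, e.symm x ∈ U ∩ e.source ∧ e (e.symm x) = x := by
    intro x hx
    rw [← hcs] at hx
    exact ⟨⟨hx.2, e.map_target hx.1⟩, e.right_inv hx.1⟩
  have hT : TensorTVanishesOn conn ε e U ↔
      ∀ x ∈ square (e p) r, ∀ a b, tensorT Γ (ε.comp e) x a b = 0 := by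
    constructor
    · intro h x hx
      have := h _ (hsquare x hx).1
      rwa [(hsquare x hx).2] at this
    · exact fun h q hq => h _ hq.1.2
  have hrk : ∀ {n}, HasIndepFirstIntegrals conn n U → ∀ x ∈ square (e p) r,
      (M x).rank + n ≤ 3 := fun h x hx =>
    h.rank_add_le he hc ht hUo hUc.isPreconnected (by rwa [hcs])
  have hskew : ∀ q, RicciSkewNeZeroAt conn e q ↔ beta Γ unitVol (e q) ≠ 0 := fun q =>
    ricciSkew_ne_zero_iff
  have hno4 : ¬ HasIndepFirstIntegrals conn 4 U := fun h => by
    have := hrk h (e p) (mem_square_self hr)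
    omega
  have hinv : (∀ x ∈ square (e p) r, (M x).rank ≤ 1) → InvariantsVanishOn conn ε e U := by
    intro h q hq
    have h1 := h _ hq.1.2
    have hvq := hv _ hq.1.2
    have hW : ∀ a, tensorW Γ (ε.comp e) (e q) a a a = 0 := fun a => by
      rw [tensorW_eq hvq, det3_rowU_eq_zero h1, mul_zero]
    refine ⟨?_, ?_⟩
    · rw [invN_eq hvq, det3_obsRow_eq_zero (h1.trans one_le_two), mul_zero]
    · rw [invS, hW, hW]; rfl
  have htwo : HasExactlyFirstIntegrals conn 2 U →
      TensorTVanishesOn conn ε e U ∧ ∃ q ∈ U, RicciSkewNeZeroAt conn e q := by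
    rintro ⟨h2, h3⟩
    have hT0 : ∀ x ∈ square (e p) r, ∀ a b, tensorT Γ (ε.comp e) x a b = 0 := fun x hx =>
      tensorT_eq_zero_of_rank_le_one (hv x hx) (Nat.le_of_add_le_add_right (hrk h2 x hx))
    refine ⟨hT.2 hT0, ?_⟩
    by_contra! hne
    -- If the Ricci tensor were symmetric on all of `U`, then `T = 0` would kill the first row and
    -- produce a third first integral.
    refine h3 (H3 fun x hx => obsRow_zero_eq_zero_of_tensorT (hv x hx) (hT0 x hx) ?_)
    filter_upwards [(isOpen_square _ _).mem_nhds hx] with y hy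
    obtain ⟨hyU, hye⟩ := hsquare y hy
    have := hne _ hyU.1
    rw [hskew, hye, not_not] at this
    exact this
  have hexact : IsRegularPoint conn ε e p → (∀ x ∈ square (e p) r, (M x).rank = 1) →
      HasExactlyFirstIntegrals conn 2 U := by
    intro hregp h1
    have hp1 := h1 _ (mem_square_self hr)
    refine ⟨Hreg hregp (hinv fun x hx => (h1 x hx).le) 2 (by rw [hp1]), fun h3 => ?_⟩
    have := hrk h3 _ (mem_square_self hr)
    omega
  refine ⟨U, hUo, hUc, hpU, hUO, fun hregp => ⟨fun hI => ?_, htwo, ?_⟩, htwo, ?_, ?_, ?_⟩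
  · have h2 : (M (e p)).rank ≤ 2 := by
      refine rank_le_two_of_det3 ?_
      have := (hI p ⟨hpU, hp⟩).1
      rw [invN_eq (hv _ (mem_square_self hr))] at this
      exact (mul_eq_zero.1 this).resolve_left
        (pow_ne_zero _ (inv_ne_zero (hv _ (mem_square_self hr))))
    exact hasFirstIntegral_iff.2 (Hreg hregp hI 1 (Nat.add_le_add_right h2 1))
  · rintro ⟨hT0, q, hqU, hq⟩
    rw [hT] at hT0
    have hq1 := rank_eq_one_of_tensorT (hv _ hqU.2) (hT0 _ hqU.2) ((hskew q).1 hq)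
    refine hexact hregp fun x hx => ?_
    rw [hrank hregp x hx, ← hrank hregp _ hqU.2]
    exact hq1
  · rintro ⟨hT0, hne⟩
    rw [hT] at hT0
    have h1 : ∀ x ∈ square (e p) r, (M x).rank = 1 := fun x hx => by
      refine rank_eq_one_of_tensorT (hv x hx) (hT0 x hx) ?_
      obtain ⟨hxU, hxe⟩ := hsquare x hx
      have := (hskew _).1 (hne _ hxU.1)
      rwa [hxe] at this
    -- Here regularity is a consequence: the rank is one at every point of the square.
    refine hexact ((isRegularPoint_iff he hp).2 ?_) h1
    filter_upwards [square_mem_nhds hr] with x hx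
    exact (h1 x hx).trans (h1 _ (mem_square_self hr)).symm
  · exact fun h => h.1.projectivelyFlat hc ht hUo hUc.isPreconnected
  · rintro ⟨hf, hR⟩
    exact ⟨H3 fun x hx => obsRow_eq_zero_of_projectivelyFlat hc ht hf hR he (by rwa [hcs]), hno4⟩

end main

end AffineSurface

open AffineSurface
theorem theorem5p1 {S : Type*} [TopologicalSpace S] [T2Space S]
    [ChartedSpace Plane S] [IsManifold (𝓡 2) 6 S]
    (conn : CovariantDerivative (𝓡 2) Plane (TangentSpace (𝓡 2) : S → Type))
    (hsmooth : conn.ContMDiffCovariantDerivative 4) (htorsion : conn.torsion = 0)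
    (ε : VolumeForm S) :
    -- necessity of `I_N = I_S = 0`
    (∀ U : Set S, IsOpen U → IsConnected U → HasFirstIntegral conn U →
      ∀ e ∈ IsManifold.maximalAtlas (𝓡 2) 6 S, InvariantsVanishOn conn ε e U) ∧
    -- regular points are dense (they form an open set by definition)
    (∀ e ∈ IsManifold.maximalAtlas (𝓡 2) 6 S,
      e.source ⊆ closure {p ∈ e.source | IsRegularPoint conn ε e p}) ∧
    -- local statements, in arbitrary local coordinates around an arbitrary point
    (∀ e ∈ IsManifold.maximalAtlas (𝓡 2) 6 S, ∀ p ∈ e.source, ∀ O ∈ 𝓝 p,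
      ∃ U : Set S, IsOpen U ∧ IsConnected U ∧ p ∈ U ∧ U ⊆ O ∩ e.source ∧
        (IsRegularPoint conn ε e p →
          (InvariantsVanishOn conn ε e U → HasFirstIntegral conn U) ∧
          (HasExactlyFirstIntegrals conn 2 U ↔
            TensorTVanishesOn conn ε e U ∧ ∃ q ∈ U, RicciSkewNeZeroAt conn e q)) ∧
        (HasExactlyFirstIntegrals conn 2 U →
          TensorTVanishesOn conn ε e U ∧ ∃ q ∈ U, RicciSkewNeZeroAt conn e q) ∧
        (TensorTVanishesOn conn ε e U ∧ (∀ q ∈ U, RicciSkewNeZeroAt conn e q) →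
          HasExactlyFirstIntegrals conn 2 U) ∧
        (HasExactlyFirstIntegrals conn 3 U ↔
          ProjectivelyFlatOn conn U ∧ RicciSymmetricOn conn U)) :=
  ⟨fun _ hU hUc h _ he => h.invariants he hsmooth htorsion hU hUc.isPreconnected ε,
    fun _ he => subset_closure_regular he hsmooth ε,
    fun _ he _ hp _ hO => local_characterisation hsmooth htorsion he ε hp hO⟩
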